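/- **Setting.** Let $K\ge 1$. A decision maker (DM) faces an unknown state vector $\theta=(\theta_1,\dots,\theta_K)'\sim\mathcal N(\mu^0,V^0)$ with $V^0$ positive definite. An observation of source $k\in\{1,\dots,K\}$ is $X_k=\langle c_k,\theta\rangle+\epsilon_k$ with $\epsilon_k\sim\mathcal N(0,\sigma_k^2)$, $\sigma_k^2>0$, where all noise terms are independent of each other and of $\theta$. The matrix $C$ with rows $c_1',\dots,c_K'$ is invertible and the first row of $C^{-1}$ has no zero entry. In each period $t=1,2,\dots$ the DM chooses, as a measurable function of the history of observations, a finite multiset of sources, whose size $N_t\in\mathbb Z_+$ (the intensity) is chosen freely, then sees the signal realizations, and then chooses an action $a_t\in A_t$ as a measurable function of the history. The payoff is $$U(a_1,a_2,\dots;\theta_1)-\sum_{t\ge1}\delta^{t-1}\kappa(N_t),$$ where $A_1,A_2,\dots$ are arbitrary measurable spaces, $U$ is an arbitrary measurable real function, $\delta\in(0,1]$, and $\kappa:\mathbb Z_+\to[0,\infty]$ with $\kappa(0)=0$ is a cost function (typically increasing, but this is not needed). Only strategies for which the positive part of the payoff has finite expectation are compared; their expected payoffs lie in $[-\infty,\infty)$.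 Let $f(q_1,\dots,q_K)=\big[\big((V^0)^{-1}+C'\,\mathrm{diag}(q_1/\sigma_1^2,\dots,q_K/\sigma_K^2)\,C\big)^{-1}\big]_{11}$ be the posterior variance of $\theta_1$ after $q_k\in\mathbb Z_+$ observations of each source $k$. The environment $(V^0,C,\{\sigma_k^2\})$ is *separable* if there are convex functions $g_1,\dots,g_K:[0,\infty)\to(-\infty,+\infty]$ and a function $F$, strictly increasing on the set of values taken by the sum, such that $f(q_1,\dots,q_K)=F(g_1(q_1)+\dots+g_K(q_K))$ for all $q\in\mathbb Z_+^K$. A strategy *chooses signals myopically* if at every history, given the number $N_t$ of signals that it acquires in that period, the multiset it acquires minimizes the resulting posterior variance of $\theta_1$ among all multisets of $N_t$ sources. **Statement.** (a) There is $B_0$, depending only on $(V^0,C,\{\sigma_k^2\})$, such that the following holds for every $B\ge B_0$, every $\mu^0$ and all $A_t$, $U$, $\delta$, $\kappa$ with $\kappa(B)\le\kappa(N)$ for $1\le N\le B$ (acquiring between $1$ and $B$ signals is never cheaper than acquiring $B$; for example $\kappa=0$ on $\{0,\dots,B\}$, or $\kappa=\infty$ on $\{1,\dots,B-1\}$): every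 strategy is weakly dominated, in expected payoff, by a strategy that chooses signals myopically; in particular, if the DM has an optimal strategy, then he has one that chooses signals myopically. (b) If the environment is separable, the same conclusion holds for every $\mu^0$ and all $A_t$, $U$, $\delta$, $\kappa$. -/

import Mathlib

open MeasureTheory ProbabilityTheory
open scoped NNReal ENNReal Matrix

universe u

namespace SignalAcquisition

/-! ### The informational environment -/

/-- The data `(V⁰, C, {σ_k²})` of a Gaussian informational environment with `K` states and `K`
sources. An observation of source `k` is `⟨c_k, θ⟩ + ε_k`, where `c_k` is the `k`-th row of `C`
and `ε_k ∼ 𝒩(0, σ_k²)`. -/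
structure InfoEnv (K : ℕ) where
  /-- prior covariance matrix of the state vector -/
  V₀ : Matrix (Fin K) (Fin K) ℝ
  /-- coefficient matrix of the sources -/
  C : Matrix (Fin K) (Fin K) ℝ
  /-- noise variances of the sources -/
  sigmaSq : Fin K → ℝ≥0

namespace InfoEnv

variable {K : ℕ}

/-- Non-redundancy: `C` is invertible and the first row of `C⁻¹` has only non-zero entries (so that
`e₁` is not spanned by any proper subset of the rows of `C`). The payoff-relevant state `θ₁` has
index `0`. -/
def NonRedundant [NeZero K] (E : InfoEnv K) : Prop :=
  IsUnit E.C ∧ ∀ k, E.C⁻¹ 0 k ≠ 0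

/-- The posterior variance `f(q₁, …, q_K)` of `θ₁` after `q_k` observations of each source `k`: the
`(1,1)` entry of the Gaussian posterior covariance matrix `((V⁰)⁻¹ + Cᵀ D C)⁻¹`, where
`D = diag(q_k / σ_k²)`. It does not depend on the realizations. -/
noncomputable def posteriorVar [NeZero K] (E : InfoEnv K) (q : Fin K → ℕ) : ℝ :=
  (E.V₀⁻¹ + E.Cᵀ * Matrix.diagonal (fun k => (q k : ℝ) / (E.sigmaSq k : ℝ)) * E.C)⁻¹ 0 0

/-- A convex function `[0, ∞) → (-∞, +∞]`. -/
def IsConvex (g : ℝ≥0 → EReal) : Prop :=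
  (∀ x, g x ≠ ⊥) ∧
    ∀ x y a b : ℝ≥0, 0 < a → 0 < b → a + b = 1 →
      g (a * x + b * y) ≤ ((a : ℝ) : EReal) * g x + ((b : ℝ) : EReal) * g y

/-- Separability: `f(q₁, …, q_K) = F(g₁(q₁) + ⋯ + g_K(q_K))` for all signal counts, with convex
`g_k` and with `F` strictly increasing on the values that the sum takes. The value `+∞` is allowed
for the `g_k`, as in `g(q) = σ² / q` at `q = 0`. -/
def Separable [NeZero K] (E : InfoEnv K) : Prop :=
  ∃ (g : Fin K → ℝ≥0 → EReal) (F : EReal → ℝ),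
    (∀ k, IsConvex (g k)) ∧
    StrictMonoOn F (Set.range fun q : Fin K → ℕ => ∑ k, g k (q k)) ∧
    ∀ q : Fin K → ℕ, E.posteriorVar q = F (∑ k, g k (q k))

end InfoEnv

/-! ### Histories and strategies -/

/-- What is observed in one period: how many times each source is sampled, and the resulting signal
realizations. -/
abbrev Observation (K : ℕ) : Type :=
  Σ n : Fin K → ℕ, ((k : Fin K) → Fin (n k) → ℝ)

/-- What has been observed in the first `t` periods. -/
abbrev History (K t : ℕ) : Type := Fin t → Observation K

/-- The number of past observations of each source. -/
def History.counts {K t : ℕ} (h : History K t) : Fin K → ℕ :=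
  fun k => ∑ i, (h i).1 k

/-- A (pure) strategy. Periods are numbered `0, 1, 2, …`. In each period the DM first chooses, as a
function of the history, a multiset of sources (given by its multiplicities; its size is the
intensity), then observes the signals, and then chooses an action. -/
structure Strategy (K : ℕ) (A : ℕ → Type u) [∀ t, MeasurableSpace (A t)] where
  /-- information acquisition strategy -/
  acquire : ∀ t, History K t → (Fin K → ℕ)
  measurable_acquire : ∀ t, Measurable (acquire t)
  /-- decision strategy -/
  act : ∀ t, History K (t + 1) → A t
  measurable_act : ∀ t, Measurable (act t)

/-- The acquisition strategy chooses signals myopically given its intensities: at every history, the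
chosen multiset minimizes the next posterior variance of `θ₁` among all multisets of the same
size. -/
def Strategy.Myopic {K : ℕ} [NeZero K] {A : ℕ → Type u} [∀ t, MeasurableSpace (A t)]
    (s : Strategy K A) (E : InfoEnv K) : Prop :=
  ∀ t (h : History K t) (m : Fin K → ℕ), ∑ k, m k = ∑ k, s.acquire t h k →
    E.posteriorVar (h.counts + s.acquire t h) ≤ E.posteriorVar (h.counts + m)

/-! ### The probability model -/

/-- An outcome: the state vector `θ`, and for all `t`, `k`, `j` the noise in the `j`-th observation
of source `k` in period `t`. -/
abbrev Outcome (K : ℕ) : Type := EuclideanSpace ℝ (Fin K) × (ℕ × Fin K × ℕ → ℝ)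

/-- The law of the outcome: `θ ∼ 𝒩(μ⁰, V⁰)`, the noise terms are `𝒩(0, σ_k²)`, and all of these are
independent. -/
noncomputable def law {K : ℕ} (E : InfoEnv K) (μ₀ : EuclideanSpace ℝ (Fin K)) :
    Measure (Outcome K) :=
  (multivariateGaussian μ₀ E.V₀).prod
    (Measure.infinitePi fun i : ℕ × Fin K × ℕ => gaussianReal 0 (E.sigmaSq i.2.1))

/-- The `j`-th observation of source `k` in period `t`. -/
noncomputable def signal {K : ℕ} (E : InfoEnv K) (ω : Outcome K) (t : ℕ) (k : Fin K) (j : ℕ) : ℝ :=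
  (∑ i, E.C k i * ω.1 i) + ω.2 (t, k, j)

/-- The history of the first `t` periods that a strategy generates. -/
noncomputable def Strategy.history {K : ℕ} {A : ℕ → Type u} [∀ t, MeasurableSpace (A t)]
    (s : Strategy K A) (E : InfoEnv K) (ω : Outcome K) : (t : ℕ) → History K t
  | 0 => Fin.elim0
  | t + 1 => Fin.snoc (α := fun _ => Observation K) (s.history E ω t)
      ⟨s.acquire t (s.history E ω t), fun k j => signal E ω t k j⟩

/-! ### Payoffs -/

/-- A decision problem with endogenous intensities: an arbitrary (measurable) payoff function
`U(a₁, a₂, …; θ₁)`, a flow cost `κ` with `κ(0) = 0` of the number of signals acquired in a period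
(the value `∞` is allowed), a discount factor `δ`, and the prior mean `μ⁰` of the states. -/
structure DecisionProblem (K : ℕ) (A : ℕ → Type u) [∀ t, MeasurableSpace (A t)] where
  /-- gross payoff -/
  U : ((t : ℕ) → A t) → ℝ → ℝ
  measurable_U : Measurable (Function.uncurry U)
  /-- flow cost of information acquisition -/
  κ : ℕ → ℝ≥0∞
  κ_zero : κ 0 = 0
  /-- discount factor -/
  δ : ℝ
  δ_pos : 0 < δ
  δ_le_one : δ ≤ 1
  /-- prior mean -/
  μ₀ : EuclideanSpace ℝ (Fin K)

namespace DecisionProblem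

variable {K : ℕ} [NeZero K] {A : ℕ → Type u} [∀ t, MeasurableSpace (A t)]

/-- The discounted total cost of information acquisition; the first period, which is not discounted,
has index `0`. -/
noncomputable def totalCost (P : DecisionProblem K A) (E : InfoEnv K) (s : Strategy K A)
    (ω : Outcome K) : ℝ≥0∞ :=
  ∑' t, ENNReal.ofReal P.δ ^ t * P.κ (∑ k, s.acquire t (s.history E ω t) k)

/-- The realized payoff `U(a₁, a₂, …; θ₁)` minus the total cost of information. -/
noncomputable def payoff (P : DecisionProblem K A) (E : InfoEnv K) (s : Strategy K A)
    (ω : Outcome K) : EReal :=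
  ((P.U (fun t => s.act t (s.history E ω (t + 1))) (ω.1 0) : ℝ) : EReal)
    - (P.totalCost E s ω : EReal)

/-- The expected payoff of `s` is well defined in `[-∞, ∞)`: the positive part of the payoff is
integrable. -/
def WellDefined (P : DecisionProblem K A) (E : InfoEnv K) (s : Strategy K A) : Prop :=
  ∫⁻ ω, (P.payoff E s ω).toENNReal ∂(law E P.μ₀) < ∞

/-- The expected payoff of `s`: expected positive part minus expected negative part. -/
noncomputable def expectedPayoff (P : DecisionProblem K A) (E : InfoEnv K) (s : Strategy K A) :
    EReal :=
  ((∫⁻ ω, (P.payoff E s ω).toENNReal ∂(law E P.μ₀) : ℝ≥0∞) : EReal)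
    - ((∫⁻ ω, (-P.payoff E s ω).toENNReal ∂(law E P.μ₀) : ℝ≥0∞) : EReal)

/-- `s` maximizes the expected payoff among all strategies whose expected payoff is well defined. -/
def IsOptimal (P : DecisionProblem K A) (E : InfoEnv K) (s : Strategy K A) : Prop :=
  P.WellDefined E s ∧
    ∀ s' : Strategy K A, P.WellDefined E s' → P.expectedPayoff E s' ≤ P.expectedPayoff E s

/-- Choosing signals myopically is optimal: every strategy is weakly dominated, in expected payoff,
by one that chooses signals myopically; and if there is an optimal strategy, then there is one that
chooses signals myopically. -/
def MyopicOptimal (P : DecisionProblem K A) (E : InfoEnv K) : Prop :=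
  (∀ s : Strategy K A, P.WellDefined E s →
    ∃ s' : Strategy K A, s'.Myopic E ∧ P.WellDefined E s' ∧
      P.expectedPayoff E s ≤ P.expectedPayoff E s') ∧
  ((∃ s : Strategy K A, P.IsOptimal E s) →
    ∃ s : Strategy K A, P.IsOptimal E s ∧ s.Myopic E)

end DecisionProblem

end SignalAcquisition

/-! The argument is a comparison of experiments carried out dynamically. Given the signal counts,
the posterior of `θ₁` is Gaussian with a variance that does not depend on the realizations, and
payoffs involve the state only through `θ₁`. So a DM whose counts `c` always give a variance no
larger than the counts `q` of a strategy `s` can imitate `s`. He keeps a fictitious history of `s`,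
and after each period he draws a fictitious block of signals from his own posterior mean of `θ₁` and
independent noise. Conditionally on the fictitious history, his actual posterior mean is Gaussian
around the fictitious one, with variance `f(q) - f(c)` (`lintegral_fictHist`); the one-period step
is Gaussian regression (`map_simulate_eq`). Hence the fictitious history and `θ₁` have the joint law
of the history of `s` and `θ₁` (`lintegral_fictHist_state`). Playing the actions of `s` at the
fictitious history gives the same gross payoff in law, and some fixed realization of the extra noise
does at least as well as its average (`exists_le_sub`).

It remains to keep `f(c) ≤ f(q)` while choosing signals myopically; this is `IsSimulationInvariant`.
In a separable environment, an exchange argument with convexity shows that a myopic block leads from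
optimal counts to optimal counts (`Separable.add_bestBlock`), so equal intensities suffice. In
general, optimal counts are proportional to `|(C⁻¹)₁ₖ| σₖ` up to a bounded error, and myopic blocks
preserve this balance once the counts are large (`exists_balance_const`). Therefore counts that are
balanced and ahead by a fixed number `D` of signals dominate, source by source, some optimal counts
for the smaller total. The lead is gained by raising intensities between `1` and `B` to `B ≥ D`,
which costs no more; until the lead is reached, every nonempty block has at least `D` signals, and
such a large myopic block leads from optimal counts to optimal counts
(`exists_simulationInvariant`).

Infinite values need care. Raised intensities save only a bounded amount in total (`tsum_cost_le`),
so the positive part of the payoff stays integrable. When this bound is unavailable, `s` has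
expected payoff `-∞` and any well-defined myopic strategy dominates it. -/

namespace SignalAcquisition

/-! ### Matrix algebra of Gaussian precisions and posterior covariances. -/

namespace InfoEnv

variable {K : ℕ}

/-- The Fisher information about the state vector of `q k` observations of each source `k`. -/
noncomputable def obsInfo (E : InfoEnv K) (q : Fin K → ℕ) : Matrix (Fin K) (Fin K) ℝ :=
  E.Cᵀ * Matrix.diagonal (fun k => (q k : ℝ) / (E.sigmaSq k : ℝ)) * E.C

/-- The posterior covariance matrix of the state vector. -/
noncomputable def postCov (E : InfoEnv K) (q : Fin K → ℕ) : Matrix (Fin K) (Fin K) ℝ :=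
  (E.V₀⁻¹ + E.obsInfo q)⁻¹

lemma obsInfo_add (E : InfoEnv K) (q n : Fin K → ℕ) :
    E.obsInfo (q + n) = E.obsInfo q + E.obsInfo n := by
  have h : Matrix.diagonal (fun k => (((q + n) k : ℕ) : ℝ) / (E.sigmaSq k : ℝ)) =
      Matrix.diagonal (fun k => (q k : ℝ) / (E.sigmaSq k : ℝ)) +
        Matrix.diagonal (fun k => (n k : ℝ) / (E.sigmaSq k : ℝ)) := by
    rw [Matrix.diagonal_add]
    congr 1
    ext k
    simp [add_div]
  simp only [obsInfo, h, Matrix.mul_add, Matrix.add_mul]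

lemma dotProduct_obsInfo (E : InfoEnv K) (q : Fin K → ℕ) (x y : Fin K → ℝ) :
    x ⬝ᵥ (E.obsInfo q *ᵥ y) =
      ∑ k, (q k : ℝ) / (E.sigmaSq k : ℝ) * ((E.C *ᵥ x) k * (E.C *ᵥ y) k) := by
  rw [obsInfo, ← Matrix.mulVec_mulVec, ← Matrix.mulVec_mulVec, Matrix.dotProduct_mulVec,
    Matrix.vecMul_transpose, dotProduct]
  refine Finset.sum_congr rfl fun k _ => ?_
  rw [Matrix.mulVec_diagonal]
  ring

lemma obsInfo_posSemidef (E : InfoEnv K) (q : Fin K → ℕ) : (E.obsInfo q).PosSemidef := by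
  have h := (Matrix.PosSemidef.diagonal (d := fun k => (q k : ℝ) / (E.sigmaSq k : ℝ))
    (fun k => by positivity)).conjTranspose_mul_mul_same E.C
  simpa [obsInfo, Matrix.conjTranspose_eq_transpose_of_trivial] using h

lemma precision_posDef (E : InfoEnv K) (hV : E.V₀.PosDef) (q : Fin K → ℕ) :
    (E.V₀⁻¹ + E.obsInfo q).PosDef :=
  hV.inv.add_posSemidef (E.obsInfo_posSemidef q)

lemma postCov_posDef (E : InfoEnv K) (hV : E.V₀.PosDef) (q : Fin K → ℕ) :
    (E.postCov q).PosDef :=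
  (E.precision_posDef hV q).inv

lemma postCov_zero (E : InfoEnv K) (hV : E.V₀.PosDef) : E.postCov 0 = E.V₀ := by
  have h : E.obsInfo 0 = 0 := by simp [obsInfo]
  rw [postCov, h, add_zero, Matrix.nonsing_inv_nonsing_inv]
  exact (Matrix.isUnit_iff_isUnit_det _).1 hV.isUnit

lemma postCov_transpose (E : InfoEnv K) (hV : E.V₀.PosDef) (q : Fin K → ℕ) :
    (E.postCov q)ᵀ = E.postCov q := by
  have := (E.postCov_posDef hV q).isHermitian
  rwa [Matrix.IsHermitian, Matrix.conjTranspose_eq_transpose_of_trivial] at this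

lemma precision_mul_postCov (E : InfoEnv K) (hV : E.V₀.PosDef) (q : Fin K → ℕ) :
    (E.V₀⁻¹ + E.obsInfo q) * E.postCov q = 1 :=
  Matrix.mul_nonsing_inv _ ((Matrix.isUnit_iff_isUnit_det _).1 (E.precision_posDef hV q).isUnit)

lemma postCov_mul_precision (E : InfoEnv K) (hV : E.V₀.PosDef) (q : Fin K → ℕ) :
    E.postCov q * (E.V₀⁻¹ + E.obsInfo q) = 1 :=
  Matrix.nonsing_inv_mul _ ((Matrix.isUnit_iff_isUnit_det _).1 (E.precision_posDef hV q).isUnit)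

/-- The resolvent identity `P⁻¹ - Q⁻¹ = P⁻¹ (Q - P) Q⁻¹` for the precisions before and after a
block. -/
lemma postCov_update (E : InfoEnv K) (hV : E.V₀.PosDef) (q n : Fin K → ℕ) :
    E.postCov q * E.obsInfo n * E.postCov (q + n) + E.postCov (q + n) = E.postCov q := by
  have h : E.postCov q * ((E.V₀⁻¹ + E.obsInfo (q + n)) * E.postCov (q + n)) = E.postCov q := by
    rw [precision_mul_postCov E hV, mul_one]
  rw [obsInfo_add, ← add_assoc, Matrix.add_mul, Matrix.mul_add, ← Matrix.mul_assoc,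
    postCov_mul_precision E hV, Matrix.one_mul, ← Matrix.mul_assoc] at h
  rw [add_comm]
  exact h

lemma dual_expand (E : InfoEnv K) (q : Fin K → ℕ) (y : Fin K → ℝ) :
    y ⬝ᵥ ((E.V₀⁻¹ + E.obsInfo q) *ᵥ y) =
      y ⬝ᵥ (E.V₀⁻¹ *ᵥ y) + ∑ k, (q k : ℝ) / (E.sigmaSq k : ℝ) * ((E.C *ᵥ y) k) ^ 2 := by
  rw [Matrix.add_mulVec, dotProduct_add, dotProduct_obsInfo]
  simp only [pow_two]

/-! ### The posterior variance as the maximum of a concave quadratic objective. -/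

section variational

variable [NeZero K]

lemma posteriorVar_pos (E : InfoEnv K) (hV : E.V₀.PosDef) (q : Fin K → ℕ) :
    0 < E.posteriorVar q :=
  (E.postCov_posDef hV q).diag_pos

/-- The posterior covariances of the payoff-relevant state with all states. -/
noncomputable def covRow (E : InfoEnv K) (q : Fin K → ℕ) : Fin K → ℝ :=
  E.postCov q *ᵥ Pi.single 0 1

lemma covRow_zero (E : InfoEnv K) (q : Fin K → ℕ) : E.covRow q 0 = E.posteriorVar q := by
  simp only [covRow, Matrix.mulVec_single_one, Matrix.col_apply]
  rfl

/-- The posterior covariances of the payoff-relevant state with the signal means. -/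
noncomputable def sourceCov (E : InfoEnv K) (q : Fin K → ℕ) : Fin K → ℝ :=
  E.C *ᵥ E.covRow q

lemma precision_covRow (E : InfoEnv K) (hV : E.V₀.PosDef) (q : Fin K → ℕ) :
    (E.V₀⁻¹ + E.obsInfo q) *ᵥ E.covRow q = Pi.single 0 1 := by
  rw [covRow, Matrix.mulVec_mulVec, precision_mul_postCov E hV, Matrix.one_mulVec]

/-- The quadratic objective whose maximum over `y` is the posterior variance. -/
lemma dual_le_posteriorVar (E : InfoEnv K) (hV : E.V₀.PosDef) (q : Fin K → ℕ) (y : Fin K → ℝ) :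
    2 * y 0 - y ⬝ᵥ ((E.V₀⁻¹ + E.obsInfo q) *ᵥ y) ≤ E.posteriorVar q := by
  set P := E.V₀⁻¹ + E.obsInfo q with hP
  have hPd : P.PosDef := E.precision_posDef hV q
  set b := E.covRow q with hb
  have hPb : P *ᵥ b = Pi.single 0 1 := E.precision_covRow hV q
  have h := hPd.posSemidef.dotProduct_mulVec_nonneg (y - b)
  have hsym : b ⬝ᵥ (P *ᵥ y) = y 0 := by
    have hPt : Pᵀ = P := by
      have := hPd.isHermitian
      rwa [Matrix.IsHermitian, Matrix.conjTranspose_eq_transpose_of_trivial] at this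
    rw [Matrix.dotProduct_mulVec, ← Matrix.mulVec_transpose, hPt, hPb]
    simp
  simp only [star_trivial, Matrix.mulVec_sub, sub_dotProduct, dotProduct_sub, hPb, hsym] at h
  simp only [dotProduct_single, mul_one] at h
  rw [hb, covRow_zero] at h
  linarith

lemma posteriorVar_eq_dual (E : InfoEnv K) (hV : E.V₀.PosDef) (q : Fin K → ℕ) :
    E.covRow q ⬝ᵥ ((E.V₀⁻¹ + E.obsInfo q) *ᵥ E.covRow q) = E.posteriorVar q := by
  rw [precision_covRow E hV]
  simp [covRow_zero]

/-- The dual objective is affine in the counts, and the maximizer `covRow q'` for `q'` is a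
competitor at `q`. This is the subgradient inequality of the convex function `f` at `q'`: the
marginal value of source `k` there is `sourceCov² / σ²`. -/
lemma posteriorVar_compare (E : InfoEnv K) (hV : E.V₀.PosDef) (q q' : Fin K → ℕ) :
    E.posteriorVar q' +
        ∑ k, ((q' k : ℝ) - q k) / (E.sigmaSq k : ℝ) * (E.sourceCov q' k) ^ 2 ≤
      E.posteriorVar q := by
  have h := E.dual_le_posteriorVar hV q (E.covRow q')
  have h2 := E.posteriorVar_eq_dual hV q'
  rw [dual_expand] at h h2
  rw [covRow_zero] at h
  have : ∑ k, ((q' k : ℝ) - q k) / (E.sigmaSq k : ℝ) * (E.sourceCov q' k) ^ 2 =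
      ∑ k, (q' k : ℝ) / (E.sigmaSq k : ℝ) * ((E.C *ᵥ E.covRow q') k) ^ 2 -
      ∑ k, (q k : ℝ) / (E.sigmaSq k : ℝ) * ((E.C *ᵥ E.covRow q') k) ^ 2 := by
    rw [← Finset.sum_sub_distrib]
    refine Finset.sum_congr rfl fun k _ => ?_
    rw [sourceCov]; ring
  rw [this]
  linarith

lemma posteriorVar_antitone (E : InfoEnv K) (hV : E.V₀.PosDef) {q q' : Fin K → ℕ}
    (h : q ≤ q') : E.posteriorVar q' ≤ E.posteriorVar q := by
  refine le_trans ?_ (E.posteriorVar_compare hV q q')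
  have : 0 ≤ ∑ k, ((q' k : ℝ) - q k) / (E.sigmaSq k : ℝ) * (E.sourceCov q' k) ^ 2 := by
    refine Finset.sum_nonneg fun k _ => mul_nonneg (div_nonneg ?_ (by positivity)) (by positivity)
    have : (q k : ℝ) ≤ q' k := by exact_mod_cast h k
    linarith
  linarith

lemma posteriorVar_le_two_mul (E : InfoEnv K) (hV : E.V₀.PosDef) {q q' : Fin K → ℕ}
    (h : ∀ k, q k ≤ 2 * q' k) : E.posteriorVar q' ≤ 2 * E.posteriorVar q := by
  -- Halving the maximizer for `q'` divides the quadratic term by four, which absorbs the doubling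
  -- of the counts and leaves half of `posteriorVar q'`.
  have h1 := E.dual_le_posteriorVar hV q ((1 / 2 : ℝ) • E.covRow q')
  have h2 := E.posteriorVar_eq_dual hV q'
  have h3 : 0 ≤ E.covRow q' ⬝ᵥ (E.V₀⁻¹ *ᵥ E.covRow q') := by
    simpa using hV.inv.posSemidef.dotProduct_mulVec_nonneg (E.covRow q')
  rw [Matrix.mulVec_smul, smul_dotProduct, dotProduct_smul, dual_expand] at h1
  rw [dual_expand] at h2
  simp only [Pi.smul_apply, covRow_zero, smul_eq_mul] at h1
  have h4 : ∑ k, (q k : ℝ) / (E.sigmaSq k : ℝ) * ((E.C *ᵥ E.covRow q') k) ^ 2 ≤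
      2 * ∑ k, (q' k : ℝ) / (E.sigmaSq k : ℝ) * ((E.C *ᵥ E.covRow q') k) ^ 2 := by
    rw [Finset.mul_sum]
    refine Finset.sum_le_sum fun k _ => ?_
    rw [← mul_assoc, ← mul_div_assoc]
    gcongr
    exact_mod_cast h k
  linarith

/-- The posterior variance as a linear functional of the covariances with the sources. -/
lemma posteriorVar_eq_sum (E : InfoEnv K) (hC : E.NonRedundant) (q : Fin K → ℕ) :
    E.posteriorVar q = ∑ k, E.C⁻¹ 0 k * E.sourceCov q k := by
  have : E.C⁻¹ *ᵥ E.sourceCov q = E.covRow q := by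
    rw [sourceCov, Matrix.mulVec_mulVec,
      Matrix.nonsing_inv_mul _ ((Matrix.isUnit_iff_isUnit_det _).1 hC.1), Matrix.one_mulVec]
  rw [← covRow_zero, ← this]
  rfl

lemma sum_sq_sourceCov_le (E : InfoEnv K) (hV : E.V₀.PosDef) (q : Fin K → ℕ) :
    ∑ k, (q k : ℝ) / (E.sigmaSq k : ℝ) * (E.sourceCov q k) ^ 2 ≤ E.posteriorVar q := by
  have h2 := E.posteriorVar_eq_dual hV q
  have h3 : 0 ≤ E.covRow q ⬝ᵥ (E.V₀⁻¹ *ᵥ E.covRow q) := by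
    simpa using hV.inv.posSemidef.dotProduct_mulVec_nonneg (E.covRow q)
  rw [dual_expand] at h2
  simp only [sourceCov]
  linarith

/-- An upper bound in terms of the counts alone. -/
lemma posteriorVar_le_sum (E : InfoEnv K) (hV : E.V₀.PosDef) (hσ : ∀ k, 0 < E.sigmaSq k)
    (hC : E.NonRedundant) (q : Fin K → ℕ) (hq : ∀ k, 0 < q k) :
    E.posteriorVar q ≤ ∑ k, (E.C⁻¹ 0 k) ^ 2 * E.sigmaSq k / q k := by
  have h1 := E.posteriorVar_eq_sum hC q
  have h2 := E.sum_sq_sourceCov_le hV q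
  -- The variance `f = 2f - f` is at most this difference; completing the square bounds each
  -- summand, for any value of the covariance.
  have h3 : 2 * ∑ k, E.C⁻¹ 0 k * E.sourceCov q k -
      ∑ k, (q k : ℝ) / (E.sigmaSq k : ℝ) * (E.sourceCov q k) ^ 2 ≤
      ∑ k, (E.C⁻¹ 0 k) ^ 2 * E.sigmaSq k / q k := by
    rw [Finset.mul_sum, ← Finset.sum_sub_distrib]
    refine Finset.sum_le_sum fun k _ => ?_
    have hs : (0 : ℝ) < E.sigmaSq k := by exact_mod_cast hσ k
    have hk : (0 : ℝ) < q k := by exact_mod_cast hq k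
    have : (E.C⁻¹ 0 k) ^ 2 * E.sigmaSq k / q k - (2 * (E.C⁻¹ 0 k * E.sourceCov q k) -
        (q k : ℝ) / (E.sigmaSq k : ℝ) * (E.sourceCov q k) ^ 2) =
        (E.C⁻¹ 0 k * E.sigmaSq k - q k * E.sourceCov q k) ^ 2 / (E.sigmaSq k * q k) := by
      field_simp
      ring
    have h4 : 0 ≤ (E.C⁻¹ 0 k * E.sigmaSq k - q k * E.sourceCov q k) ^ 2 / (E.sigmaSq k * q k) := by
      positivity
    linarith
  linarith

/-- The first-order condition: the covariance with a source is, up to a prior term, inversely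
proportional to the number of its observations. -/
noncomputable def priorTerm (E : InfoEnv K) (x : Fin K → ℝ) : Fin K → ℝ :=
  (E.C⁻¹)ᵀ *ᵥ (E.V₀⁻¹ *ᵥ (E.C⁻¹ *ᵥ x))

/-- This is `precision_covRow` multiplied by `(C⁻¹)ᵀ`. When the prior term is negligible,
`sourceCov` is about `σ² (C⁻¹)₁ₖ / qₖ`, so the marginal values of the sources agree when `qₖ` is
proportional to `|(C⁻¹)₁ₖ| σₖ`, which is `weight`. -/
lemma count_mul_sourceCov (E : InfoEnv K) (hV : E.V₀.PosDef) (hC : E.NonRedundant)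
    (q : Fin K → ℕ) (k : Fin K) :
    (q k : ℝ) / (E.sigmaSq k : ℝ) * E.sourceCov q k =
      E.C⁻¹ 0 k - E.priorTerm (E.sourceCov q) k := by
  have hdet := (Matrix.isUnit_iff_isUnit_det _).1 hC.1
  have h := E.precision_covRow hV q
  rw [Matrix.add_mulVec] at h
  have h0 : E.C⁻¹ *ᵥ E.sourceCov q = E.covRow q := by
    rw [sourceCov, Matrix.mulVec_mulVec, Matrix.nonsing_inv_mul _ hdet, Matrix.one_mulVec]
  have h1 : (E.C⁻¹)ᵀ *ᵥ (E.obsInfo q *ᵥ E.covRow q) =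
      Matrix.diagonal (fun k => (q k : ℝ) / (E.sigmaSq k : ℝ)) *ᵥ E.sourceCov q := by
    rw [obsInfo, sourceCov, Matrix.mulVec_mulVec, Matrix.mulVec_mulVec, ← Matrix.mul_assoc,
      ← Matrix.mul_assoc, ← Matrix.transpose_mul, Matrix.mul_nonsing_inv _ hdet,
      Matrix.transpose_one, Matrix.one_mul]
  have h2 := congrArg (fun v => ((E.C⁻¹)ᵀ *ᵥ v) k) h
  simp only [Matrix.mulVec_add, h1, Pi.add_apply, Matrix.mulVec_diagonal] at h2
  rw [priorTerm, h0]
  have h3 : ((E.C⁻¹)ᵀ *ᵥ Pi.single 0 1) k = E.C⁻¹ 0 k := by simp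
  linarith

/-- Cauchy–Schwarz for the form `V₀⁻¹`: the squared covariance is at most `(r ⬝ V₀ r)(b ⬝ V₀⁻¹ b)`,
and the second factor is the prior part of the dual value, hence at most the posterior variance. A
small posterior variance thus makes all prior terms small. -/
lemma exists_sourceCov_sq_le (E : InfoEnv K) (hV : E.V₀.PosDef) :
    ∃ M : ℝ, 0 < M ∧ ∀ (q : Fin K → ℕ) (k : Fin K),
      (E.sourceCov q k) ^ 2 ≤ M * E.posteriorVar q := by
  obtain ⟨c, hc⟩ : ∃ c : ℝ, ∀ k, (E.C * E.V₀ * E.Cᵀ) k k ≤ c := by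
    refine ⟨∑ k, |(E.C * E.V₀ * E.Cᵀ) k k|, fun k => (le_abs_self _).trans ?_⟩
    exact Finset.single_le_sum (f := fun k => |(E.C * E.V₀ * E.Cᵀ) k k|)
      (fun _ _ => abs_nonneg _) (Finset.mem_univ k)
  refine ⟨max c 1, by positivity, fun q k => ?_⟩
  have h2 := E.posteriorVar_eq_dual hV q
  rw [dual_expand] at h2
  have h3 : E.covRow q ⬝ᵥ (E.V₀⁻¹ *ᵥ E.covRow q) ≤ E.posteriorVar q := by
    have : 0 ≤ ∑ k, (q k : ℝ) / (E.sigmaSq k : ℝ) * ((E.C *ᵥ E.covRow q) k) ^ 2 :=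
      Finset.sum_nonneg fun k _ => by positivity
    linarith
  have hu : IsUnit E.V₀.det := (Matrix.isUnit_iff_isUnit_det _).1 hV.isUnit
  set b := E.covRow q
  set r : Fin K → ℝ := E.C k with hr
  have hx : E.sourceCov q k = r ⬝ᵥ b := rfl
  have hquad : ∀ s : ℝ, 0 ≤ b ⬝ᵥ (E.V₀⁻¹ *ᵥ b) + 2 * s * (r ⬝ᵥ b) + s ^ 2 * (r ⬝ᵥ (E.V₀ *ᵥ r)) := by
    intro s
    have h := hV.inv.posSemidef.dotProduct_mulVec_nonneg (b + s • (E.V₀ *ᵥ r))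
    have hV0 : E.V₀ᵀ = E.V₀ := by
      have := hV.isHermitian
      rwa [Matrix.IsHermitian, Matrix.conjTranspose_eq_transpose_of_trivial] at this
    have e1 : E.V₀⁻¹ *ᵥ (E.V₀ *ᵥ r) = r := by
      rw [Matrix.mulVec_mulVec, Matrix.nonsing_inv_mul _ hu, Matrix.one_mulVec]
    have e2 : (E.V₀ *ᵥ r) ⬝ᵥ (E.V₀⁻¹ *ᵥ b) = r ⬝ᵥ b := by
      rw [← Matrix.vecMul_transpose, hV0, ← Matrix.dotProduct_mulVec, Matrix.mulVec_mulVec,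
        Matrix.mul_nonsing_inv _ hu, Matrix.one_mulVec]
    simp only [star_trivial, Matrix.mulVec_add, Matrix.mulVec_smul, add_dotProduct,
      dotProduct_add, smul_dotProduct, dotProduct_smul, e1, e2, smul_eq_mul] at h
    rw [dotProduct_comm b r, dotProduct_comm (E.V₀ *ᵥ r) r] at h
    nlinarith
  have hrr : r ⬝ᵥ (E.V₀ *ᵥ r) ≤ max c 1 := by
    refine le_trans (le_of_eq ?_) ((hc k).trans (le_max_left _ _))
    rw [Matrix.mul_assoc, Matrix.mul_apply]
    rfl
  have hm : 0 < max c 1 := by positivity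
  rw [hx]
  -- This `s` minimizes the quadratic in which `r ⬝ V₀ r` is replaced by its upper bound.
  have h4 := hquad (-(r ⬝ᵥ b) / max c 1)
  have h5 : (-(r ⬝ᵥ b) / max c 1) ^ 2 * (r ⬝ᵥ (E.V₀ *ᵥ r)) ≤
      (-(r ⬝ᵥ b) / max c 1) ^ 2 * max c 1 := by gcongr
  have h6 : (-(r ⬝ᵥ b) / max c 1) ^ 2 * max c 1 + 2 * (-(r ⬝ᵥ b) / max c 1) * (r ⬝ᵥ b) =
      - ((r ⬝ᵥ b) ^ 2 / max c 1) := by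
    field_simp
    ring
  have h7 : (r ⬝ᵥ b) ^ 2 / max c 1 ≤ E.posteriorVar q := by linarith
  rw [div_le_iff₀ hm] at h7
  linarith

lemma exists_priorTerm_le (E : InfoEnv K) :
    ∃ L : ℝ, 0 < L ∧ ∀ (x : Fin K → ℝ) (r : ℝ), (∀ k, |x k| ≤ r) →
      ∀ k, |E.priorTerm x k| ≤ L * r := by
  set A := (E.C⁻¹)ᵀ * E.V₀⁻¹ * E.C⁻¹ with hA
  refine ⟨∑ i, ∑ j, |A i j| + 1, by positivity, fun x r hx k => ?_⟩
  have hr : 0 ≤ r := (abs_nonneg _).trans (hx 0)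
  have h1 : E.priorTerm x k = ∑ j, A k j * x j := by
    rw [priorTerm, Matrix.mulVec_mulVec, Matrix.mulVec_mulVec]
    rfl
  rw [h1]
  calc |∑ j, A k j * x j| ≤ ∑ j, |A k j| * r := by
        refine (Finset.abs_sum_le_sum_abs _ _).trans (Finset.sum_le_sum fun j _ => ?_)
        rw [abs_mul]
        gcongr
        exact hx j
    _ = (∑ j, |A k j|) * r := by rw [Finset.sum_mul]
    _ ≤ (∑ i, ∑ j, |A i j| + 1) * r := by
        gcongr
        have : ∑ j, |A k j| ≤ ∑ i, ∑ j, |A i j| :=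
          Finset.single_le_sum (f := fun i => ∑ j, |A i j|)
            (fun _ _ => Finset.sum_nonneg fun _ _ => abs_nonneg _) (Finset.mem_univ k)
        linarith

end variational

end InfoEnv

/-! ### Optimal counts, myopic blocks and single exchanges. -/

namespace InfoEnv

variable {K : ℕ} [NeZero K]

/-- Signal counts that minimize the posterior variance among all counts of the same total. -/
def IsOptCount (E : InfoEnv K) (q : Fin K → ℕ) : Prop :=
  ∀ m : Fin K → ℕ, ∑ k, m k = ∑ k, q k → E.posteriorVar q ≤ E.posteriorVar m

lemma exists_bestBlock (E : InfoEnv K) (c : Fin K → ℕ) (N : ℕ) :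
    ∃ m : Fin K → ℕ, ∑ k, m k = N ∧ ∀ m' : Fin K → ℕ, ∑ k, m' k = N →
      E.posteriorVar (c + m) ≤ E.posteriorVar (c + m') := by
  have hne : (Finset.piAntidiag (Finset.univ : Finset (Fin K)) N).Nonempty :=
    ⟨Pi.single 0 N, by simp [Finset.mem_piAntidiag]⟩
  obtain ⟨m, hm, hmin⟩ := Finset.exists_min_image _ (fun m => E.posteriorVar (c + m)) hne
  refine ⟨m, by simpa using hm, fun m' hm' => hmin m' (by simpa using hm')⟩

/-- A multiset of `N` sources whose observation, given the counts `c`, minimizes the posterior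
variance. -/
noncomputable def bestBlock (E : InfoEnv K) (c : Fin K → ℕ) (N : ℕ) : Fin K → ℕ :=
  (E.exists_bestBlock c N).choose

lemma sum_bestBlock (E : InfoEnv K) (c : Fin K → ℕ) (N : ℕ) : ∑ k, E.bestBlock c N k = N :=
  (E.exists_bestBlock c N).choose_spec.1

lemma posteriorVar_bestBlock_le (E : InfoEnv K) (c : Fin K → ℕ) {N : ℕ} {m : Fin K → ℕ}
    (hm : ∑ k, m k = N) :
    E.posteriorVar (c + E.bestBlock c N) ≤ E.posteriorVar (c + m) :=
  (E.exists_bestBlock c N).choose_spec.2 m hm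

lemma exists_isOptCount (E : InfoEnv K) (N : ℕ) :
    ∃ q : Fin K → ℕ, ∑ k, q k = N ∧ E.IsOptCount q := by
  refine ⟨E.bestBlock 0 N, E.sum_bestBlock 0 N, fun m hm => ?_⟩
  rw [sum_bestBlock] at hm
  simpa using E.posteriorVar_bestBlock_le 0 hm

lemma isOptCount_zero (E : InfoEnv K) : E.IsOptCount 0 := by
  intro m hm
  have : m = 0 := by
    ext k
    have := Finset.sum_eq_zero_iff.1 (hm.trans (by simp)) k (Finset.mem_univ k)
    simpa using this
  rw [this]

/-- Moving from `c` to a maximal point above it of the optimal counts keeps optimality. -/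
lemma IsOptCount.add_bestBlock {E : InfoEnv K} {c q : Fin K → ℕ} (hq : E.IsOptCount q)
    (hcq : c ≤ q) {N : ℕ} (hN : ∑ k, q k = ∑ k, c k + N) :
    E.IsOptCount (c + E.bestBlock c N) := by
  intro m hm
  have h1 : ∑ k, (q - c) k = N := by
    have : ∑ k, c k + ∑ k, (q - c) k = ∑ k, q k := by
      rw [← Finset.sum_add_distrib]
      exact Finset.sum_congr rfl fun k _ => Nat.add_sub_cancel' (hcq k)
    omega
  have h2 := E.posteriorVar_bestBlock_le c h1
  have h3 : c + (q - c) = q := by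
    ext k
    exact Nat.add_sub_cancel' (hcq k)
  rw [h3] at h2
  refine h2.trans (hq m ?_)
  rw [hm, hN]
  simp [Finset.sum_add_distrib, sum_bestBlock]

lemma exists_le_sum_eq (q : Fin K → ℕ) {N : ℕ} (hN : ∑ k, q k ≤ N) :
    ∃ q' : Fin K → ℕ, q ≤ q' ∧ ∑ k, q' k = N := by
  refine ⟨q + Pi.single 0 (N - ∑ k, q k), by simp, ?_⟩
  simp [Finset.sum_add_distrib]
  omega

/-- Pad `q` to the total of `c`; additional signals never raise the variance. -/
lemma IsOptCount.le_of_sum_le {E : InfoEnv K} (hV : E.V₀.PosDef) {c q : Fin K → ℕ}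
    (hc : E.IsOptCount c) (h : ∑ k, q k ≤ ∑ k, c k) : E.posteriorVar c ≤ E.posteriorVar q := by
  obtain ⟨q', hle, hsum⟩ := exists_le_sum_eq q h
  exact (hc q' hsum).trans (E.posteriorVar_antitone hV hle)

/-! ### Asymptotic balance of the optimal counts -/

/-- The weight to which the number of observations of a source is asymptotically proportional. -/
noncomputable def weight (E : InfoEnv K) (k : Fin K) : ℝ :=
  |E.C⁻¹ 0 k| * √(E.sigmaSq k)

/-- The counts are proportional to the weights, up to an additive error. -/
def Balanced (E : InfoEnv K) (D : ℝ) (q : Fin K → ℕ) : Prop :=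
  ∀ j k, q j * E.weight k - q k * E.weight j ≤ D

/-- The counts obtained by replacing one observation of `j` by one of `k`. -/
def exchange (q : Fin K → ℕ) (j k : Fin K) : Fin K → ℕ :=
  Function.update (Function.update q j (q j - 1)) k (q k + 1)

omit [NeZero K] in
lemma exchange_left (q : Fin K → ℕ) {j k : Fin K} (h : j ≠ k) : exchange q j k j = q j - 1 := by
  simp [exchange, h]

omit [NeZero K] in
lemma exchange_right (q : Fin K → ℕ) (j k : Fin K) : exchange q j k k = q k + 1 := by
  simp [exchange]

omit [NeZero K] in
lemma exchange_of_ne (q : Fin K → ℕ) {i j k : Fin K} (hj : i ≠ j) (hk : i ≠ k) :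
    exchange q j k i = q i := by
  simp [exchange, hj, hk]

omit [NeZero K] in
lemma le_exchange_add_one (q : Fin K → ℕ) {j k : Fin K} (h : j ≠ k) (i : Fin K) :
    q i ≤ exchange q j k i + 1 := by
  by_cases hi : i = k
  · subst hi; rw [exchange_right]; omega
  by_cases hj : i = j
  · subst hj; rw [exchange_left q h]; omega
  rw [exchange_of_ne q hj hi]; omega

omit [NeZero K] in
lemma sum_exchange (q : Fin K → ℕ) {j k : Fin K} (h : j ≠ k) (hj : 1 ≤ q j) :
    ∑ i, exchange q j k i = ∑ i, q i := by
  have e : ∀ q' : Fin K → ℕ, ∑ i, q' i = q' j + (q' k + ∑ i ∈ (Finset.univ.erase j).erase k, q' i) := by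
    intro q'
    rw [← Finset.add_sum_erase _ q' (Finset.mem_univ j),
      ← Finset.add_sum_erase _ q' (Finset.mem_erase.2 ⟨h.symm, Finset.mem_univ k⟩)]
  rw [e, e q, exchange_left q h, exchange_right]
  have : ∑ i ∈ (Finset.univ.erase j).erase k, exchange q j k i =
      ∑ i ∈ (Finset.univ.erase j).erase k, q i := by
    refine Finset.sum_congr rfl fun i hi => ?_
    simp only [Finset.mem_erase] at hi
    exact exchange_of_ne q hi.2.1 hi.1
  omega

/-- If the exchange does not pay, the subgradient inequality at the exchanged counts shows that
source `k` has no larger marginal value there than source `j`. The first-order condition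
`count_mul_sourceCov` turns this into a comparison of counts; as it is used at the exchanged counts,
`q j - 1` and `q k + 1` appear. -/
lemma exchange_ineq (E : InfoEnv K) (hV : E.V₀.PosDef) (hσ : ∀ k, 0 < E.sigmaSq k)
    (hC : E.NonRedundant) {q : Fin K → ℕ} {j k : Fin K} (hjk : j ≠ k) (hj : 1 ≤ q j)
    (hle : E.posteriorVar q ≤ E.posteriorVar (exchange q j k)) :
    √(E.sigmaSq k) * |E.C⁻¹ 0 k - E.priorTerm (E.sourceCov (exchange q j k)) k| *
        ((q j : ℝ) - 1) ≤
      √(E.sigmaSq j) * |E.C⁻¹ 0 j - E.priorTerm (E.sourceCov (exchange q j k)) j| *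
        ((q k : ℝ) + 1) := by
  set q' := exchange q j k with hq'
  have hs : ∀ i, (0 : ℝ) < E.sigmaSq i := fun i => by exact_mod_cast hσ i
  have h1 := E.posteriorVar_compare hV q q'
  have h2 : ∑ i, ((q' i : ℝ) - q i) / (E.sigmaSq i : ℝ) * (E.sourceCov q' i) ^ 2 =
      (E.sourceCov q' k) ^ 2 / E.sigmaSq k - (E.sourceCov q' j) ^ 2 / E.sigmaSq j := by
    rw [← Finset.add_sum_erase _ _ (Finset.mem_univ j),
      ← Finset.add_sum_erase _ _ (Finset.mem_erase.2 ⟨hjk.symm, Finset.mem_univ k⟩),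
      Finset.sum_eq_zero, hq', exchange_left q hjk, exchange_right, Nat.cast_sub hj]
    · push_cast
      ring
    · intro i hi
      simp only [Finset.mem_erase] at hi
      rw [hq', exchange_of_ne q hi.2.1 hi.1]
      simp
  rw [h2] at h1
  have h3 : (|E.sourceCov q' k| / √(E.sigmaSq k)) ^ 2 ≤
      (|E.sourceCov q' j| / √(E.sigmaSq j)) ^ 2 := by
    rw [div_pow, div_pow, sq_abs, sq_abs, Real.sq_sqrt (hs k).le, Real.sq_sqrt (hs j).le]
    linarith
  have h4 : |E.sourceCov q' k| / √(E.sigmaSq k) ≤ |E.sourceCov q' j| / √(E.sigmaSq j) :=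
    (pow_le_pow_iff_left₀ (by positivity) (by positivity) two_ne_zero).1 h3
  have key : ∀ i, √(E.sigmaSq i) * |E.C⁻¹ 0 i - E.priorTerm (E.sourceCov q') i| =
      q' i * (|E.sourceCov q' i| / √(E.sigmaSq i)) := by
    intro i
    rw [← count_mul_sourceCov E hV hC, abs_mul, abs_of_nonneg (by positivity)]
    have := Real.sqrt_pos.2 (hs i)
    have h5 := Real.sq_sqrt (hs i).le
    calc √(E.sigmaSq i : ℝ) * (q' i / E.sigmaSq i * |E.sourceCov q' i|)
        = √(E.sigmaSq i : ℝ) * (q' i / √(E.sigmaSq i : ℝ) ^ 2 * |E.sourceCov q' i|) := by rw [h5]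
      _ = _ := by field_simp
  have hqj : (q' j : ℝ) = q j - 1 := by
    rw [hq', exchange_left q hjk, Nat.cast_sub hj]; simp
  have hqk : (q' k : ℝ) = q k + 1 := by
    rw [hq', exchange_right]; simp
  rw [key, key, ← hqj, ← hqk]
  calc (q' k : ℝ) * (|E.sourceCov q' k| / √(E.sigmaSq k)) * q' j
      ≤ (q' k : ℝ) * (|E.sourceCov q' j| / √(E.sigmaSq j)) * q' j := by gcongr
    _ = _ := by ring

set_option maxHeartbeats 800000 in
/-- Counts at which no exchange of single observations pays are balanced, with an error that does
not depend on their size. -/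
lemma balanced_of_exchange (E : InfoEnv K) (hV : E.V₀.PosDef) (hσ : ∀ k, 0 < E.sigmaSq k)
    (hC : E.NonRedundant) :
    ∃ D ε : ℝ, 0 ≤ D ∧ 0 < ε ∧ ∀ D' : ℝ, ∃ n₀ : ℕ, ∀ q : Fin K → ℕ, n₀ ≤ ∑ k, q k →
      E.posteriorVar q ≤ ε →
      (∀ j k, j ≠ k → q j * E.weight k - q k * E.weight j ≤ D' ∨
        (1 ≤ q j ∧ E.posteriorVar q ≤ E.posteriorVar (exchange q j k))) →
      E.Balanced (max D D') q := by
  obtain ⟨M, hM, hMle⟩ := E.exists_sourceCov_sq_le hV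
  obtain ⟨L, hL, hLle⟩ := E.exists_priorTerm_le
  have hs : ∀ i, (0 : ℝ) < E.sigmaSq i := fun i => by exact_mod_cast hσ i
  have hsq : ∀ i, 0 < √(E.sigmaSq i : ℝ) := fun i => Real.sqrt_pos.2 (hs i)
  have ha : ∀ i, 0 < |E.C⁻¹ 0 i| := fun i => abs_pos.2 (hC.2 i)
  have hw : ∀ i, 0 < E.weight i := fun i => mul_pos (ha i) (hsq i)
  obtain ⟨i₀, -, hi₀⟩ := Finset.exists_min_image Finset.univ (fun i => |E.C⁻¹ 0 i|)
    Finset.univ_nonempty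
  obtain ⟨i₁, -, hi₁⟩ := Finset.exists_min_image Finset.univ E.weight Finset.univ_nonempty
  obtain ⟨i₂, -, hi₂⟩ := Finset.exists_max_image Finset.univ E.weight Finset.univ_nonempty
  set a₀ := |E.C⁻¹ 0 i₀| with ha₀
  set wmin := E.weight i₁ with hwmin
  set wmax := E.weight i₂ with hwmax
  have hwminpos : 0 < wmin := hw i₁
  have hwle : ∀ i, wmin ≤ E.weight i := fun i => hi₁ i (Finset.mem_univ i)
  have hlew : ∀ i, E.weight i ≤ wmax := fun i => hi₂ i (Finset.mem_univ i)
  have ha0pos : 0 < a₀ := ha i₀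
  have ha0le : ∀ i, a₀ ≤ |E.C⁻¹ 0 i| := fun i => hi₀ i (Finset.mem_univ i)
  have hKpos : (1 : ℝ) ≤ K := by exact_mod_cast NeZero.one_le
  -- The factor `3` is `(3/2) / (1/2)`: in the first, crude estimate the prior terms shift each
  -- coefficient by at most half of its size.
  set A : ℝ := 3 * wmax / wmin with hA
  have hA3 : 3 ≤ A := by
    rw [hA, le_div_iff₀ hwminpos]
    linarith [hwle i₂]
  have hwA : ∀ j k, 3 * E.weight j ≤ A * E.weight k := by
    intro j k
    calc 3 * E.weight j ≤ 3 * wmax := by linarith [hlew j]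
      _ = A * wmin := by rw [hA]; field_simp
      _ ≤ A * E.weight k := by gcongr; exact hwle k
  set c₁ : ℝ := ∑ i, (E.sigmaSq i : ℝ) * |E.C⁻¹ 0 i| with hc₁
  have hc₁le : ∀ i, (E.sigmaSq i : ℝ) * |E.C⁻¹ 0 i| ≤ c₁ := fun i =>
    Finset.single_le_sum (f := fun i => (E.sigmaSq i : ℝ) * |E.C⁻¹ 0 i|)
      (fun _ _ => by positivity) (Finset.mem_univ i)
  set S : ℝ := ∑ i, √(E.sigmaSq i : ℝ) with hS
  have hSle : ∀ i, √(E.sigmaSq i : ℝ) ≤ S := fun i =>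
    Finset.single_le_sum (f := fun i => √(E.sigmaSq i : ℝ))
      (fun _ _ => by positivity) (Finset.mem_univ i)
  have hS0 : 0 ≤ S := Finset.sum_nonneg fun _ _ => by positivity
  set M₂ : ℝ := 6 * K * A * c₁ with hM₂
  have hc₁0 : 0 ≤ c₁ := Finset.sum_nonneg fun _ _ => by positivity
  have hM₂0 : 0 ≤ M₂ := by positivity
  -- The threshold `ε` is such that a variance of at most `2ε` forces `|sourceCov| ≤ a₀ / (2L)` and
  -- hence prior terms of at most `a₀ / 2`. In the error bound, `2 * wmax` comes from the shifts of
  -- the counts by one, and `3 * S * L * M₂` from the prior terms, which are of order `1 / n`.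
  refine ⟨2 * wmax + 3 * S * L * M₂, (a₀ / (2 * L)) ^ 2 / (2 * M), ?_, by positivity, fun D' => ?_⟩
  · have := hw i₂
    positivity
  set B' : ℝ := A + 1 + |D'| / wmin with hB'
  obtain ⟨n₀, hn₀⟩ := exists_nat_ge (2 * K * B' + 4 * K * A)
  refine ⟨n₀, fun q hn hf hex => ?_⟩
  have hB0 : 0 ≤ B' := by positivity
  set n : ℝ := ((∑ k, q k : ℕ) : ℝ) with hndef
  have hnge : 2 * K * B' + 4 * K * A ≤ n := hn₀.trans (Nat.cast_le.2 hn)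
  have hn1 : 1 ≤ n := by
    have h1 : 1 * 3 ≤ K * A := mul_le_mul hKpos hA3 (by norm_num) (by linarith)
    have h2 : 0 ≤ 2 * K * B' := by positivity
    linarith
  have hqn : ∀ k, (q k : ℝ) ≤ n := fun k => by
    rw [hndef]
    exact_mod_cast Finset.single_le_sum (f := q) (fun _ _ => Nat.zero_le _) (Finset.mem_univ k)
  -- a profitable exchange is ruled out unless the difference is already small
  have hsmall : ∀ j k, j ≠ k → 2 ≤ q j → ∀ i,
      |E.priorTerm (E.sourceCov (exchange q j k)) i| ≤ |E.C⁻¹ 0 i| / 2 := by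
    intro j k hjk h2 i
    have h3 : E.posteriorVar (exchange q j k) ≤ 2 * E.posteriorVar q := by
      -- Removing one observation of `j` at most halves its count, because `2 ≤ q j`.
      refine E.posteriorVar_le_two_mul hV fun i => ?_
      by_cases hi : i = j
      · subst hi; rw [exchange_left q hjk]; omega
      · by_cases hk : i = k
        · subst hk; rw [exchange_right]; omega
        · rw [exchange_of_ne q hi hk]; omega
    have h4 : ∀ i, |E.sourceCov (exchange q j k) i| ≤ a₀ / (2 * L) := by
      intro i
      refine abs_le_of_sq_le_sq ?_ (by positivity)
      calc _ ≤ M * E.posteriorVar (exchange q j k) := hMle _ i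
        _ ≤ M * (2 * ((a₀ / (2 * L)) ^ 2 / (2 * M))) := by gcongr; linarith
        _ = (a₀ / (2 * L)) ^ 2 := by field_simp
    calc _ ≤ L * (a₀ / (2 * L)) := hLle _ _ h4 i
      _ = a₀ / 2 := by field_simp
      _ ≤ _ := by linarith [ha0le i]
  have hupper : ∀ (x : Fin K → ℝ) i r, |E.priorTerm x i| ≤ r →
      |E.C⁻¹ 0 i - E.priorTerm x i| ≤ |E.C⁻¹ 0 i| + r := fun x i r h =>
    (abs_sub _ _).trans (by linarith)
  have hlower : ∀ (x : Fin K → ℝ) i r, |E.priorTerm x i| ≤ r →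
      |E.C⁻¹ 0 i| - r ≤ |E.C⁻¹ 0 i - E.priorTerm x i| := fun x i r h => by
    have := abs_sub_abs_le_abs_sub (E.C⁻¹ 0 i) (E.priorTerm x i)
    linarith
  -- First pass: all counts are comparable up to the factor `A`. The conclusion is crude but shows
  -- that each count grows linearly with the total.
  have hrough : ∀ j k, (q j : ℝ) ≤ A * q k + B' := by
    intro j k
    have hD' : 0 ≤ |D'| / wmin := by positivity
    have hqk : (0 : ℝ) ≤ q k := by positivity
    by_cases hjk : j = k
    · subst hjk
      have h1 : 1 * (q j : ℝ) ≤ A * q j := mul_le_mul_of_nonneg_right (by linarith) hqk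
      linarith
    rcases hex j k hjk with h | ⟨-, h⟩
    · have h1 : q j * E.weight k ≤ (|D'| / wmin + A * q k) * E.weight k := by
        have e1 : |D'| ≤ |D'| / wmin * E.weight k := by
          calc |D'| = |D'| / wmin * wmin := by field_simp
            _ ≤ _ := by gcongr; exact hwle k
        have e2 : q k * E.weight j ≤ A * q k * E.weight k := by
          calc q k * E.weight j ≤ q k * (A * E.weight k) :=
                mul_le_mul_of_nonneg_left (by linarith [hwA j k, hw j]) hqk
            _ = _ := by ring
        have := le_abs_self D'
        linarith
      have h2 := le_of_mul_le_mul_right h1 (hw k)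
      linarith
    · by_cases h2 : 2 ≤ q j
      · have h3 := E.exchange_ineq hV hσ hC hjk (by omega) h
        have hq2 : (2 : ℝ) ≤ q j := by exact_mod_cast h2
        have h4 : E.weight k / 2 * ((q j : ℝ) - 1) ≤ 3 / 2 * E.weight j * ((q k : ℝ) + 1) := by
          refine le_trans ?_ (h3.trans ?_)
          · refine mul_le_mul_of_nonneg_right ?_ (by linarith)
            rw [weight]
            have h7 := hlower _ k _ (hsmall j k hjk h2 k)
            calc |E.C⁻¹ 0 k| * √(E.sigmaSq k : ℝ) / 2
                = √(E.sigmaSq k : ℝ) * (|E.C⁻¹ 0 k| - |E.C⁻¹ 0 k| / 2) := by ring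
              _ ≤ _ := mul_le_mul_of_nonneg_left h7 (hsq k).le
          · refine mul_le_mul_of_nonneg_right ?_ (by linarith)
            rw [weight]
            have h7 := hupper _ j _ (hsmall j k hjk h2 j)
            calc _ ≤ √(E.sigmaSq j : ℝ) * (|E.C⁻¹ 0 j| + |E.C⁻¹ 0 j| / 2) :=
                  mul_le_mul_of_nonneg_left h7 (hsq j).le
              _ = _ := by ring
        have h5 : ((q j : ℝ) - 1) * E.weight k ≤ A * (q k + 1) * E.weight k := by
          calc ((q j : ℝ) - 1) * E.weight k = 2 * (E.weight k / 2 * ((q j : ℝ) - 1)) := by ring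
            _ ≤ 3 * E.weight j * ((q k : ℝ) + 1) := by linarith
            _ ≤ A * E.weight k * ((q k : ℝ) + 1) :=
                mul_le_mul_of_nonneg_right (hwA j k) (by linarith)
            _ = _ := by ring
        have h6 := le_of_mul_le_mul_right h5 (hw k)
        linarith
      · have h3 : (q j : ℝ) ≤ 1 := by exact_mod_cast (by omega : q j ≤ 1)
        have h4 : 0 ≤ A * q k := by positivity
        linarith
  have hlow : ∀ k, n / (4 * K * A) ≤ (q k : ℝ) - 1 := by
    intro k
    have h1 : n ≤ K * (A * q k + B') := by
      rw [hndef, Nat.cast_sum]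
      calc ∑ j, (q j : ℝ) ≤ ∑ j : Fin K, (A * q k + B') := Finset.sum_le_sum fun j _ => hrough j k
        _ = K * (A * q k + B') := by simp [mul_add]
    have h2 : 0 < 4 * K * A := by positivity
    rw [div_le_iff₀ h2]
    linarith
  intro j k
  by_cases hjk : j = k
  · subst hjk
    have : 0 ≤ 2 * wmax + 3 * S * L * M₂ := by
      have := hw i₂
      positivity
    simp [this]
  rcases hex j k hjk with h | ⟨h1, h⟩
  · exact h.trans (le_max_right _ _)
  refine le_trans ?_ (le_max_left _ _)
  have h2 : 2 ≤ q j := by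
    have := hlow j
    have h3 : 0 < n / (4 * K * A) := by positivity
    have h4 : (1 : ℝ) < q j := by linarith
    exact_mod_cast h4
  -- Second pass: linearly growing counts make the covariances, and with them the prior terms, of
  -- order `1 / n`. The constant `M₂` is `(3/2) c₁` times `4KA`.
  have hx : ∀ i, |E.sourceCov (exchange q j k) i| ≤ M₂ / n := by
    intro i
    have hqi : n / (4 * K * A) ≤ (exchange q j k i : ℝ) := by
      have : (q i : ℝ) ≤ exchange q j k i + 1 := by exact_mod_cast le_exchange_add_one q hjk i
      linarith [hlow i]
    have h3 := E.count_mul_sourceCov hV hC (exchange q j k) i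
    have h4 := hupper _ i _ (hsmall j k hjk h2 i)
    rw [← h3, abs_mul, abs_of_nonneg (by positivity), div_mul_eq_mul_div,
      div_le_iff₀ (hs i)] at h4
    have h5 : n / (4 * K * A) * |E.sourceCov (exchange q j k) i| ≤ 3 / 2 * c₁ := by
      calc _ ≤ (exchange q j k i : ℝ) * |E.sourceCov (exchange q j k) i| := by gcongr
        _ ≤ _ := h4
        _ = 3 / 2 * (E.sigmaSq i * |E.C⁻¹ 0 i|) := by ring
        _ ≤ _ := by linarith [hc₁le i]
    rw [le_div_iff₀ (by linarith)]
    rw [div_mul_eq_mul_div, div_le_iff₀ (by positivity)] at h5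
    calc _ = n * |E.sourceCov (exchange q j k) i| := by ring
      _ ≤ _ := h5
      _ = M₂ := by rw [hM₂]; ring
  have hp := hLle _ _ hx
  have h3 := E.exchange_ineq hV hσ hC hjk h1 h
  have hq2 : (2 : ℝ) ≤ q j := by exact_mod_cast h2
  have h4 : √(E.sigmaSq k : ℝ) * (|E.C⁻¹ 0 k| - L * (M₂ / n)) * ((q j : ℝ) - 1) ≤
      √(E.sigmaSq j : ℝ) * (|E.C⁻¹ 0 j| + L * (M₂ / n)) * ((q k : ℝ) + 1) := by
    refine le_trans ?_ (h3.trans ?_)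
    · refine mul_le_mul_of_nonneg_right ?_ (by linarith)
      exact mul_le_mul_of_nonneg_left (hlower _ k _ (hp k)) (hsq k).le
    · refine mul_le_mul_of_nonneg_right ?_ (by positivity)
      exact mul_le_mul_of_nonneg_left (hupper _ j _ (hp j)) (hsq j).le
  have hδ : 0 ≤ L * (M₂ / n) := by positivity
  set δ := L * (M₂ / n) with hδdef
  -- The coefficient error `δ` is multiplied by counts of order `n`, so it contributes a bounded
  -- amount.
  have hδn : δ * n = L * M₂ := by rw [hδdef]; field_simp
  clear_value δ S n M₂ A B' c₁ wmax wmin a₀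
  have h5 : √(E.sigmaSq k : ℝ) * δ * ((q j : ℝ) - 1) ≤ S * δ * n := by
    have := hqn j
    have := hSle k
    gcongr
    all_goals linarith
  have h6 : √(E.sigmaSq j : ℝ) * δ * ((q k : ℝ) + 1) ≤ S * δ * (2 * n) := by
    have := hqn k
    have := hSle j
    gcongr
    all_goals linarith
  have h7 : S * δ * n = S * L * M₂ := by rw [mul_assoc, hδn]; ring
  have h8 := hlew j
  have h9 := hlew k
  simp only [weight] at h8 h9 ⊢
  linarith

lemma weight_pos (E : InfoEnv K) (hσ : ∀ k, 0 < E.sigmaSq k) (hC : E.NonRedundant) (k : Fin K) :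
    0 < E.weight k :=
  mul_pos (abs_pos.2 (hC.2 k)) (Real.sqrt_pos.2 (by exact_mod_cast hσ k))

lemma Balanced.mono {E : InfoEnv K} {D D' : ℝ} {q : Fin K → ℕ} (h : E.Balanced D q)
    (hD : D ≤ D') : E.Balanced D' q :=
  fun j k => (h j k).trans hD

/-- Summing the balance inequalities over one index compares a count with its proportional share of
the total. The error `K * D` does not depend on the total. -/
lemma Balanced.lower {E : InfoEnv K} {D : ℝ} {q : Fin K → ℕ} (h : E.Balanced D q) (k : Fin K) :
    ((∑ j, q j : ℕ) : ℝ) * E.weight k - K * D ≤ q k * ∑ j, E.weight j := by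
  have := Finset.sum_le_sum fun j (_ : j ∈ Finset.univ) => h j k
  simp only [Finset.sum_sub_distrib, ← Finset.sum_mul, ← Finset.mul_sum, Finset.sum_const,
    Finset.card_univ, Fintype.card_fin, nsmul_eq_mul] at this
  push_cast
  linarith

lemma Balanced.upper {E : InfoEnv K} {D : ℝ} {q : Fin K → ℕ} (h : E.Balanced D q) (j : Fin K) :
    q j * ∑ k, E.weight k ≤ ((∑ k, q k : ℕ) : ℝ) * E.weight j + K * D := by
  have := Finset.sum_le_sum fun k (_ : k ∈ Finset.univ) => h j k
  simp only [Finset.sum_sub_distrib, ← Finset.sum_mul, ← Finset.mul_sum, Finset.sum_const,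
    Finset.card_univ, Fintype.card_fin, nsmul_eq_mul] at this
  push_cast
  linarith

lemma exists_small_of_large (E : InfoEnv K) (hV : E.V₀.PosDef) (hσ : ∀ k, 0 < E.sigmaSq k)
    (hC : E.NonRedundant) {ε : ℝ} (hε : 0 < ε) :
    ∃ m : ℕ, ∀ q : Fin K → ℕ, (∀ k, m ≤ q k) → E.posteriorVar q ≤ ε := by
  set s : ℝ := ∑ k, (E.C⁻¹ 0 k) ^ 2 * E.sigmaSq k with hs
  obtain ⟨m, hm⟩ := exists_nat_ge (s / ε)
  refine ⟨m + 1, fun q hq => ?_⟩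
  refine (E.posteriorVar_le_sum hV hσ hC q fun k => (Nat.succ_pos m).trans_le (hq k)).trans ?_
  have h1 : ∑ k, (E.C⁻¹ 0 k) ^ 2 * E.sigmaSq k / q k ≤ s / (m + 1) := by
    rw [hs, Finset.sum_div]
    refine Finset.sum_le_sum fun k _ => ?_
    have : ((m + 1 : ℕ) : ℝ) ≤ q k := by exact_mod_cast hq k
    push_cast at this
    gcongr
  refine h1.trans ?_
  rw [div_le_iff₀ hε] at hm
  rw [div_le_iff₀ (by positivity)]
  linarith

/-- A uniform balance constant, valid for the optimal counts and preserved by blocks that are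
chosen myopically from large balanced counts. -/
lemma exists_balance_const (E : InfoEnv K) (hV : E.V₀.PosDef) (hσ : ∀ k, 0 < E.sigmaSq k)
    (hC : E.NonRedundant) :
    ∃ (D : ℝ) (n₀ : ℕ), (∀ q, E.IsOptCount q → E.Balanced D q) ∧
      ∀ (c : Fin K → ℕ) (N : ℕ), n₀ ≤ ∑ k, c k → E.Balanced D c →
        E.Balanced D (c + E.bestBlock c N) := by
  obtain ⟨D, ε, hD0, hε, hD⟩ := E.balanced_of_exchange hV hσ hC
  obtain ⟨m, hm⟩ := E.exists_small_of_large hV hσ hC hε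
  have hw := E.weight_pos hσ hC
  obtain ⟨n₁, hn₁⟩ := hD D
  set W := ∑ k, E.weight k with hW
  have hWpos : 0 < W := Finset.sum_pos (fun k _ => hw k) Finset.univ_nonempty
  have hWle : ∀ k, E.weight k ≤ W := fun k =>
    Finset.single_le_sum (fun i _ => (hw i).le) (Finset.mem_univ k)
  set n₂ := max n₁ (K * m) with hn₂
  -- The second term makes all counts with total below `n₂` balanced for trivial reasons.
  set D₂ := max D (n₂ * W) with hD₂
  have hDD₂ : D ≤ D₂ := le_max_left _ _
  obtain ⟨n₃, hn₃⟩ := hD D₂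
  obtain ⟨i₁, -, hi₁⟩ := Finset.exists_min_image Finset.univ E.weight Finset.univ_nonempty
  -- Balanced counts with a total of at least `n₄` have at least `m` observations of every source,
  -- hence variance at most `ε`.
  obtain ⟨n₄, hn₄⟩ := exists_nat_ge ((m * W + K * D₂) / E.weight i₁)
  rw [div_le_iff₀ (hw i₁)] at hn₄
  refine ⟨D₂, max n₃ n₄, fun q hq => ?_, fun c N hc hbal => ?_⟩
  · by_cases hbig : n₂ ≤ ∑ k, q k
    · refine (hn₁ q ((le_max_left _ _).trans hbig) ?_ fun j k hjk => ?_).mono (by simp [hD₂])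
      · have h1 : ∑ _k : Fin K, m ≤ ∑ k, q k := by simpa using (le_max_right _ _).trans hbig
        obtain ⟨q', hle, hsum⟩ := exists_le_sum_eq (fun _ => m) h1
        exact (hq q' hsum).trans (hm q' hle)
      · by_cases hj : 1 ≤ q j
        · exact Or.inr ⟨hj, hq _ (sum_exchange q hjk hj)⟩
        · left
          have h0 : q j = 0 := by omega
          have : 0 ≤ q k * E.weight j := mul_nonneg (by positivity) (hw j).le
          rw [h0, Nat.cast_zero, zero_mul]
          linarith
    · intro j k
      have h1 : (q j : ℝ) ≤ n₂ := by
        have := Finset.single_le_sum (f := q) (fun _ _ => Nat.zero_le _) (Finset.mem_univ j)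
        exact_mod_cast this.trans (by omega)
      have h2 : q j * E.weight k ≤ n₂ * W :=
        mul_le_mul h1 (hWle k) (hw k).le (by positivity)
      have h3 : 0 ≤ q k * E.weight j := mul_nonneg (by positivity) (hw j).le
      linarith [le_max_right D (n₂ * W)]
  · set b := E.bestBlock c N with hb
    have hle : c ≤ c + b := le_self_add
    have hcε : E.posteriorVar c ≤ ε := by
      refine hm c fun k => ?_
      have h1 := hbal.lower k
      have h2 : (n₄ : ℝ) * E.weight i₁ ≤ ((∑ j, c j : ℕ) : ℝ) * E.weight k :=
        mul_le_mul (Nat.cast_le.2 ((le_max_right _ _).trans hc)) (hi₁ k (Finset.mem_univ k))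
          (hw _).le (by positivity)
      have h3 : (m : ℝ) * W ≤ c k * W := by linarith
      exact_mod_cast le_of_mul_le_mul_right h3 hWpos
    -- The constant obtained is `max D D₂ = D₂`, so the same balance constant is reproduced and can
    -- be iterated over all periods.
    have h1 := hn₃ (c + b) ?_ ((E.posteriorVar_antitone hV hle).trans hcε) fun j k hjk => ?_
    · exact h1.mono (by simp [hDD₂])
    · exact ((le_max_left _ _).trans hc).trans (Finset.sum_le_sum fun k _ => hle k)
    -- Only observations of the new block can be exchanged. If the block contains no observation of
    -- `j`, then the count of `j` is that of `c` and the others have not fallen, so the inequality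
    -- for `c` persists.
    · by_cases hj : 1 ≤ b j
      · right
        refine ⟨hj.trans (by simp), ?_⟩
        have h2 : exchange (c + b) j k = c + exchange b j k := by
          ext i
          by_cases hik : i = k
          · subst hik; simp [exchange_right, add_assoc]
          by_cases hij : i = j
          · subst hij
            simp only [exchange_left _ hjk, Pi.add_apply]
            omega
          · simp [exchange_of_ne _ hij hik]
        rw [h2]
        refine E.posteriorVar_bestBlock_le c ?_
        rw [sum_exchange b hjk hj, hb, sum_bestBlock]
      · left
        have h0 : b j = 0 := by omega
        refine le_trans ?_ (hbal j k)
        have h2 : (c k : ℝ) * E.weight j ≤ ((c + b) k : ℕ) * E.weight j :=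
          mul_le_mul_of_nonneg_right (by exact_mod_cast hle k) (hw j).le
        have h3 : (c + b) j = c j := by simp [h0]
        rw [h3]
        linarith

/-! ### Counts of a simulation that stay at least as informative. -/

/-- How the simulated intensity depends on the original intensity `N` and on the number `adv` of
signals by which the simulation is ahead: as long as that is less than `D`, an intensity between
`1` and `B` is raised to `B`. -/
def boost (B D N adv : ℕ) : ℕ := if 1 ≤ N ∧ N < B ∧ adv < D then B else N

lemma le_boost (B D N adv : ℕ) : N ≤ boost B D N adv := by
  unfold boost; split_ifs <;> omega

/-- A relation between the signal counts `c` of a simulation and the counts `q` of the simulated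
strategy that ensures that the simulation is at least as well informed, and that is maintained if
the simulation chooses signals myopically, with boosted intensities. -/
structure IsSimulationInvariant (E : InfoEnv K) (B D : ℕ)
    (R : (Fin K → ℕ) → (Fin K → ℕ) → Prop) : Prop where
  zero : R 0 0
  posteriorVar_le : ∀ c q, R c q → E.posteriorVar c ≤ E.posteriorVar q
  sum_le : ∀ c q, R c q → ∑ k, q k ≤ ∑ k, c k
  step : ∀ c q n, R c q →
    R (c + E.bestBlock c (boost B D (∑ k, n k) (∑ k, c k - ∑ k, q k))) (q + n)

/-- There are two regimes. Until the simulation is `D` signals ahead, its counts are optimal for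
their own total. Afterwards they are only balanced, but the lead makes them dominate optimal counts
for the total of `q`. The lead never shrinks because `boost` never lowers an intensity. -/
lemma exists_simulationInvariant (E : InfoEnv K) (hV : E.V₀.PosDef) (hσ : ∀ k, 0 < E.sigmaSq k)
    (hC : E.NonRedundant) :
    ∃ D : ℕ, ∀ B, D ≤ B → ∃ R, E.IsSimulationInvariant B D R := by
  obtain ⟨D₁, n₀, hopt, hstep⟩ := E.exists_balance_const hV hσ hC
  have hw := E.weight_pos hσ hC
  set W := ∑ k, E.weight k with hW
  have hWpos : 0 < W := Finset.sum_pos (fun k _ => hw k) Finset.univ_nonempty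
  obtain ⟨i₁, -, hi₁⟩ := Finset.exists_min_image Finset.univ E.weight Finset.univ_nonempty
  -- The bounds `Balanced.lower` for `c` and `Balanced.upper` for `q` lose `K * D₁` each; a gap of
  -- `n₁` in the totals covers both.
  obtain ⟨n₁, hn₁⟩ := exists_nat_ge ((2 * K * D₁) / E.weight i₁)
  rw [div_le_iff₀ (hw i₁)] at hn₁
  set D := max n₀ (n₁ + 1) with hD
  have hdom : ∀ c q, E.Balanced D₁ c → E.IsOptCount q → ∑ k, q k + n₁ ≤ ∑ k, c k → q ≤ c := by
    intro c q hc hq hsum k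
    have h1 := hc.lower k
    have h2 := (hopt q hq).upper k
    have h3 : ((∑ j, q j : ℕ) : ℝ) + n₁ ≤ ((∑ j, c j : ℕ) : ℝ) := by exact_mod_cast hsum
    have h4 := mul_le_mul_of_nonneg_right h3 (hw k).le
    have h5 : (n₁ : ℝ) * E.weight i₁ ≤ n₁ * E.weight k :=
      mul_le_mul_of_nonneg_left (hi₁ k (Finset.mem_univ k)) (by positivity)
    have h6 : (q k : ℝ) * W ≤ c k * W := by linarith
    exact_mod_cast le_of_mul_le_mul_right h6 hWpos
  have hsum : ∀ (c : Fin K → ℕ) N, ∑ k, (c + E.bestBlock c N) k = ∑ k, c k + N := by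
    intro c N
    simp [Finset.sum_add_distrib, sum_bestBlock]
  refine ⟨D, fun B hB => ⟨fun c q => ∑ k, q k ≤ ∑ k, c k ∧ (E.IsOptCount c ∨
    ∑ k, q k + D ≤ ∑ k, c k ∧ E.Balanced D₁ c), ?_, ?_, fun c q h => h.1, ?_⟩⟩
  · exact ⟨le_rfl, Or.inl E.isOptCount_zero⟩
  · rintro c q ⟨hle, hc | ⟨hge, hc⟩⟩
    · exact hc.le_of_sum_le hV hle
    · obtain ⟨q', hq', ho⟩ := E.exists_isOptCount (∑ k, q k)
      have h1 : q' ≤ c := hdom c q' hc ho (by omega)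
      exact (E.posteriorVar_antitone hV h1).trans (ho q hq'.symm)
  · rintro c q n ⟨hle, hor⟩
    have hn : ∑ k, (q + n) k = ∑ k, q k + ∑ k, n k := by simp [Finset.sum_add_distrib]
    have hb := le_boost B D (∑ k, n k) (∑ k, c k - ∑ k, q k)
    refine ⟨by rw [hsum, hn]; omega, ?_⟩
    by_cases hadv : ∑ k, q k + D ≤ ∑ k, c k
    · right
      refine ⟨by rw [hsum, hn]; omega, hstep c _ (by omega) ?_⟩
      rcases hor with hc | hc
      · exact hopt c hc
      · exact hc.2
    · left
      rcases hor with hc | hc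
      · by_cases h0 : ∑ k, n k = 0
        · have h1 : boost B D (∑ k, n k) (∑ k, c k - ∑ k, q k) = 0 := by simp [boost, h0]
          rw [h1]
          exact hc.add_bestBlock le_rfl (by simp)
        -- A nonempty block has at least `D` signals here: either it is raised to `B ≥ D`, or its
        -- intensity was already at least `B`. So optimal counts at the new total dominate `c`, and
        -- the myopic block reaches the optimum.
        · have h1 : D ≤ boost B D (∑ k, n k) (∑ k, c k - ∑ k, q k) := by
            unfold boost; split_ifs <;> omega
          obtain ⟨q', hq', ho⟩ := E.exists_isOptCount
            (∑ k, c k + boost B D (∑ k, n k) (∑ k, c k - ∑ k, q k))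
          refine ho.add_bestBlock ?_ hq'
          exact hdom q' c (hopt q' ho) hc (by omega)
      · exact absurd hc.1 hadv

end InfoEnv

/-! ### Separable environments: optimal counts are reached by myopic blocks. -/

namespace InfoEnv

variable {K : ℕ} [NeZero K]

/-- If no single observation helped, then `θ₁` would be uncorrelated with every signal mean under
the prior; as `θ₁` is a combination of the signal means, its variance would vanish. This excludes
the value `+∞` of the separable sum at optimal counts with a positive total. -/
lemma exists_posteriorVar_single_lt (E : InfoEnv K) (hV : E.V₀.PosDef)
    (hσ : ∀ k, 0 < E.sigmaSq k) (hC : E.NonRedundant) :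
    ∃ k, E.posteriorVar (Pi.single k 1) < E.posteriorVar 0 := by
  by_contra! h
  have hx : ∀ k, E.sourceCov (Pi.single k 1) k = 0 := by
    intro k
    have h1 := E.posteriorVar_compare hV 0 (Pi.single k 1)
    rw [Finset.sum_eq_single k (fun i _ hi => by simp [hi]) (by simp)] at h1
    have hs : (0 : ℝ) < E.sigmaSq k := by exact_mod_cast hσ k
    have h2 : 1 / (E.sigmaSq k : ℝ) * E.sourceCov (Pi.single k 1) k ^ 2 ≤ 0 := by
      have := h k
      simp only [Pi.single_eq_same, Nat.cast_one, Pi.zero_apply, Nat.cast_zero, sub_zero] at h1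
      linarith
    have h3 : E.sourceCov (Pi.single k 1) k ^ 2 ≤ 0 := by
      by_contra! h3
      have : 0 < 1 / (E.sigmaSq k : ℝ) * E.sourceCov (Pi.single k 1) k ^ 2 := by positivity
      linarith
    exact pow_eq_zero_iff two_ne_zero |>.1 (le_antisymm h3 (sq_nonneg _))
  have hobs : E.obsInfo 0 = 0 := by simp [obsInfo]
  have hrow : ∀ k, E.covRow (Pi.single k 1) = E.covRow 0 := by
    intro k
    have h1 := E.precision_covRow hV (Pi.single k 1)
    have h2 : E.obsInfo (Pi.single k 1) *ᵥ E.covRow (Pi.single k 1) = 0 := by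
      rw [obsInfo, ← Matrix.mulVec_mulVec, ← Matrix.mulVec_mulVec]
      have : Matrix.diagonal (fun i => ((Pi.single k 1 : Fin K → ℕ) i : ℝ) / (E.sigmaSq i : ℝ)) *ᵥ
          (E.C *ᵥ E.covRow (Pi.single k 1)) = 0 := by
        ext i
        rw [Matrix.mulVec_diagonal]
        by_cases hi : i = k
        · subst hi
          have := hx i
          rw [sourceCov] at this
          simp [this]
        · simp [hi]
      rw [this, Matrix.mulVec_zero]
    have h3 := E.precision_covRow hV 0
    rw [Matrix.add_mulVec, h2, add_zero] at h1
    rw [hobs, add_zero] at h3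
    have h4 := congrArg (fun v => E.V₀ *ᵥ v) (h1.trans h3.symm)
    simpa [Matrix.mulVec_mulVec,
      Matrix.mul_nonsing_inv _ ((Matrix.isUnit_iff_isUnit_det _).1 hV.isUnit)] using h4
  have h0 : E.sourceCov 0 = 0 := by
    ext k
    have := hx k
    rw [sourceCov, hrow] at this
    rw [sourceCov, this, Pi.zero_apply]
  have h1 := E.posteriorVar_eq_sum hC 0
  rw [h0] at h1
  have := E.posteriorVar_pos hV 0
  simp at h1
  linarith

/-- Convexity, between natural numbers, of a function that does not take the value `⊥`. -/
lemma IsConvex.exchange {g : ℝ≥0 → EReal} (hg : IsConvex g) {u v : ℕ} (huv : u < v)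
    (hu : g u ≠ ⊤) (hv : g v ≠ ⊤) :
    g ((u + 1 : ℕ) : ℝ≥0) + g ((v - 1 : ℕ) : ℝ≥0) ≤ g u + g v := by
  rcases Nat.lt_or_ge (u + 1) v with h | h
  · have hd : (0 : ℝ≥0) < ((v - u : ℕ) : ℝ≥0) := by
      have : 0 < v - u := by omega
      exact_mod_cast this
    -- The points `u + 1` and `v - 1` are convex combinations of `u` and `v` with interchanged
    -- weights, so the two convexity inequalities add up to the claim.
    set a : ℝ≥0 := ((v - u - 1 : ℕ) : ℝ≥0) / ((v - u : ℕ) : ℝ≥0) with ha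
    set b : ℝ≥0 := 1 / ((v - u : ℕ) : ℝ≥0) with hb
    have ha0 : 0 < a := div_pos (by exact_mod_cast (by omega : 0 < v - u - 1)) hd
    have hb0 : 0 < b := div_pos one_pos hd
    have hcast : ((v - u - 1 : ℕ) : ℝ≥0) + 1 = ((v - u : ℕ) : ℝ≥0) := by
      exact_mod_cast (by omega : v - u - 1 + 1 = v - u)
    have hab : a + b = 1 := by
      rw [ha, hb, ← add_div, hcast, div_self hd.ne']
    have hvu : (v : ℝ≥0) = u + ((v - u : ℕ) : ℝ≥0) := by
      exact_mod_cast (by omega : v = u + (v - u))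
    have e1 : a * u + b * v = ((u + 1 : ℕ) : ℝ≥0) := by
      rw [hvu, mul_add, ← add_assoc, ← add_mul, hab, hb]
      field_simp
      push_cast
      ring
    have e2 : b * u + a * v = ((v - 1 : ℕ) : ℝ≥0) := by
      rw [hvu, mul_add, ← add_assoc, ← add_mul, add_comm b a, hab, ha, div_mul_cancel₀ _ hd.ne',
        one_mul]
      exact_mod_cast (by omega : u + (v - u - 1) = v - 1)
    have h1 := hg.2 u v a b ha0 hb0 hab
    have h2 := hg.2 u v b a hb0 ha0 (by rw [add_comm, hab])
    rw [e1] at h1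
    rw [e2] at h2
    refine (add_le_add h1 h2).trans (le_of_eq ?_)
    lift g u to ℝ using ⟨hu, hg.1 _⟩ with x
    lift g v to ℝ using ⟨hv, hg.1 _⟩ with y
    have hab' : (a : ℝ) + b = 1 := by exact_mod_cast hab
    norm_cast
    calc ((a : ℝ) * x + b * y) + (b * x + a * y) = ((a : ℝ) + b) * (x + y) := by ring
      _ = x + y := by rw [hab', one_mul]
  · have : v = u + 1 := by omega
    subst this
    simp [add_comm]

/-- In a separable environment, myopic blocks lead from optimal counts to optimal counts. -/
lemma Separable.add_bestBlock (E : InfoEnv K) (hV : E.V₀.PosDef)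
    (hσ : ∀ k, 0 < E.sigmaSq k) (hC : E.NonRedundant) (hsep : E.Separable) {c : Fin K → ℕ}
    (hc : E.IsOptCount c) (N : ℕ) : E.IsOptCount (c + E.bestBlock c N) := by
  classical
  -- At `c = 0` the separable sum may be infinite and could not be cancelled below; there the claim
  -- is immediate from the choice of the block.
  rcases Nat.eq_zero_or_pos (∑ k, c k) with hc0 | hcpos
  · have : c = 0 := by
      ext k
      exact Finset.sum_eq_zero_iff.1 hc0 k (Finset.mem_univ k)
    obtain ⟨q, hq, ho⟩ := E.exists_isOptCount N
    exact ho.add_bestBlock (by rw [this]; exact zero_le) (by rw [hc0, hq, zero_add])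
  obtain ⟨g, F, hg, hF, hfF⟩ := hsep
  set G : (Fin K → ℕ) → EReal := fun q => ∑ k, g k (q k) with hG
  have hmono : ∀ q q', E.posteriorVar q ≤ E.posteriorVar q' ↔ G q ≤ G q' := by
    intro q q'
    rw [hfF, hfF]
    exact hF.le_iff_le ⟨q, rfl⟩ ⟨q', rfl⟩
  -- the minimal sums are finite
  have hfin : ∀ q, 0 < ∑ k, q k → E.IsOptCount q → G q ≠ ⊤ := by
    intro q hq ho htop
    obtain ⟨k, hk⟩ := E.exists_posteriorVar_single_lt hV hσ hC
    obtain ⟨q', hle, hsum⟩ := exists_le_sum_eq (Pi.single k 1 : Fin K → ℕ) (N := ∑ k, q k)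
      (by simpa using Nat.succ_le_of_lt hq)
    have h1 : E.posteriorVar q ≤ E.posteriorVar (Pi.single k 1) :=
      (ho q' hsum).trans (E.posteriorVar_antitone hV hle)
    -- An infinite sum is the largest possible one, so monotonicity of `F` would give `q` the
    -- largest variance of all.
    have h2 : E.posteriorVar 0 ≤ E.posteriorVar q := (hmono _ _).2 (by rw [htop]; exact le_top)
    linarith
  have hcoord : ∀ q, G q ≠ ⊤ → ∀ k, g k (q k) ≠ ⊤ := by
    intro q hq k hk
    apply hq
    simp only [hG]
    rw [← Finset.add_sum_erase _ _ (Finset.mem_univ k), hk]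
    refine EReal.top_add_of_ne_bot ?_
    exact Finset.sum_induction _ (fun x => x ≠ ⊥) (fun a b ha hb => by simp [ha, hb])
      (by simp) (fun i _ => (hg i).1 _)
  -- an optimal point at the new total that is closest to `c`
  set T : Finset (Fin K → ℕ) :=
    (Finset.piAntidiag Finset.univ (∑ k, c k + N)).filter E.IsOptCount with hT
  have hTne : T.Nonempty := by
    obtain ⟨q, hq, ho⟩ := E.exists_isOptCount (∑ k, c k + N)
    exact ⟨q, by simp [hT, hq, ho]⟩
  obtain ⟨q, hqT, hqmax⟩ := Finset.exists_max_image T (fun q => ∑ k, min (q k) (c k)) hTne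
  have hqs : ∑ k, q k = ∑ k, c k + N := by simpa using (Finset.mem_filter.1 hqT).1
  have hqo : E.IsOptCount q := (Finset.mem_filter.1 hqT).2
  refine hqo.add_bestBlock ?_ hqs
  by_contra hle
  obtain ⟨j, hj⟩ : ∃ j, q j < c j := by
    rw [Pi.le_def] at hle
    push Not at hle
    exact hle
  obtain ⟨i, hi⟩ : ∃ i, c i < q i := by
    by_contra! h
    have := Finset.sum_lt_sum (fun k _ => h k) ⟨j, Finset.mem_univ j, hj⟩
    omega
  have hij : i ≠ j := by rintro rfl; omega
  have hqfin := hfin q (by omega) hqo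
  have hcfin := hfin c hcpos hc
  set q' := exchange q i j with hq'
  set c' := exchange c j i with hc'
  have hq's : ∑ k, q' k = ∑ k, q k := sum_exchange q hij (by omega)
  have hc's : ∑ k, c' k = ∑ k, c k := sum_exchange c hij.symm (by omega)
  -- Moving one unit from `i` to `j` in `q` and from `j` to `i` in `c` brings the two counts closer
  -- in both coordinates, which by convexity does not raise the total of the sums.
  have hGsum : G q' + G c' ≤ G q + G c := by
    simp only [hG]
    rw [← Finset.sum_add_distrib, ← Finset.sum_add_distrib]
    refine Finset.sum_le_sum fun k _ => ?_
    by_cases hki : k = i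
    · subst hki
      rw [hq', hc', exchange_left q hij, exchange_right, add_comm, add_comm (g k (q k))]
      exact (hg k).exchange hi (hcoord c hcfin k) (hcoord q hqfin k)
    by_cases hkj : k = j
    · subst hkj
      rw [hq', hc', exchange_left c hij.symm, exchange_right]
      exact (hg k).exchange hj (hcoord q hqfin k) (hcoord c hcfin k)
    · rw [hq', hc', exchange_of_ne q hki hkj, exchange_of_ne c hkj hki]
  have hcc' : G c ≤ G c' := (hmono _ _).1 (hc c' hc's)
  have hbot : ∀ q, G q ≠ ⊥ := fun q =>
    Finset.sum_induction _ (fun x => x ≠ ⊥) (fun a b ha hb => by simp [ha, hb])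
      (by simp) (fun i _ => (hg i).1 _)
  -- Optimality of `c` means that the change from `c` to `c'` gains nothing, so `q'` is no worse
  -- than `q`. But `q'` overlaps more with `c`, against the choice of `q`.
  have hqq' : G q' ≤ G q := by
    have h1 : G q' + G c ≤ G q + G c := (add_le_add le_rfl hcc').trans hGsum
    lift G c to ℝ using ⟨hcfin, hbot c⟩ with x
    exact (EReal.addLECancellable_coe x).add_le_add_iff_right.1 h1
  have hq'o : E.IsOptCount q' := fun m hm =>
    ((hmono _ _).2 hqq').trans (hqo m (hm.trans hq's))
  have hmem : q' ∈ T := by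
    rw [hT, Finset.mem_filter]
    exact ⟨by simp [hq's, hqs], hq'o⟩
  have h1 := hqmax q' hmem
  have h2 : ∑ k, min (q k) (c k) < ∑ k, min (q' k) (c k) := by
    refine Finset.sum_lt_sum (fun k _ => ?_) ⟨j, Finset.mem_univ j, ?_⟩
    · by_cases hki : k = i
      · subst hki; rw [hq', exchange_left q hij]; omega
      by_cases hkj : k = j
      · subst hkj; rw [hq', exchange_right]; omega
      · rw [hq', exchange_of_ne q hki hkj]
    · rw [hq', exchange_right]; omega
  omega

/-- With `B = D = 0`, `boost` leaves every intensity unchanged, so the totals of both counts agree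
forever. -/
lemma Separable.simulationInvariant (E : InfoEnv K) (hV : E.V₀.PosDef)
    (hσ : ∀ k, 0 < E.sigmaSq k) (hC : E.NonRedundant) (hsep : E.Separable) :
    E.IsSimulationInvariant 0 0 fun c q => E.IsOptCount c ∧ ∑ k, q k = ∑ k, c k where
  zero := ⟨E.isOptCount_zero, rfl⟩
  posteriorVar_le c q h := h.1 q h.2
  sum_le c q h := h.2.le
  step c q n h := by
    refine ⟨Separable.add_bestBlock E hV hσ hC hsep h.1 _, ?_⟩
    simp [Finset.sum_add_distrib, sum_bestBlock, boost, h.2]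

end InfoEnv

end SignalAcquisition

open scoped MatrixOrder

namespace SignalAcquisition

/-! ### Gaussian updating after one block of signals -/

/-- The realizations of a block of signals. -/
abbrev Block {K : ℕ} (n : Fin K → ℕ) : Type := (k : Fin K) → Fin (n k) → ℝ

namespace InfoEnv

variable {K : ℕ}

/-- The law of the noise in a block of signals. -/
noncomputable def blockNoise (E : InfoEnv K) (n : Fin K → ℕ) : Measure (Block n) :=
  Measure.pi fun k => Measure.pi fun _ : Fin (n k) => gaussianReal 0 (E.sigmaSq k)

instance (E : InfoEnv K) (n : Fin K → ℕ) : IsProbabilityMeasure (E.blockNoise n) := by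
  unfold blockNoise; infer_instance

/-- The signals at the state `θ` with noise `e`. -/
noncomputable def observe (E : InfoEnv K) {n : Fin K → ℕ} (θ : EuclideanSpace ℝ (Fin K))
    (e : Block n) : Block n :=
  fun k j => (∑ i, E.C k i * θ i) + e k j

/-- The standard Gaussian law of state vectors. -/
noncomputable abbrev stdState (K : ℕ) : Measure (EuclideanSpace ℝ (Fin K)) :=
  stdGaussian (EuclideanSpace ℝ (Fin K))

/-- A square root of the posterior covariance matrix. -/
noncomputable def root (E : InfoEnv K) (q : Fin K → ℕ) :
    EuclideanSpace ℝ (Fin K) →L[ℝ] EuclideanSpace ℝ (Fin K) :=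
  Matrix.toEuclideanCLM (𝕜 := ℝ) (CFC.sqrt (E.postCov q))

/-- The change of the posterior mean of the states caused by the signal innovations `y`, where `q`
are the counts including the block. -/
noncomputable def gain (E : InfoEnv K) (q : Fin K → ℕ) {n : Fin K → ℕ} (y : Block n) :
    EuclideanSpace ℝ (Fin K) :=
  WithLp.toLp 2 (E.postCov q *ᵥ (E.Cᵀ *ᵥ fun k => (∑ j, y k j) / (E.sigmaSq k : ℝ)))

lemma measurable_observe (E : InfoEnv K) {n : Fin K → ℕ} {α : Type*} [MeasurableSpace α]
    {f : α → EuclideanSpace ℝ (Fin K)} {g : α → Block n} (hf : Measurable f)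
    (hg : Measurable g) : Measurable fun a => E.observe (f a) (g a) := by
  refine measurable_pi_lambda _ fun k => measurable_pi_lambda _ fun j => ?_
  unfold observe
  fun_prop

lemma measurable_gain (E : InfoEnv K) (q : Fin K → ℕ) {n : Fin K → ℕ} :
    Measurable fun y : Block n => E.gain q y := by
  unfold gain
  refine (WithLp.measurable_toLp 2 _).comp ?_
  simp only [Matrix.mulVec_mulVec]
  refine measurable_pi_lambda _ fun i => ?_
  simp only [Matrix.mulVec, dotProduct]
  fun_prop

lemma measurable_root_apply (E : InfoEnv K) (q : Fin K → ℕ) : Measurable (E.root q) :=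
  (E.root q).continuous.measurable

/-- The inner product of a block with coefficients. -/
def blockDot {n : Fin K → ℕ} (u y : Block n) : ℝ := ∑ k, ∑ j, u k j * y k j

/-- The variance of `blockDot u y + w ⬝ᵥ θ` when `θ` is centered with covariance `postCov q`. -/
noncomputable def obsVar (E : InfoEnv K) (q : Fin K → ℕ) {n : Fin K → ℕ} (u : Block n)
    (w : Fin K → ℝ) : ℝ :=
  (E.Cᵀ *ᵥ (fun k => ∑ j, u k j) + w) ⬝ᵥ
      (E.postCov q *ᵥ (E.Cᵀ *ᵥ (fun k => ∑ j, u k j) + w)) +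
    ∑ k, (E.sigmaSq k : ℝ) * ∑ j, u k j ^ 2

lemma integral_exp_gaussian (r : ℝ) (v : ℝ≥0) :
    ∫ x, Complex.exp (((r * x : ℝ) : ℂ) * Complex.I) ∂(gaussianReal 0 v) =
      Complex.exp (-((v * r ^ 2 : ℝ) : ℂ) / 2) := by
  have h := charFun_gaussianReal (μ := 0) (v := v) r
  rw [charFun_apply_real] at h
  push_cast at h ⊢
  rw [h]
  congr 1
  ring

lemma integral_exp_root (E : InfoEnv K) (hV : E.V₀.PosDef) (q : Fin K → ℕ) (w : Fin K → ℝ) :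
    ∫ z, Complex.exp (((w ⬝ᵥ WithLp.ofLp (E.root q z) : ℝ) : ℂ) * Complex.I) ∂(stdState K) =
      Complex.exp (-((w ⬝ᵥ (E.postCov q *ᵥ w) : ℝ) : ℂ) / 2) := by
  have h := charFun_multivariateGaussian (μ := 0) (E.postCov_posDef hV q).posSemidef
    (WithLp.toLp 2 w)
  rw [charFun_apply, multivariateGaussian,
    integral_map (by fun_prop) (Measurable.aestronglyMeasurable (by fun_prop))] at h
  simp only [zero_add, inner_zero_right, Complex.ofReal_zero, zero_mul, zero_sub] at h
  rw [neg_div]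
  rw [← h]
  rfl

lemma integral_exp_blockNoise (E : InfoEnv K) {n : Fin K → ℕ} (u : Block n) :
    ∫ e, Complex.exp (((blockDot u e : ℝ) : ℂ) * Complex.I) ∂(E.blockNoise n) =
      Complex.exp (-((∑ k, (E.sigmaSq k : ℝ) * ∑ j, u k j ^ 2 : ℝ) : ℂ) / 2) := by
  simp only [blockDot, Complex.ofReal_sum, Finset.sum_mul, Complex.exp_sum, blockNoise]
  rw [integral_fintype_prod_eq_prod
    (f := fun k (x : Fin (n k) → ℝ) => ∏ j, Complex.exp (((u k j * x j : ℝ) : ℂ) * Complex.I))]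
  simp only [← Complex.ofReal_sum, neg_div]
  rw [Complex.ofReal_sum, Finset.sum_div, ← Finset.sum_neg_distrib, Complex.exp_sum]
  refine Finset.prod_congr rfl fun k _ => ?_
  rw [integral_fintype_prod_eq_prod
    (f := fun j (x : ℝ) => Complex.exp (((u k j * x : ℝ) : ℂ) * Complex.I))]
  simp only [integral_exp_gaussian]
  rw [← Complex.exp_sum]
  congr 1
  push_cast
  rw [Finset.mul_sum, Finset.sum_div, ← Finset.sum_neg_distrib]
  refine Finset.sum_congr rfl fun j _ => ?_
  ring

lemma blockDot_observe (E : InfoEnv K) {n : Fin K → ℕ} (u e : Block n)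
    (θ : EuclideanSpace ℝ (Fin K)) :
    blockDot u (E.observe θ e) =
      (E.Cᵀ *ᵥ (fun k => ∑ j, u k j)) ⬝ᵥ WithLp.ofLp θ + blockDot u e := by
  rw [Matrix.mulVec_transpose, ← Matrix.dotProduct_mulVec]
  simp only [blockDot, observe, mul_add, Finset.sum_add_distrib, ← Finset.sum_mul]
  rfl

lemma integral_exp_observe (E : InfoEnv K) (hV : E.V₀.PosDef) (q : Fin K → ℕ) {n : Fin K → ℕ}
    (u : Block n) (w : Fin K → ℝ) :
    ∫ p, Complex.exp (((blockDot u (E.observe (E.root q p.1) p.2) +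
        w ⬝ᵥ WithLp.ofLp (E.root q p.1) : ℝ) : ℂ) * Complex.I)
        ∂((stdState K).prod (E.blockNoise n)) =
      Complex.exp (-((E.obsVar q u w : ℝ) : ℂ) / 2) := by
  have h : ∀ p : EuclideanSpace ℝ (Fin K) × Block n,
      Complex.exp (((blockDot u (E.observe (E.root q p.1) p.2) +
        w ⬝ᵥ WithLp.ofLp (E.root q p.1) : ℝ) : ℂ) * Complex.I) =
      Complex.exp ((((E.Cᵀ *ᵥ (fun k => ∑ j, u k j) + w) ⬝ᵥ
        WithLp.ofLp (E.root q p.1) : ℝ) : ℂ) * Complex.I) *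
        Complex.exp (((blockDot u p.2 : ℝ) : ℂ) * Complex.I) := by
    intro p
    rw [blockDot_observe, ← Complex.exp_add, add_dotProduct]
    congr 1
    push_cast
    ring
  simp only [h]
  rw [integral_prod_mul
    (fun z => Complex.exp ((((E.Cᵀ *ᵥ (fun k => ∑ j, u k j) + w) ⬝ᵥ
        WithLp.ofLp (E.root q z) : ℝ) : ℂ) * Complex.I))
    (fun e : Block n => Complex.exp (((blockDot u e : ℝ) : ℂ) * Complex.I)),
    integral_exp_root E hV, integral_exp_blockNoise, ← Complex.exp_add, obsVar]
  congr 1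
  push_cast
  ring

/-- The coefficients of the linear functional `w` of the gain. -/
noncomputable def gainCoeff (E : InfoEnv K) (q : Fin K → ℕ) (n : Fin K → ℕ) (w : Fin K → ℝ) :
    Block n :=
  fun k _ => (E.C *ᵥ (E.postCov q *ᵥ w)) k / (E.sigmaSq k : ℝ)

lemma dotProduct_gain (E : InfoEnv K) (hV : E.V₀.PosDef) (q : Fin K → ℕ) {n : Fin K → ℕ}
    (w : Fin K → ℝ) (y : Block n) :
    w ⬝ᵥ WithLp.ofLp (E.gain q y) = blockDot (E.gainCoeff q n w) y := by
  simp only [gain]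
  rw [Matrix.dotProduct_mulVec, Matrix.dotProduct_mulVec, ← Matrix.mulVec_transpose,
    ← Matrix.mulVec_transpose, Matrix.transpose_transpose, postCov_transpose E hV]
  simp only [blockDot, gainCoeff, dotProduct]
  refine Finset.sum_congr rfl fun k _ => ?_
  rw [← Finset.mul_sum]
  ring

lemma blockDot_add_left {n : Fin K → ℕ} (u v y : Block n) :
    blockDot (u + v) y = blockDot u y + blockDot v y := by
  simp [blockDot, add_mul, Finset.sum_add_distrib]

/-- The law of total variance for the functional `u ⬝ y + w ⬝ θ`: given the block `y`, the state is
the gain plus an orthogonal error with covariance `postCov (q + n)`. The gain is linear in `y`, with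
coefficients `gainCoeff`, so the first term is again a variance of a combination of signals. -/
lemma obsVar_add_gainCoeff (E : InfoEnv K) (hV : E.V₀.PosDef) (hσ : ∀ k, 0 < E.sigmaSq k)
    (q : Fin K → ℕ) {n : Fin K → ℕ} (u : Block n) (w : Fin K → ℝ) :
    E.obsVar q (u + E.gainCoeff (q + n) n w) 0 + w ⬝ᵥ (E.postCov (q + n) *ᵥ w) =
      E.obsVar q u w := by
  set α := E.Cᵀ *ᵥ (fun k => ∑ j, u k j) with hα
  set v := E.postCov (q + n) *ᵥ w with hv
  have hs : ∀ i, (E.sigmaSq i : ℝ) ≠ 0 := fun i => by exact_mod_cast (hσ i).ne'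
  have h1 : E.Cᵀ *ᵥ (fun k => ∑ j, (u + E.gainCoeff (q + n) n w) k j) =
      α + E.obsInfo n *ᵥ v := by
    have : (fun k => ∑ j, (u + E.gainCoeff (q + n) n w) k j) = (fun k => ∑ j, u k j) +
        Matrix.diagonal (fun k => (n k : ℝ) / (E.sigmaSq k : ℝ)) *ᵥ (E.C *ᵥ v) := by
      ext k
      simp only [Pi.add_apply, Finset.sum_add_distrib, Matrix.mulVec_diagonal, gainCoeff,
        Finset.sum_const, Finset.card_univ, Fintype.card_fin, nsmul_eq_mul, ← hv]
      ring
    rw [this, Matrix.mulVec_add, obsInfo, ← Matrix.mulVec_mulVec, ← Matrix.mulVec_mulVec]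
  have h2 : ∑ k, (E.sigmaSq k : ℝ) * ∑ j, (u + E.gainCoeff (q + n) n w) k j ^ 2 =
      ∑ k, (E.sigmaSq k : ℝ) * ∑ j, u k j ^ 2 + 2 * (α ⬝ᵥ v) + v ⬝ᵥ (E.obsInfo n *ᵥ v) := by
    rw [hα, Matrix.mulVec_transpose, ← Matrix.dotProduct_mulVec, dotProduct_obsInfo]
    simp only [dotProduct, Finset.mul_sum]
    rw [← Finset.sum_add_distrib, ← Finset.sum_add_distrib]
    refine Finset.sum_congr rfl fun k _ => ?_
    simp only [Pi.add_apply, gainCoeff, ← hv, Finset.sum_mul, Finset.mul_sum]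
    rw [← Finset.sum_add_distrib]
    have h3 : (n k : ℝ) / (E.sigmaSq k : ℝ) * ((E.C *ᵥ v) k * (E.C *ᵥ v) k) =
        ∑ _j : Fin (n k), (E.C *ᵥ v) k ^ 2 / (E.sigmaSq k : ℝ) := by
      simp only [Finset.sum_const, Finset.card_univ, Fintype.card_fin, nsmul_eq_mul]
      ring
    rw [h3, ← Finset.sum_add_distrib]
    refine Finset.sum_congr rfl fun j _ => ?_
    have := hs k
    field_simp
    ring
  -- This is `postCov_update` applied to `w`; it removes `obsInfo n` from all mixed terms.
  have h4 : E.postCov q *ᵥ (E.obsInfo n *ᵥ v) = E.postCov q *ᵥ w - v := by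
    have := congrArg (fun A => A *ᵥ w) (E.postCov_update hV q n)
    simp only [Matrix.add_mulVec, ← Matrix.mulVec_mulVec] at this
    rw [← this, ← hv]
    simp
  have hsym : ∀ x y : Fin K → ℝ, x ⬝ᵥ (E.postCov q *ᵥ y) = y ⬝ᵥ (E.postCov q *ᵥ x) := by
    intro x y
    rw [Matrix.dotProduct_mulVec, ← Matrix.mulVec_transpose, postCov_transpose E hV,
      dotProduct_comm]
  unfold obsVar
  rw [h1, h2, ← hα]
  have h5 := hsym (E.obsInfo n *ᵥ v) α
  have h6 := hsym (E.obsInfo n *ᵥ v) w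
  rw [h4, dotProduct_sub] at h5 h6
  simp only [add_zero, Matrix.mulVec_add, dotProduct_add, add_dotProduct, h4, dotProduct_sub]
  rw [dotProduct_comm v (E.obsInfo n *ᵥ v), hsym w α]
  linarith

lemma linear_eq_blockDot {n : Fin K → ℕ} (L : StrongDual ℝ (Block n)) (y : Block n) :
    L y = blockDot (fun k j => L (Pi.single k (Pi.single j 1))) y := by
  have h : y = ∑ k, ∑ j, y k j • (Pi.single k (Pi.single j 1) : Block n) := by
    ext k j
    simp only [Finset.sum_apply, Pi.smul_apply, smul_eq_mul]
    rw [Finset.sum_eq_single k, Finset.sum_eq_single j]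
    · simp
    · intro b _ hb; simp [hb.symm]
    · simp
    · intro b _ hb; simp [hb.symm]
    · simp
  conv_lhs => rw [h]
  simp only [map_sum, map_smul, blockDot, smul_eq_mul, mul_comm]

/-- Joint laws are identified by their characteristic functions; coordinates `u`, `w` describe every
continuous linear functional on the product space. -/
lemma ext_of_integral_exp {n : Fin K → ℕ} {μ ν : Measure (Block n × EuclideanSpace ℝ (Fin K))}
    [IsFiniteMeasure μ] [IsFiniteMeasure ν]
    (h : ∀ (u : Block n) (w : Fin K → ℝ),
      ∫ p, Complex.exp (((blockDot u p.1 + w ⬝ᵥ WithLp.ofLp p.2 : ℝ) : ℂ) * Complex.I) ∂μ =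
      ∫ p, Complex.exp (((blockDot u p.1 + w ⬝ᵥ WithLp.ofLp p.2 : ℝ) : ℂ) * Complex.I) ∂ν) :
    μ = ν := by
  refine Measure.ext_of_charFunDual ?_
  ext L
  set L₁ : StrongDual ℝ (Block n) := L.comp (ContinuousLinearMap.inl ℝ _ _) with hL₁
  set L₂ : StrongDual ℝ (EuclideanSpace ℝ (Fin K)) :=
    L.comp (ContinuousLinearMap.inr ℝ _ _) with hL₂
  have hL : ∀ p : Block n × EuclideanSpace ℝ (Fin K), L p =
      blockDot (fun k j => L₁ (Pi.single k (Pi.single j 1))) p.1 +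
        (fun i => L₂ (EuclideanSpace.single i 1)) ⬝ᵥ WithLp.ofLp p.2 := by
    intro p
    have h3 : p.2 = ∑ i, p.2 i • EuclideanSpace.single i (1 : ℝ) := by
      ext i
      simp [Finset.sum_apply, Pi.single_apply]
    have e2 : L₂ p.2 = (fun i => L₂ (EuclideanSpace.single i 1)) ⬝ᵥ WithLp.ofLp p.2 := by
      conv_lhs => rw [h3]
      simp only [map_sum, map_smul, dotProduct, smul_eq_mul, mul_comm]
    rw [← linear_eq_blockDot, ← e2, hL₁, hL₂, ContinuousLinearMap.comp_apply,
      ContinuousLinearMap.comp_apply, ← map_add]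
    simp
  simp only [charFunDual_apply, hL]
  exact h _ _

lemma ext_of_integral_exp_real {n : Fin K → ℕ} {μ ν : Measure (Block n × ℝ)}
    [IsFiniteMeasure μ] [IsFiniteMeasure ν]
    (h : ∀ (u : Block n) (r : ℝ),
      ∫ p, Complex.exp (((blockDot u p.1 + r * p.2 : ℝ) : ℂ) * Complex.I) ∂μ =
      ∫ p, Complex.exp (((blockDot u p.1 + r * p.2 : ℝ) : ℂ) * Complex.I) ∂ν) :
    μ = ν := by
  refine Measure.ext_of_charFunDual ?_
  ext L
  set L₁ : StrongDual ℝ (Block n) := L.comp (ContinuousLinearMap.inl ℝ _ _) with hL₁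
  set L₂ : StrongDual ℝ ℝ := L.comp (ContinuousLinearMap.inr ℝ _ _) with hL₂
  have hL : ∀ p : Block n × ℝ, L p =
      blockDot (fun k j => L₁ (Pi.single k (Pi.single j 1))) p.1 + L₂ 1 * p.2 := by
    intro p
    have e2 : L₂ p.2 = L₂ 1 * p.2 := by
      calc L₂ p.2 = L₂ (p.2 • (1 : ℝ)) := by rw [smul_eq_mul, mul_one]
        _ = _ := by rw [map_smul, smul_eq_mul, mul_comm]
    rw [← linear_eq_blockDot, ← e2, hL₁, hL₂, ContinuousLinearMap.comp_apply,
      ContinuousLinearMap.comp_apply, ← map_add]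
    simp
  simp only [charFunDual_apply, hL]
  exact h _ _

/-- Gaussian updating: the state is the posterior mean given the block plus an independent error
with the posterior covariance matrix. -/
lemma map_observe_eq (E : InfoEnv K) (hV : E.V₀.PosDef) (hσ : ∀ k, 0 < E.sigmaSq k)
    (q n : Fin K → ℕ) :
    ((stdState K).prod (E.blockNoise n)).map
        (fun p => (E.observe (E.root q p.1) p.2, E.root q p.1)) =
      (((stdState K).prod (E.blockNoise n)).prod (stdState K)).map
        (fun p => (E.observe (E.root q p.1.1) p.1.2,
          E.gain (q + n) (E.observe (E.root q p.1.1) p.1.2) + E.root (q + n) p.2)) := by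
  have hobs : Measurable fun p : EuclideanSpace ℝ (Fin K) × Block n =>
      E.observe (E.root q p.1) p.2 :=
    E.measurable_observe ((E.measurable_root_apply q).comp measurable_fst) measurable_snd
  have hgain := E.measurable_gain (q + n) (n := n)
  have hm1 : Measurable fun p : EuclideanSpace ℝ (Fin K) × Block n =>
      (E.observe (E.root q p.1) p.2, E.root q p.1) := hobs.prodMk (by fun_prop)
  have hobs2 : Measurable fun p : (EuclideanSpace ℝ (Fin K) × Block n) ×
      EuclideanSpace ℝ (Fin K) => E.observe (E.root q p.1.1) p.1.2 := hobs.comp measurable_fst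
  have hm2 : Measurable fun p : (EuclideanSpace ℝ (Fin K) × Block n) ×
      EuclideanSpace ℝ (Fin K) => (E.observe (E.root q p.1.1) p.1.2,
          E.gain (q + n) (E.observe (E.root q p.1.1) p.1.2) + E.root (q + n) p.2) :=
    hobs2.prodMk ((hgain.comp hobs2).add (by fun_prop))
  have : IsProbabilityMeasure (((stdState K).prod (E.blockNoise n)).map
        (fun p => (E.observe (E.root q p.1) p.2, E.root q p.1))) :=
    Measure.isProbabilityMeasure_map hm1.aemeasurable
  have : IsProbabilityMeasure ((((stdState K).prod (E.blockNoise n)).prod (stdState K)).map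
        (fun p => (E.observe (E.root q p.1.1) p.1.2,
          E.gain (q + n) (E.observe (E.root q p.1.1) p.1.2) + E.root (q + n) p.2))) :=
    Measure.isProbabilityMeasure_map hm2.aemeasurable
  refine ext_of_integral_exp fun u w => ?_
  have hdot : Measurable fun p : Block n × EuclideanSpace ℝ (Fin K) =>
      Complex.exp (((blockDot u p.1 + w ⬝ᵥ WithLp.ofLp p.2 : ℝ) : ℂ) * Complex.I) := by
    unfold blockDot dotProduct
    fun_prop
  rw [integral_map hm1.aemeasurable hdot.aestronglyMeasurable,
    integral_map hm2.aemeasurable hdot.aestronglyMeasurable, integral_exp_observe E hV]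
  have hsplit : ∀ p : (EuclideanSpace ℝ (Fin K) × Block n) × EuclideanSpace ℝ (Fin K),
      Complex.exp (((blockDot u (E.observe (E.root q p.1.1) p.1.2) + w ⬝ᵥ WithLp.ofLp
        (E.gain (q + n) (E.observe (E.root q p.1.1) p.1.2) + E.root (q + n) p.2) : ℝ) : ℂ) *
          Complex.I) =
      Complex.exp (((blockDot (u + E.gainCoeff (q + n) n w)
        (E.observe (E.root q p.1.1) p.1.2) +
          (0 : Fin K → ℝ) ⬝ᵥ WithLp.ofLp (E.root q p.1.1) : ℝ) : ℂ) * Complex.I) *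
      Complex.exp (((w ⬝ᵥ WithLp.ofLp (E.root (q + n) p.2) : ℝ) : ℂ) * Complex.I) := by
    intro p
    rw [WithLp.ofLp_add, dotProduct_add, dotProduct_gain E hV, blockDot_add_left,
      ← Complex.exp_add, zero_dotProduct]
    congr 1
    push_cast
    ring
  simp only [hsplit]
  rw [integral_prod_mul (fun p : EuclideanSpace ℝ (Fin K) × Block n => Complex.exp
      (((blockDot (u + E.gainCoeff (q + n) n w) (E.observe (E.root q p.1) p.2) +
          (0 : Fin K → ℝ) ⬝ᵥ WithLp.ofLp (E.root q p.1) : ℝ) : ℂ) * Complex.I))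
      (fun z => Complex.exp (((w ⬝ᵥ WithLp.ofLp (E.root (q + n) z) : ℝ) : ℂ) * Complex.I)),
    integral_exp_observe E hV, integral_exp_root E hV, ← Complex.exp_add,
    ← obsVar_add_gainCoeff E hV hσ]
  congr 1
  push_cast
  ring

/-- The law of a scaled standard normal variable is determined by the variance. -/
lemma ext_of_integral_exp_line {μ ν : Measure ℝ} [IsFiniteMeasure μ] [IsFiniteMeasure ν]
    (h : ∀ r : ℝ, ∫ x, Complex.exp (((r * x : ℝ) : ℂ) * Complex.I) ∂μ =
      ∫ x, Complex.exp (((r * x : ℝ) : ℂ) * Complex.I) ∂ν) : μ = ν := by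
  refine Measure.ext_of_charFun ?_
  ext r
  simp only [charFun_apply_real]
  simpa using h r

lemma integral_exp_scaled (r s : ℝ) :
    ∫ x, Complex.exp (((r * (s * x) : ℝ) : ℂ) * Complex.I) ∂(gaussianReal 0 1) =
      Complex.exp (-(((r * s) ^ 2 : ℝ) : ℂ) / 2) := by
  have := integral_exp_gaussian (r * s) 1
  simp only [NNReal.coe_one, one_mul, mul_assoc] at this
  simpa [mul_assoc] using this

/-! ### Gaussian laws involving the payoff-relevant state, and the simulation of one block. -/

section payoffRelevant

variable [NeZero K]

lemma obsVar_single (E : InfoEnv K) (hV : E.V₀.PosDef) (q : Fin K → ℕ) {n : Fin K → ℕ}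
    (u : Block n) (r : ℝ) :
    E.obsVar q u (Pi.single 0 r) = E.obsVar q u 0 +
      2 * r * (∑ k, (∑ j, u k j) * E.sourceCov q k) + r ^ 2 * E.posteriorVar q := by
  have hsym : ∀ x y : Fin K → ℝ, x ⬝ᵥ (E.postCov q *ᵥ y) = y ⬝ᵥ (E.postCov q *ᵥ x) := by
    intro x y
    rw [Matrix.dotProduct_mulVec, ← Matrix.mulVec_transpose, postCov_transpose E hV,
      dotProduct_comm]
  have hs : (Pi.single 0 r : Fin K → ℝ) = r • Pi.single 0 1 := by
    ext i
    by_cases hi : i = 0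
    · subst hi; simp
    · simp [hi]
  have h1 : (E.Cᵀ *ᵥ (fun k => ∑ j, u k j)) ⬝ᵥ (E.postCov q *ᵥ Pi.single 0 r) =
      r * (∑ k, (∑ j, u k j) * E.sourceCov q k) := by
    rw [hs, Matrix.mulVec_smul, dotProduct_smul, smul_eq_mul, Matrix.mulVec_transpose,
      ← Matrix.dotProduct_mulVec]
    rfl
  have h2 : (Pi.single 0 r : Fin K → ℝ) ⬝ᵥ (E.postCov q *ᵥ Pi.single 0 r) =
      r ^ 2 * E.posteriorVar q := by
    rw [hs, Matrix.mulVec_smul, dotProduct_smul, smul_dotProduct, smul_eq_mul, smul_eq_mul,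
      single_dotProduct]
    have := E.covRow_zero q
    rw [covRow] at this
    rw [this]
    ring
  unfold obsVar
  simp only [add_zero, Matrix.mulVec_add, dotProduct_add, add_dotProduct]
  rw [hsym (Pi.single 0 r) (E.Cᵀ *ᵥ fun k => ∑ j, u k j), h1, h2]
  ring

lemma single_dotProduct_postCov (E : InfoEnv K) (q : Fin K → ℕ) (r : ℝ) :
    (Pi.single 0 r : Fin K → ℝ) ⬝ᵥ (E.postCov q *ᵥ Pi.single 0 r) = r ^ 2 * E.posteriorVar q := by
  have hs : (Pi.single 0 r : Fin K → ℝ) = r • Pi.single 0 1 := by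
    ext i
    by_cases hi : i = 0
    · subst hi; simp
    · simp [hi]
  rw [hs, Matrix.mulVec_smul, dotProduct_smul, smul_dotProduct, smul_eq_mul, smul_eq_mul,
    single_dotProduct]
  have := E.covRow_zero q
  rw [covRow] at this
  rw [this]
  ring

/-- The law of the change of the posterior mean of the payoff-relevant state. -/
lemma map_gain_eq (E : InfoEnv K) (hV : E.V₀.PosDef) (hσ : ∀ k, 0 < E.sigmaSq k)
    (q n : Fin K → ℕ) :
    ((stdState K).prod (E.blockNoise n)).map
        (fun p => E.gain (q + n) (E.observe (E.root q p.1) p.2) 0) =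
      (gaussianReal 0 1).map
        (fun g => √(E.posteriorVar q - E.posteriorVar (q + n)) * g) := by
  have hobs : Measurable fun p : EuclideanSpace ℝ (Fin K) × Block n =>
      E.observe (E.root q p.1) p.2 :=
    E.measurable_observe ((E.measurable_root_apply q).comp measurable_fst) measurable_snd
  have hm1 : Measurable fun p : EuclideanSpace ℝ (Fin K) × Block n =>
      E.gain (q + n) (E.observe (E.root q p.1) p.2) 0 := by
    have := (E.measurable_gain (q + n) (n := n)).comp hobs
    fun_prop
  have hm2 : Measurable fun g : ℝ => √(E.posteriorVar q - E.posteriorVar (q + n)) * g := by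
    fun_prop
  have : IsProbabilityMeasure (((stdState K).prod (E.blockNoise n)).map
        (fun p => E.gain (q + n) (E.observe (E.root q p.1) p.2) 0)) :=
    Measure.isProbabilityMeasure_map hm1.aemeasurable
  have : IsProbabilityMeasure ((gaussianReal 0 1).map
        (fun g => √(E.posteriorVar q - E.posteriorVar (q + n)) * g)) :=
    Measure.isProbabilityMeasure_map hm2.aemeasurable
  refine ext_of_integral_exp_line fun r => ?_
  have hdot : Measurable fun x : ℝ => Complex.exp (((r * x : ℝ) : ℂ) * Complex.I) := by fun_prop
  rw [integral_map hm1.aemeasurable hdot.aestronglyMeasurable,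
    integral_map hm2.aemeasurable hdot.aestronglyMeasurable, integral_exp_scaled]
  have hsplit : ∀ p : EuclideanSpace ℝ (Fin K) × Block n,
      r * E.gain (q + n) (E.observe (E.root q p.1) p.2) 0 =
      blockDot (0 + E.gainCoeff (q + n) n (Pi.single 0 r)) (E.observe (E.root q p.1) p.2) +
          (0 : Fin K → ℝ) ⬝ᵥ WithLp.ofLp (E.root q p.1) := by
    intro p
    rw [zero_add, ← dotProduct_gain E hV]
    simp
  simp only [hsplit]
  rw [integral_exp_observe E hV]
  -- With `u = 0` the law of total variance reads: prior variance of `θ₁` equals variance of the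
  -- gain plus posterior variance.
  have h := E.obsVar_add_gainCoeff hV hσ q (0 : Block n) (Pi.single 0 r)
  rw [obsVar_single E hV, single_dotProduct_postCov] at h
  have h0 : E.obsVar q (0 : Block n) 0 = 0 := by
    have : (fun k => ∑ j, (0 : Block n) k j) = 0 := by ext k; simp
    rw [obsVar, this]
    simp
  have hle : E.posteriorVar (q + n) ≤ E.posteriorVar q :=
    E.posteriorVar_antitone hV le_self_add
  rw [h0] at h
  simp only [Pi.zero_apply, Finset.sum_const_zero, zero_mul, mul_zero, add_zero, zero_add] at h
  rw [mul_pow, Real.sq_sqrt (by linarith)]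
  congr 4
  rw [zero_add]
  linarith

/-- The change of the posterior mean of the payoff-relevant state, blurred so that its variance
becomes `posteriorVar q - v`. -/
noncomputable def blurredGain (E : InfoEnv K) (q n : Fin K → ℕ) (v : ℝ)
    (p : (EuclideanSpace ℝ (Fin K) × Block n) × ℝ) : ℝ :=
  E.gain (q + n) (E.observe (E.root q p.1.1) p.1.2) 0 + √(E.posteriorVar (q + n) - v) * p.2

/-- A block of centered signals, simulated from the value `a` of a blurred change of the posterior
mean and independent noise `p`. -/
noncomputable def simulate (E : InfoEnv K) (q n : Fin K → ℕ) (v a : ℝ)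
    (p : (EuclideanSpace ℝ (Fin K) × Block n) × ℝ) : Block n :=
  fun k j => E.observe (E.root q p.1.1) p.1.2 k j +
    -- The coefficient is covariance over variance in the regression of a signal on the blurred
    -- gain. An independent copy of the block supplies the residual, and its fitted part is replaced
    -- by the one belonging to `a`.
    E.sourceCov q k / (E.posteriorVar q - v) * (a - E.blurredGain q n v p)

/-- The blurred gain has variance `f(q) - f(q + n)` from the gain plus `f(q + n) - v` from the blur.
Its covariances with the signals are those of `θ₁`, because the posterior error and the blur are
uncorrelated with the block. -/
lemma integral_exp_blurred (E : InfoEnv K) (hV : E.V₀.PosDef) (hσ : ∀ k, 0 < E.sigmaSq k)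
    (q n : Fin K → ℕ) {v : ℝ} (hv : v ≤ E.posteriorVar (q + n)) (u : Block n) (r : ℝ) :
    ∫ p, Complex.exp (((blockDot u (E.observe (E.root q p.1.1) p.1.2) +
        r * E.blurredGain q n v p : ℝ) : ℂ) * Complex.I)
        ∂(((stdState K).prod (E.blockNoise n)).prod (gaussianReal 0 1)) =
      Complex.exp (-((E.obsVar q u 0 + 2 * r * (∑ k, (∑ j, u k j) * E.sourceCov q k) +
        r ^ 2 * (E.posteriorVar q - v) : ℝ) : ℂ) / 2) := by
  have hsplit : ∀ p : (EuclideanSpace ℝ (Fin K) × Block n) × ℝ,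
      Complex.exp (((blockDot u (E.observe (E.root q p.1.1) p.1.2) +
        r * E.blurredGain q n v p : ℝ) : ℂ) * Complex.I) =
      Complex.exp (((blockDot (u + E.gainCoeff (q + n) n (Pi.single 0 r))
        (E.observe (E.root q p.1.1) p.1.2) +
          (0 : Fin K → ℝ) ⬝ᵥ WithLp.ofLp (E.root q p.1.1) : ℝ) : ℂ) * Complex.I) *
      Complex.exp (((r * (√(E.posteriorVar (q + n) - v) * p.2) : ℝ) : ℂ) * Complex.I) := by
    intro p
    rw [blurredGain, blockDot_add_left, ← Complex.exp_add, zero_dotProduct,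
      ← dotProduct_gain E hV, single_dotProduct]
    congr 1
    push_cast
    ring
  simp only [hsplit]
  rw [integral_prod_mul (fun p : EuclideanSpace ℝ (Fin K) × Block n => Complex.exp
      (((blockDot (u + E.gainCoeff (q + n) n (Pi.single 0 r)) (E.observe (E.root q p.1) p.2) +
          (0 : Fin K → ℝ) ⬝ᵥ WithLp.ofLp (E.root q p.1) : ℝ) : ℂ) * Complex.I))
      (fun g : ℝ => Complex.exp
        (((r * (√(E.posteriorVar (q + n) - v) * g) : ℝ) : ℂ) * Complex.I)),
    integral_exp_observe E hV, integral_exp_scaled, ← Complex.exp_add]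
  have h := E.obsVar_add_gainCoeff hV hσ q u (Pi.single 0 r)
  rw [obsVar_single E hV, single_dotProduct_postCov] at h
  rw [mul_pow, Real.sq_sqrt (by linarith), ← add_div, ← neg_add, ← Complex.ofReal_add]
  congr 4
  linarith

/-- The blurred change of the posterior mean has variance `posteriorVar q - v`, so it determines
the covariances with the block if that variance vanishes. -/
lemma sum_mul_sourceCov_eq_zero (E : InfoEnv K) (hV : E.V₀.PosDef) (hσ : ∀ k, 0 < E.sigmaSq k)
    (q n : Fin K → ℕ) {v : ℝ} (hv : v ≤ E.posteriorVar (q + n)) (hq : E.posteriorVar q = v)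
    (u : Block n) : ∑ k, (∑ j, u k j) * E.sourceCov q k = 0 := by
  set γ := ∑ k, (∑ j, u k j) * E.sourceCov q k with hγ
  have hle : E.posteriorVar (q + n) ≤ E.posteriorVar q := E.posteriorVar_antitone hV le_self_add
  have hnonneg : ∀ r : ℝ, 0 ≤ E.obsVar q u 0 + 2 * r * γ := by
    intro r
    have h := E.obsVar_add_gainCoeff hV hσ q u (Pi.single 0 r)
    rw [obsVar_single E hV, single_dotProduct_postCov, ← hγ] at h
    have h1 : E.posteriorVar (q + n) = E.posteriorVar q := by linarith
    have h2 : 0 ≤ E.obsVar q (u + E.gainCoeff (q + n) n (Pi.single 0 r)) 0 := by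
      unfold obsVar
      have := (E.postCov_posDef hV q).posSemidef.dotProduct_mulVec_nonneg
        (E.Cᵀ *ᵥ (fun k => ∑ j, (u + E.gainCoeff (q + n) n (Pi.single 0 r)) k j) + 0)
      rw [star_trivial] at this
      positivity
    rw [h1] at h
    linarith
  -- An affine function of `r` that is nonnegative everywhere has slope zero; this `r` would make it
  -- equal to `-1`.
  by_contra hne
  have h1 := hnonneg (-(E.obsVar q u 0 + 1) / (2 * γ))
  have h2 : 2 * (-(E.obsVar q u 0 + 1) / (2 * γ)) * γ = -(E.obsVar q u 0 + 1) := by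
    field_simp
  linarith

lemma measurable_blurredGain (E : InfoEnv K) (q n : Fin K → ℕ) (v : ℝ) :
    Measurable (E.blurredGain q n v) := by
  have hobs : Measurable fun p : (EuclideanSpace ℝ (Fin K) × Block n) × ℝ =>
      E.observe (E.root q p.1.1) p.1.2 :=
    E.measurable_observe ((E.measurable_root_apply q).comp (by fun_prop)) (by fun_prop)
  have := (E.measurable_gain (q + n) (n := n)).comp hobs
  unfold blurredGain
  fun_prop

lemma measurable_simulate (E : InfoEnv K) (q n : Fin K → ℕ) (v : ℝ) :
    Measurable fun p : ℝ × ((EuclideanSpace ℝ (Fin K) × Block n) × ℝ) =>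
      E.simulate q n v p.1 p.2 := by
  have hobs : Measurable fun p : (EuclideanSpace ℝ (Fin K) × Block n) × ℝ =>
      E.observe (E.root q p.1.1) p.1.2 :=
    E.measurable_observe ((E.measurable_root_apply q).comp (by fun_prop)) (by fun_prop)
  have := E.measurable_blurredGain q n v
  unfold simulate
  refine measurable_pi_lambda _ fun k => measurable_pi_lambda _ fun j => ?_
  have h1 : Measurable fun p : ℝ × ((EuclideanSpace ℝ (Fin K) × Block n) × ℝ) =>
      E.observe (E.root q p.2.1.1) p.2.1.2 k j :=
    (measurable_pi_apply j).comp ((measurable_pi_apply k).comp (hobs.comp measurable_snd))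
  fun_prop

/-- Simulating a block from its blurred effect on the posterior mean reproduces the joint law of
the two. -/
lemma map_simulate_eq (E : InfoEnv K) (hV : E.V₀.PosDef) (hσ : ∀ k, 0 < E.sigmaSq k)
    (q n : Fin K → ℕ) {v : ℝ} (hv : v ≤ E.posteriorVar (q + n)) :
    ((gaussianReal 0 1).prod
        (((stdState K).prod (E.blockNoise n)).prod (gaussianReal 0 1))).map
        (fun p => (E.simulate q n v (√(E.posteriorVar q - v) * p.1) p.2,
          √(E.posteriorVar q - v) * p.1)) =
      (((stdState K).prod (E.blockNoise n)).prod (gaussianReal 0 1)).map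
        (fun p => (E.observe (E.root q p.1.1) p.1.2, E.blurredGain q n v p)) := by
  have hle : E.posteriorVar (q + n) ≤ E.posteriorVar q := E.posteriorVar_antitone hV le_self_add
  have hobs : Measurable fun p : (EuclideanSpace ℝ (Fin K) × Block n) × ℝ =>
      E.observe (E.root q p.1.1) p.1.2 :=
    E.measurable_observe ((E.measurable_root_apply q).comp (by fun_prop)) (by fun_prop)
  have hm2 : Measurable fun p : (EuclideanSpace ℝ (Fin K) × Block n) × ℝ =>
      (E.observe (E.root q p.1.1) p.1.2, E.blurredGain q n v p) :=
    hobs.prodMk (E.measurable_blurredGain q n v)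
  have hm1 : Measurable fun p : ℝ × ((EuclideanSpace ℝ (Fin K) × Block n) × ℝ) =>
      (E.simulate q n v (√(E.posteriorVar q - v) * p.1) p.2, √(E.posteriorVar q - v) * p.1) := by
    refine Measurable.prodMk ((E.measurable_simulate q n v).comp
      (f := fun p : ℝ × ((EuclideanSpace ℝ (Fin K) × Block n) × ℝ) =>
        (√(E.posteriorVar q - v) * p.1, p.2)) (by fun_prop)) (by fun_prop)
  have i1 := Measure.isProbabilityMeasure_map (μ := (gaussianReal 0 1).prod
        (((stdState K).prod (E.blockNoise n)).prod (gaussianReal 0 1))) hm1.aemeasurable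
  have i2 := Measure.isProbabilityMeasure_map (μ :=
        (((stdState K).prod (E.blockNoise n)).prod (gaussianReal 0 1))) hm2.aemeasurable
  refine ext_of_integral_exp_real fun u r => ?_
  have hdot : Measurable fun p : Block n × ℝ =>
      Complex.exp (((blockDot u p.1 + r * p.2 : ℝ) : ℂ) * Complex.I) := by
    unfold blockDot
    fun_prop
  rw [integral_map hm1.aemeasurable hdot.aestronglyMeasurable,
    integral_map hm2.aemeasurable hdot.aestronglyMeasurable]
  rw [integral_exp_blurred E hV hσ q n hv]
  set d := E.posteriorVar q - v with hd
  set γ := ∑ k, (∑ j, u k j) * E.sourceCov q k with hγ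
  set β := γ / d with hβ
  have hβd : β * d = γ := by
    -- In the degenerate case the quotient `β` is `0` by convention, which is harmless because `γ`
    -- vanishes too.
    by_cases h0 : d = 0
    · rw [h0, mul_zero, hγ, E.sum_mul_sourceCov_eq_zero hV hσ q n hv (by linarith) u]
    · rw [hβ, div_mul_cancel₀ _ h0]
  have hsplit : ∀ p : ℝ × ((EuclideanSpace ℝ (Fin K) × Block n) × ℝ),
      Complex.exp (((blockDot u (E.simulate q n v (√d * p.1) p.2) + r * (√d * p.1) : ℝ) : ℂ) *
        Complex.I) =
      Complex.exp ((((β + r) * (√d * p.1) : ℝ) : ℂ) * Complex.I) *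
      Complex.exp (((blockDot u (E.observe (E.root q p.2.1.1) p.2.1.2) +
        (-β) * E.blurredGain q n v p.2 : ℝ) : ℂ) * Complex.I) := by
    intro p
    have h1 : blockDot u (E.simulate q n v (√d * p.1) p.2) =
        blockDot u (E.observe (E.root q p.2.1.1) p.2.1.2) +
          β * (√d * p.1 - E.blurredGain q n v p.2) := by
      simp only [blockDot, simulate, mul_add, Finset.sum_add_distrib, ← hd]
      congr 1
      rw [hβ, hγ, Finset.sum_div, Finset.sum_mul]
      refine Finset.sum_congr rfl fun k _ => ?_
      rw [← Finset.sum_mul]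
      ring
    rw [h1, ← Complex.exp_add]
    congr 1
    push_cast
    ring
  simp only [hsplit]
  rw [integral_prod_mul (fun g : ℝ => Complex.exp ((((β + r) * (√d * g) : ℝ) : ℂ) * Complex.I))
      (fun p : (EuclideanSpace ℝ (Fin K) × Block n) × ℝ => Complex.exp
        (((blockDot u (E.observe (E.root q p.1.1) p.1.2) +
        (-β) * E.blurredGain q n v p : ℝ) : ℂ) * Complex.I)),
    integral_exp_blurred E hV hσ q n hv, integral_exp_scaled, ← Complex.exp_add, ← hγ,
    ← hd, mul_pow, Real.sq_sqrt (by linarith), ← add_div, ← neg_add, ← Complex.ofReal_add]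
  congr 4
  rw [← hβd]
  ring

/-- The law of the payoff-relevant coordinate of a centered Gaussian state. -/
lemma map_root_zero (E : InfoEnv K) (hV : E.V₀.PosDef) (q : Fin K → ℕ) :
    (stdState K).map (fun z => E.root q z 0) =
      (gaussianReal 0 1).map (fun g => √(E.posteriorVar q) * g) := by
  have hm1 : Measurable fun z : EuclideanSpace ℝ (Fin K) => E.root q z 0 := by fun_prop
  have hm2 : Measurable fun g : ℝ => √(E.posteriorVar q) * g := by fun_prop
  have i1 := Measure.isProbabilityMeasure_map (μ := stdState K) hm1.aemeasurable
  have i2 := Measure.isProbabilityMeasure_map (μ := gaussianReal 0 1) hm2.aemeasurable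
  refine ext_of_integral_exp_line fun r => ?_
  have hdot : Measurable fun x : ℝ => Complex.exp (((r * x : ℝ) : ℂ) * Complex.I) := by fun_prop
  rw [integral_map hm1.aemeasurable hdot.aestronglyMeasurable,
    integral_map hm2.aemeasurable hdot.aestronglyMeasurable, integral_exp_scaled]
  have h := E.integral_exp_root hV q (Pi.single 0 r)
  rw [single_dotProduct_postCov] at h
  simp only [single_dotProduct] at h
  rw [h, mul_pow, Real.sq_sqrt (E.posteriorVar_pos hV q).le]

/-- The sum of independent centered Gaussian variables. -/
lemma map_add_scaled {a b c : ℝ} (h : a ^ 2 + b ^ 2 = c ^ 2) :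
    ((gaussianReal 0 1).prod (gaussianReal 0 1)).map (fun p : ℝ × ℝ => a * p.1 + b * p.2) =
      (gaussianReal 0 1).map (fun g => c * g) := by
  have hm1 : Measurable fun p : ℝ × ℝ => a * p.1 + b * p.2 := by fun_prop
  have hm2 : Measurable fun g : ℝ => c * g := by fun_prop
  have i1 := Measure.isProbabilityMeasure_map
    (μ := (gaussianReal 0 1).prod (gaussianReal 0 1)) hm1.aemeasurable
  have i2 := Measure.isProbabilityMeasure_map (μ := gaussianReal 0 1) hm2.aemeasurable
  refine ext_of_integral_exp_line fun r => ?_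
  have hdot : Measurable fun x : ℝ => Complex.exp (((r * x : ℝ) : ℂ) * Complex.I) := by fun_prop
  rw [integral_map hm1.aemeasurable hdot.aestronglyMeasurable,
    integral_map hm2.aemeasurable hdot.aestronglyMeasurable, integral_exp_scaled]
  have hsplit : ∀ p : ℝ × ℝ, Complex.exp (((r * (a * p.1 + b * p.2) : ℝ) : ℂ) * Complex.I) =
      Complex.exp (((r * (a * p.1) : ℝ) : ℂ) * Complex.I) *
      Complex.exp (((r * (b * p.2) : ℝ) : ℂ) * Complex.I) := by
    intro p
    rw [← Complex.exp_add]
    congr 1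
    push_cast
    ring
  simp only [hsplit]
  rw [integral_prod_mul (fun x : ℝ => Complex.exp (((r * (a * x) : ℝ) : ℂ) * Complex.I))
      (fun x : ℝ => Complex.exp (((r * (b * x) : ℝ) : ℂ) * Complex.I)),
    integral_exp_scaled, integral_exp_scaled, ← Complex.exp_add, ← add_div, ← neg_add,
    ← Complex.ofReal_add]
  congr 4
  rw [mul_pow, mul_pow, mul_pow, ← mul_add, h]

end payoffRelevant

end InfoEnv

/-! ### Resampling coordinates of product measures -/

section resampling

variable {ι X : Type*} [MeasurableSpace X]

lemma map_comp_infinitePi {α : Type*} (μ : ι → Measure X) [∀ i, IsProbabilityMeasure (μ i)]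
    {f : α → ι} (hf : Function.Injective f) :
    (Measure.infinitePi μ).map (fun x a => x (f a)) = Measure.infinitePi fun a => μ (f a) := by
  classical
  refine Measure.eq_infinitePi _ fun s t ht => ?_
  have hm : Measurable fun (x : ι → X) a => x (f a) := by fun_prop
  rw [Measure.map_apply hm (MeasurableSet.pi s.countable_toSet fun i _ => ht i)]
  set t' : ι → Set X := Function.extend f t (fun _ => Set.univ) with ht'
  have ht'f : ∀ a, t' (f a) = t a := fun a => hf.extend_apply t _ a
  have hpre : (fun (x : ι → X) a => x (f a)) ⁻¹' (Set.pi s t) =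
      Set.pi (s.map ⟨f, hf⟩ : Finset ι) t' := by
    ext x
    simp [Set.mem_pi, ht'f]
  rw [hpre, Measure.infinitePi_pi]
  · simp [ht'f]
  · intro i hi
    obtain ⟨a, -, rfl⟩ := Finset.mem_map.1 hi
    simpa [ht'f] using ht a

/-- Take the coordinates in `S` from `y` and the others from `x`. -/
noncomputable def splice (S : Set ι) (x y : ι → X) : ι → X :=
  open Classical in fun i => if i ∈ S then y i else x i

omit [MeasurableSpace X] in
lemma splice_of_mem {S : Set ι} (x y : ι → X) {i : ι} (hi : i ∈ S) : splice S x y i = y i := by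
  simp [splice, hi]

omit [MeasurableSpace X] in
lemma splice_of_notMem {S : Set ι} (x y : ι → X) {i : ι} (hi : i ∉ S) : splice S x y i = x i := by
  simp [splice, hi]

lemma measurable_splice (S : Set ι) :
    Measurable fun p : (ι → X) × (ι → X) => splice S p.1 p.2 := by
  refine measurable_pi_lambda _ fun i => ?_
  by_cases hi : i ∈ S
  · simp only [splice_of_mem _ _ hi]; fun_prop
  · simp only [splice_of_notMem _ _ hi]; fun_prop

/-- Replacing some coordinates by an independent copy preserves a product law. This is how the
independence of current noise, or of current random numbers, from the past enters. -/
lemma map_splice (μ : ι → Measure X) [∀ i, IsProbabilityMeasure (μ i)] (S : Set ι) :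
    ((Measure.infinitePi μ).prod (Measure.infinitePi μ)).map (fun p => splice S p.1 p.2) =
      Measure.infinitePi μ := by
  classical
  refine Measure.eq_infinitePi _ fun s t ht => ?_
  rw [Measure.map_apply (measurable_splice S) (MeasurableSet.pi s.countable_toSet fun i _ => ht i)]
  have hpre : (fun p : (ι → X) × (ι → X) => splice S p.1 p.2) ⁻¹' (Set.pi s t) =
      (Set.pi (s.filter (· ∉ S) : Finset ι) t) ×ˢ (Set.pi (s.filter (· ∈ S) : Finset ι) t) := by
    ext p
    simp only [Set.mem_preimage, Set.mem_pi, Set.mem_prod, Finset.coe_filter, Set.mem_ofPred_eq]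
    constructor
    · intro h
      exact ⟨fun i hi => by simpa [splice, hi.2] using h i hi.1,
        fun i hi => by simpa [splice, hi.2] using h i hi.1⟩
    · rintro ⟨h1, h2⟩ i hi
      by_cases hS : i ∈ S
      · rw [splice_of_mem _ _ hS]; exact h2 i ⟨hi, hS⟩
      · rw [splice_of_notMem _ _ hS]; exact h1 i ⟨hi, hS⟩
  rw [hpre, Measure.prod_prod, Measure.infinitePi_pi _ fun i _ => ht i,
    Measure.infinitePi_pi _ fun i _ => ht i, mul_comm]
  exact Finset.prod_filter_mul_prod_filter_not s (· ∈ S) fun i => μ i (t i)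

lemma lintegral_splice (μ : ι → Measure X) [∀ i, IsProbabilityMeasure (μ i)] (S : Set ι)
    {f : (ι → X) → ℝ≥0∞} (hf : Measurable f) :
    ∫⁻ x, f x ∂(Measure.infinitePi μ) =
      ∫⁻ x, ∫⁻ y, f (splice S x y) ∂(Measure.infinitePi μ) ∂(Measure.infinitePi μ) := by
  conv_lhs => rw [← map_splice μ S]
  rw [lintegral_map hf (measurable_splice S),
    lintegral_prod (fun p : (ι → X) × (ι → X) => f (splice S p.1 p.2))
      (hf.comp (measurable_splice S)).aemeasurable]

end resampling

/-! ### Measurability with countably many cases -/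

/-- The type of a block depends on its counts, so measurability is checked separately for each of
the countably many counts. -/
lemma measurable_of_countable_index {ι α β : Type*} [MeasurableSpace ι] [Countable ι]
    [MeasurableSingletonClass ι] [MeasurableSpace α] [MeasurableSpace β] {c : α → ι}
    (hc : Measurable c) {G : ι → α → β} (hG : ∀ i, Measurable (G i)) :
    Measurable fun a => G (c a) a := by
  have h : Measurable fun p : α × ι => G p.2 p.1 := measurable_from_prod_countable_left hG
  exact h.comp (measurable_id.prodMk hc)

namespace Observation

variable {K : ℕ}

lemma measurable_of_mk {β : Type*} [MeasurableSpace β] {f : Observation K → β}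
    (hf : ∀ n, Measurable fun y : Block n => f ⟨n, y⟩) : Measurable f := by
  intro s hs
  rw [MeasurableSpace.measurableSet_iInf]
  intro n
  exact hf n hs

lemma measurable_counts : Measurable fun o : Observation K => o.1 :=
  measurable_of_mk fun _ => measurable_const

lemma measurable_mk (n : Fin K → ℕ) :
    Measurable fun y : Block n => (⟨n, y⟩ : Observation K) :=
  measurable_iff_comap_le.2 (by
    rintro _ ⟨s, hs, rfl⟩
    exact (MeasurableSpace.measurableSet_iInf.1 hs) n)

/-- The `j`-th realization from source `k`, or `0` if there is none. -/
noncomputable def entry (o : Observation K) (k : Fin K) (j : ℕ) : ℝ :=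
  if h : j < o.1 k then o.2 k ⟨j, h⟩ else 0

lemma measurable_entry (k : Fin K) (j : ℕ) : Measurable fun o : Observation K => entry o k j := by
  refine measurable_of_mk fun n => ?_
  unfold entry
  by_cases h : j < n k
  · simp only [h, dif_pos]
    exact (measurable_pi_apply (⟨j, h⟩ : Fin (n k))).comp (measurable_pi_apply k)
  · simp only [h, dif_neg, not_false_iff]; exact measurable_const

end Observation

section histories

variable {K : ℕ}

lemma measurable_snoc {α : Type*} [MeasurableSpace α] {t : ℕ} {f : α → History K t}
    {g : α → Observation K} (hf : Measurable f) (hg : Measurable g) :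
    Measurable fun a => (Fin.snoc (α := fun _ => Observation K) (f a) (g a) : History K (t + 1)) := by
  refine measurable_pi_lambda _ fun i => ?_
  refine Fin.lastCases ?_ (fun i => ?_) i
  · simpa using hg
  · simpa [Function.comp_def] using (measurable_pi_apply i).comp hf

lemma measurable_init {t : ℕ} :
    Measurable fun h : History K (t + 1) => (Fin.init h : History K t) :=
  measurable_pi_lambda _ fun i => measurable_pi_apply i.castSucc

lemma measurable_counts {t : ℕ} : Measurable fun h : History K t => h.counts := by
  unfold History.counts
  refine measurable_pi_lambda _ fun k => Finset.measurable_sum _ fun i _ => ?_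
  exact (measurable_pi_apply k).comp (Observation.measurable_counts.comp (measurable_pi_apply i))

lemma counts_snoc {t : ℕ} (h : History K t) (o : Observation K) :
    History.counts (Fin.snoc (α := fun _ => Observation K) h o : History K (t + 1)) =
      h.counts + o.1 := by
  ext k
  simp [History.counts, Fin.sum_univ_castSucc]

lemma counts_zero (h : History K 0) : h.counts = 0 := by
  ext k
  simp [History.counts]

/-- The posterior mean of the states given a history. -/
noncomputable def postMean (E : InfoEnv K) (μ₀ : EuclideanSpace ℝ (Fin K)) :
    (t : ℕ) → History K t → EuclideanSpace ℝ (Fin K)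
  | 0, _ => μ₀
  | t + 1, h =>
    postMean E μ₀ t (Fin.init h) +
      E.gain (History.counts h) fun k j => (h (Fin.last t)).2 k j -
        ∑ i, E.C k i * postMean E μ₀ t (Fin.init h) i

lemma postMean_snoc (E : InfoEnv K) (μ₀ : EuclideanSpace ℝ (Fin K)) {t : ℕ} (h : History K t)
    (n : Fin K → ℕ) (y : Block n) :
    postMean E μ₀ (t + 1) (Fin.snoc (α := fun _ => Observation K) h ⟨n, y⟩) =
      postMean E μ₀ t h + E.gain (h.counts + n)
        (fun k j => y k j - ∑ i, E.C k i * postMean E μ₀ t h i : Block n) := by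
  rw [postMean, counts_snoc]
  simp only [Fin.init_snoc]
  congr 1
  simp only [InfoEnv.gain]
  congr 4
  ext k
  rw [Fin.snoc_last]

lemma measurable_postMean (E : InfoEnv K) (μ₀ : EuclideanSpace ℝ (Fin K)) (t : ℕ) :
    Measurable (postMean E μ₀ t) := by
  induction t with
  | zero => exact measurable_const
  | succ t ih =>
    have hinit : Measurable fun h : History K (t + 1) => postMean E μ₀ t (Fin.init h) :=
      ih.comp measurable_init
    have hlast : Measurable fun h : History K (t + 1) => h (Fin.last t) := measurable_pi_apply _
    -- For fixed counts the realizations are read through `Observation.entry`. Its default value `0`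
    -- is irrelevant, since the counts are then set to those of the history itself.
    have hG : ∀ i : (Fin K → ℕ) × (Fin K → ℕ), Measurable fun h : History K (t + 1) =>
        postMean E μ₀ t (Fin.init h) + E.gain i.1 (fun k j =>
          Observation.entry (h (Fin.last t)) k j -
            ∑ l, E.C k l * postMean E μ₀ t (Fin.init h) l : Block i.2) := by
      intro i
      refine hinit.add ((E.measurable_gain i.1).comp ?_)
      refine measurable_pi_lambda _ fun k => measurable_pi_lambda _ fun j => ?_
      have := (Observation.measurable_entry (K := K) k j).comp hlast
      fun_prop
    have h := measurable_of_countable_index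
      (c := fun h : History K (t + 1) => (h.counts, (h (Fin.last t)).1))
      (measurable_counts.prodMk (Observation.measurable_counts.comp hlast)) hG
    convert h using 2 with h
    rw [postMean]
    congr 3
    ext k j
    simp [Observation.entry]

end histories

/-! ### The law of the state given a history -/

section posterior

variable {K : ℕ}

/-- The law of all noise terms. -/
noncomputable abbrev noiseLaw (E : InfoEnv K) : Measure (ℕ × Fin K × ℕ → ℝ) :=
  Measure.infinitePi fun i : ℕ × Fin K × ℕ => gaussianReal 0 (E.sigmaSq i.2.1)

/-- The noise terms of a block of signals in period `t`. -/
def blockAt (t : ℕ) (n : Fin K → ℕ) (y : ℕ × Fin K × ℕ → ℝ) : Block n :=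
  fun k j => y (t, k, j)

lemma measurable_blockAt (t : ℕ) (n : Fin K → ℕ) : Measurable (blockAt (K := K) t n) := by
  unfold blockAt
  fun_prop

lemma map_blockAt (E : InfoEnv K) (t : ℕ) (n : Fin K → ℕ) :
    (noiseLaw E).map (blockAt t n) = E.blockNoise n := by
  have h1 := map_comp_infinitePi (fun i : ℕ × Fin K × ℕ => gaussianReal 0 (E.sigmaSq i.2.1))
    (f := fun a : (k : Fin K) × Fin (n k) => (t, a.1, (a.2 : ℕ))) (by
      rintro ⟨k, j⟩ ⟨k', j'⟩ h
      simp only [Prod.mk.injEq, true_and] at h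
      obtain ⟨rfl, h⟩ := h
      rw [Fin.val_inj.1 h])
  have h2 := Measure.infinitePi_map_piCurry (ι := Fin K) (κ := fun k => Fin (n k))
    (X := fun _ _ => ℝ) (fun k _ => gaussianReal 0 (E.sigmaSq k))
  rw [InfoEnv.blockNoise, ← Measure.infinitePi_eq_pi]
  simp only [← Measure.infinitePi_eq_pi]
  rw [← h2, ← h1, Measure.map_map (by fun_prop) (by fun_prop)]
  rfl

lemma lintegral_blockAt (E : InfoEnv K) (t : ℕ) (n : Fin K → ℕ) {f : Block n → ℝ≥0∞}
    (hf : Measurable f) :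
    ∫⁻ y, f (blockAt t n y) ∂(noiseLaw E) = ∫⁻ e, f e ∂(E.blockNoise n) := by
  rw [← map_blockAt E t n, lintegral_map hf (measurable_blockAt t n)]

variable {A : ℕ → Type u} [∀ t, MeasurableSpace (A t)]

lemma history_succ (s : Strategy K A) (E : InfoEnv K) (ω : Outcome K) (t : ℕ) :
    s.history E ω (t + 1) = Fin.snoc (α := fun _ => Observation K) (s.history E ω t)
      ⟨s.acquire t (s.history E ω t),
        E.observe ω.1 (blockAt t (s.acquire t (s.history E ω t)) ω.2)⟩ := rfl

/-- The coordinates of the noise terms of period `t`. -/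
def periodSet (K t : ℕ) : Set (ℕ × Fin K × ℕ) := {i | i.1 = t}

lemma blockAt_splice (t : ℕ) (n : Fin K → ℕ) (x y : ℕ × Fin K × ℕ → ℝ) :
    blockAt t n (splice (periodSet K t) x y) = blockAt t n y := by
  ext k j
  exact splice_of_mem _ _ rfl

lemma blockAt_splice_of_ne {t t' : ℕ} (h : t' ≠ t) (n : Fin K → ℕ) (x y : ℕ × Fin K × ℕ → ℝ) :
    blockAt t' n (splice (periodSet K t) x y) = blockAt t' n x := by
  ext k j
  exact splice_of_notMem _ _ (fun h' => h h')

lemma history_splice (s : Strategy K A) (E : InfoEnv K) (θ : EuclideanSpace ℝ (Fin K))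
    (x y : ℕ × Fin K × ℕ → ℝ) {t t' : ℕ} (h : t' ≤ t) :
    s.history E (θ, splice (periodSet K t) x y) t' = s.history E (θ, x) t' := by
  induction t' with
  | zero => rfl
  | succ t' ih =>
    rw [history_succ, history_succ, ih (by omega)]
    simp only [blockAt_splice_of_ne (by omega : t' ≠ t)]

/-- A parameter is allowed because the random numbers of a simulation will index a family of
strategies, over which integrals are taken. -/
lemma measurable_history_family {X : Type*} [MeasurableSpace X] {S : X → Strategy K A}
    (hS : ∀ t, Measurable fun p : X × History K t => (S p.1).acquire t p.2) (E : InfoEnv K)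
    (t : ℕ) : Measurable fun p : X × Outcome K => (S p.1).history E p.2 t := by
  induction t with
  | zero => exact measurable_const
  | succ t ih =>
    have hacq : Measurable fun p : X × Outcome K =>
        (S p.1).acquire t ((S p.1).history E p.2 t) :=
      (hS t).comp (measurable_fst.prodMk ih)
    refine measurable_of_countable_index hacq
      (G := fun n p => Fin.snoc (α := fun _ => Observation K) ((S p.1).history E p.2 t)
        ⟨n, E.observe p.2.1 (blockAt t n p.2.2)⟩) fun n => ?_
    refine measurable_snoc ih ((Observation.measurable_mk n).comp ?_)
    exact E.measurable_observe (by fun_prop) ((measurable_blockAt t n).comp (by fun_prop))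

lemma measurable_history (s : Strategy K A) (E : InfoEnv K) (t : ℕ) :
    Measurable fun ω => s.history E ω t := by
  have h := measurable_history_family (S := fun _ : Unit => s)
    (fun t => (s.measurable_acquire t).comp measurable_snd) E t
  exact h.comp (f := fun ω => ((), ω)) (by fun_prop)

/-- In a history, the noise of the last period is independent of everything before. -/
lemma lintegral_history_succ (s : Strategy K A) (E : InfoEnv K) (μ₀ : EuclideanSpace ℝ (Fin K))
    (t : ℕ) {f : History K (t + 1) × EuclideanSpace ℝ (Fin K) → ℝ≥0∞} (hf : Measurable f) :
    ∫⁻ ω, f (s.history E ω (t + 1), ω.1) ∂(law E μ₀) =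
      ∫⁻ ω, ∫⁻ y, f (Fin.snoc (α := fun _ => Observation K) (s.history E ω t)
        ⟨s.acquire t (s.history E ω t),
          E.observe ω.1 (blockAt t (s.acquire t (s.history E ω t)) y)⟩, ω.1)
        ∂(noiseLaw E) ∂(law E μ₀) := by
  have hm : Measurable fun ω : Outcome K => f (s.history E ω (t + 1), ω.1) :=
    hf.comp ((measurable_history s E (t + 1)).prodMk measurable_fst)
  have hm2 : Measurable fun p : Outcome K × (ℕ × Fin K × ℕ → ℝ) =>
      f (Fin.snoc (α := fun _ => Observation K) (s.history E p.1 t)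
        ⟨s.acquire t (s.history E p.1 t),
          E.observe p.1.1 (blockAt t (s.acquire t (s.history E p.1 t)) p.2)⟩, p.1.1) := by
    refine hf.comp (Measurable.prodMk ?_ (by fun_prop))
    have hh : Measurable fun p : Outcome K × (ℕ × Fin K × ℕ → ℝ) => s.history E p.1 t :=
      (measurable_history s E t).comp measurable_fst
    refine measurable_of_countable_index ((s.measurable_acquire t).comp hh)
      (G := fun n p => Fin.snoc (α := fun _ => Observation K) (s.history E p.1 t)
        ⟨n, E.observe p.1.1 (blockAt t n p.2)⟩) fun n => ?_
    refine measurable_snoc hh ((Observation.measurable_mk n).comp ?_)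
    exact E.measurable_observe (by fun_prop) ((measurable_blockAt t n).comp (by fun_prop))
  rw [law, lintegral_prod _ hm.aemeasurable, lintegral_prod _ hm2.lintegral_prod_right'.aemeasurable]
  refine lintegral_congr fun θ => ?_
  refine (lintegral_splice _ (periodSet K t)
    (f := fun x => f (s.history E (θ, x) (t + 1), θ))
    (hm.comp (by fun_prop : Measurable fun x => (θ, x)))).trans ?_
  refine lintegral_congr fun x => lintegral_congr fun y => ?_
  rw [history_succ]
  simp only [blockAt_splice]
  rw [history_splice s E θ x y le_rfl]

lemma measurable_lintegral_root {α : Type*} [MeasurableSpace α] {E : InfoEnv K}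
    {c : α → Fin K → ℕ} (hc : Measurable c) {m : α → EuclideanSpace ℝ (Fin K)}
    (hm : Measurable m) {f : α × EuclideanSpace ℝ (Fin K) → ℝ≥0∞} (hf : Measurable f) :
    Measurable fun a => ∫⁻ z, f (a, m a + E.root (c a) z) ∂(InfoEnv.stdState K) := by
  refine measurable_of_countable_index hc
    (G := fun q a => ∫⁻ z, f (a, m a + E.root q z) ∂(InfoEnv.stdState K)) fun q => ?_
  refine Measurable.lintegral_prod_right'
    (f := fun p : α × EuclideanSpace ℝ (Fin K) => f (p.1, m p.1 + E.root q p.2)) ?_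
  have := E.measurable_root_apply q
  exact hf.comp (measurable_fst.prodMk (by fun_prop))

lemma observe_add (E : InfoEnv K) {n : Fin K → ℕ} (m θ : EuclideanSpace ℝ (Fin K))
    (e : Block n) : E.observe (m + θ) e =
      fun k j => (∑ i, E.C k i * m i) + E.observe θ e k j := by
  ext k j
  simp only [InfoEnv.observe, PiLp.add_apply, mul_add, Finset.sum_add_distrib]
  ring

lemma lintegral_observe (E : InfoEnv K) (hV : E.V₀.PosDef) (hσ : ∀ k, 0 < E.sigmaSq k)
    (q n : Fin K → ℕ) {g : Block n × EuclideanSpace ℝ (Fin K) → ℝ≥0∞} (hg : Measurable g) :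
    ∫⁻ z, ∫⁻ e, g (E.observe (E.root q z) e, E.root q z) ∂(E.blockNoise n)
        ∂(InfoEnv.stdState K) =
      ∫⁻ z, ∫⁻ e, ∫⁻ z', g (E.observe (E.root q z) e,
          E.gain (q + n) (E.observe (E.root q z) e) + E.root (q + n) z')
        ∂(InfoEnv.stdState K) ∂(E.blockNoise n) ∂(InfoEnv.stdState K) := by
  have hobs : Measurable fun p : EuclideanSpace ℝ (Fin K) × Block n =>
      E.observe (E.root q p.1) p.2 :=
    E.measurable_observe ((E.measurable_root_apply q).comp measurable_fst) measurable_snd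
  have hl : Measurable fun p : EuclideanSpace ℝ (Fin K) × Block n =>
      (E.observe (E.root q p.1) p.2, E.root q p.1) :=
    hobs.prodMk ((E.measurable_root_apply q).comp measurable_fst)
  have hr : Measurable fun p : (EuclideanSpace ℝ (Fin K) × Block n) × EuclideanSpace ℝ (Fin K) =>
      (E.observe (E.root q p.1.1) p.1.2,
          E.gain (q + n) (E.observe (E.root q p.1.1) p.1.2) + E.root (q + n) p.2) :=
    (hobs.comp measurable_fst).prodMk ((((E.measurable_gain (q + n)).comp hobs).comp
      measurable_fst).add ((E.measurable_root_apply (q + n)).comp measurable_snd))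
  have hgl : Measurable fun p : EuclideanSpace ℝ (Fin K) × Block n =>
      g (E.observe (E.root q p.1) p.2, E.root q p.1) := hg.comp hl
  have hgr : Measurable fun p : (EuclideanSpace ℝ (Fin K) × Block n) × EuclideanSpace ℝ (Fin K) =>
      g (E.observe (E.root q p.1.1) p.1.2,
          E.gain (q + n) (E.observe (E.root q p.1.1) p.1.2) + E.root (q + n) p.2) := hg.comp hr
  have key := congrArg (fun μ => ∫⁻ p, g p ∂μ) (E.map_observe_eq hV hσ q n)
  beta_reduce at key
  rw [lintegral_map hg hl, lintegral_map hg hr, lintegral_prod _ hgl.aemeasurable,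
    lintegral_prod _ hgr.aemeasurable,
    lintegral_prod _ hgr.lintegral_prod_right'.aemeasurable] at key
  exact key

/-- Bayesian updating at a history. -/
lemma lintegral_update (E : InfoEnv K) (hV : E.V₀.PosDef) (hσ : ∀ k, 0 < E.sigmaSq k)
    (μ₀ : EuclideanSpace ℝ (Fin K)) {t : ℕ} (h : History K t) (n : Fin K → ℕ)
    {f : History K (t + 1) × EuclideanSpace ℝ (Fin K) → ℝ≥0∞} (hf : Measurable f) :
    ∫⁻ z, ∫⁻ y, f (Fin.snoc (α := fun _ => Observation K) h
        ⟨n, E.observe (postMean E μ₀ t h + E.root h.counts z) (blockAt t n y)⟩,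
        postMean E μ₀ t h + E.root h.counts z) ∂(noiseLaw E) ∂(InfoEnv.stdState K) =
      ∫⁻ z, ∫⁻ y, (fun h' : History K (t + 1) =>
          ∫⁻ z', f (h', postMean E μ₀ (t + 1) h' + E.root h'.counts z') ∂(InfoEnv.stdState K))
        (Fin.snoc (α := fun _ => Observation K) h
          ⟨n, E.observe (postMean E μ₀ t h + E.root h.counts z) (blockAt t n y)⟩)
        ∂(noiseLaw E) ∂(InfoEnv.stdState K) := by
  set m := postMean E μ₀ t h with hm
  set q := h.counts with hq
  have hF := (measurable_lintegral_root (E := E) (measurable_counts (K := K) (t := t + 1))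
      (measurable_postMean E μ₀ (t + 1)) hf)
  have hsnoc : Measurable fun y : Block n =>
      (Fin.snoc (α := fun _ => Observation K) h ⟨n, y⟩ : History K (t + 1)) :=
    measurable_snoc measurable_const (Observation.measurable_mk n)
  have hobs : ∀ z, Measurable fun e : Block n => E.observe (m + E.root q z) e := fun z =>
    E.measurable_observe measurable_const measurable_id
  have hl : ∀ z, ∫⁻ y, f (Fin.snoc (α := fun _ => Observation K) h
        ⟨n, E.observe (m + E.root q z) (blockAt t n y)⟩, m + E.root q z) ∂(noiseLaw E) =
      ∫⁻ e, f (Fin.snoc (α := fun _ => Observation K) h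
        ⟨n, E.observe (m + E.root q z) e⟩, m + E.root q z) ∂(E.blockNoise n) := fun z =>
    lintegral_blockAt E t n (f := fun e => f (Fin.snoc (α := fun _ => Observation K) h
        ⟨n, E.observe (m + E.root q z) e⟩, m + E.root q z))
      (hf.comp ((hsnoc.comp (hobs z)).prodMk measurable_const))
  have hr : ∀ z, ∫⁻ y, (fun h' : History K (t + 1) =>
          ∫⁻ z', f (h', postMean E μ₀ (t + 1) h' + E.root h'.counts z') ∂(InfoEnv.stdState K))
        (Fin.snoc (α := fun _ => Observation K) h
          ⟨n, E.observe (m + E.root q z) (blockAt t n y)⟩) ∂(noiseLaw E) =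
      ∫⁻ e, (fun h' : History K (t + 1) =>
          ∫⁻ z', f (h', postMean E μ₀ (t + 1) h' + E.root h'.counts z') ∂(InfoEnv.stdState K))
        (Fin.snoc (α := fun _ => Observation K) h
          ⟨n, E.observe (m + E.root q z) e⟩) ∂(E.blockNoise n) := fun z =>
    lintegral_blockAt E t n (f := fun e => (fun h' : History K (t + 1) =>
          ∫⁻ z', f (h', postMean E μ₀ (t + 1) h' + E.root h'.counts z') ∂(InfoEnv.stdState K))
        (Fin.snoc (α := fun _ => Observation K) h
          ⟨n, E.observe (m + E.root q z) e⟩)) (hF.comp (hsnoc.comp (hobs z)))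
  rw [lintegral_congr hl, lintegral_congr hr]
  have hshift : Measurable fun y : Block n =>
      (fun k j => (∑ i, E.C k i * m i) + y k j : Block n) := by fun_prop
  have hg : Measurable fun p : Block n × EuclideanSpace ℝ (Fin K) =>
      f (Fin.snoc (α := fun _ => Observation K) h
        ⟨n, fun k j => (∑ i, E.C k i * m i) + p.1 k j⟩, m + p.2) :=
    hf.comp ((hsnoc.comp (hshift.comp measurable_fst)).prodMk (by fun_prop))
  have key := lintegral_observe E hV hσ q n hg
  have e1 : ∀ z e, (E.observe (m + E.root q z) e : Block n) =
      fun k j => (∑ i, E.C k i * m i) + E.observe (E.root q z) e k j :=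
    fun z e => observe_add E m (E.root q z) e
  have e2 : ∀ y : Block n, postMean E μ₀ (t + 1) (Fin.snoc (α := fun _ => Observation K) h
      ⟨n, fun k j => (∑ i, E.C k i * m i) + y k j⟩) = m + E.gain (q + n) y := by
    intro y
    rw [postMean_snoc, ← hm, ← hq]
    simp only [add_sub_cancel_left]
  calc _ = _ := by
        refine lintegral_congr fun z => lintegral_congr fun e => ?_
        rw [e1]
    _ = _ := key
    _ = _ := by
        refine lintegral_congr fun z => lintegral_congr fun e => lintegral_congr fun z' => ?_
        rw [e1, e2, counts_snoc, ← hq, add_assoc]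

/-- The last period of a history, when the law of the state given the earlier periods is known. -/
lemma lintegral_history_succ_of (s : Strategy K A) (E : InfoEnv K)
    (μ₀ : EuclideanSpace ℝ (Fin K)) (t : ℕ)
    (ih : ∀ f : History K t × EuclideanSpace ℝ (Fin K) → ℝ≥0∞, Measurable f →
      ∫⁻ ω, f (s.history E ω t, ω.1) ∂(law E μ₀) =
        ∫⁻ ω, (fun h : History K t =>
          ∫⁻ z, f (h, postMean E μ₀ t h + E.root h.counts z) ∂(InfoEnv.stdState K))
          (s.history E ω t) ∂(law E μ₀))
    {g : History K (t + 1) × EuclideanSpace ℝ (Fin K) → ℝ≥0∞} (hg : Measurable g) :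
    ∫⁻ ω, g (s.history E ω (t + 1), ω.1) ∂(law E μ₀) =
      ∫⁻ ω, (fun h : History K t => ∫⁻ z, ∫⁻ y,
        g (Fin.snoc (α := fun _ => Observation K) h
          ⟨s.acquire t h, E.observe (postMean E μ₀ t h + E.root h.counts z)
            (blockAt t (s.acquire t h) y)⟩, postMean E μ₀ t h + E.root h.counts z)
          ∂(noiseLaw E) ∂(InfoEnv.stdState K)) (s.history E ω t) ∂(law E μ₀) := by
  rw [lintegral_history_succ s E μ₀ t hg]
  have hG : Measurable fun p : (History K t × EuclideanSpace ℝ (Fin K)) ×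
      (ℕ × Fin K × ℕ → ℝ) => g (Fin.snoc (α := fun _ => Observation K) p.1.1
        ⟨s.acquire t p.1.1, E.observe p.1.2 (blockAt t (s.acquire t p.1.1) p.2)⟩, p.1.2) := by
    refine hg.comp (Measurable.prodMk ?_ (by fun_prop))
    refine measurable_of_countable_index (c := fun p : (History K t ×
      EuclideanSpace ℝ (Fin K)) × (ℕ × Fin K × ℕ → ℝ) => s.acquire t p.1.1)
      ((s.measurable_acquire t).comp (by fun_prop))
      (G := fun n p => Fin.snoc (α := fun _ => Observation K) p.1.1
        ⟨n, E.observe p.1.2 (blockAt t n p.2)⟩) fun n => ?_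
    refine measurable_snoc (by fun_prop) ((Observation.measurable_mk n).comp ?_)
    exact E.measurable_observe (by fun_prop) ((measurable_blockAt t n).comp (by fun_prop))
  exact ih (fun p => ∫⁻ y, g (Fin.snoc (α := fun _ => Observation K) p.1
        ⟨s.acquire t p.1, E.observe p.2 (blockAt t (s.acquire t p.1) y)⟩, p.2) ∂(noiseLaw E))
    hG.lintegral_prod_right'

/-- Given its history, the DM believes that the state has the Gaussian law with mean `postMean` and
covariance matrix `postCov`. -/
lemma lintegral_history (s : Strategy K A) (E : InfoEnv K) (hV : E.V₀.PosDef)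
    (hσ : ∀ k, 0 < E.sigmaSq k) (μ₀ : EuclideanSpace ℝ (Fin K)) (t : ℕ)
    {f : History K t × EuclideanSpace ℝ (Fin K) → ℝ≥0∞} (hf : Measurable f) :
    ∫⁻ ω, f (s.history E ω t, ω.1) ∂(law E μ₀) =
      ∫⁻ ω, (fun h : History K t =>
        ∫⁻ z, f (h, postMean E μ₀ t h + E.root h.counts z) ∂(InfoEnv.stdState K))
        (s.history E ω t) ∂(law E μ₀) := by
  induction t with
  | zero =>
    have hm : ∀ ω : Outcome K, s.history E ω 0 = Fin.elim0 := fun ω => rfl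
    simp only [hm]
    have h1 : Measurable fun θ : EuclideanSpace ℝ (Fin K) =>
        f ((Fin.elim0 : History K 0), θ) := hf.comp (by fun_prop)
    rw [lintegral_const, law, measure_univ, mul_one,
      lintegral_prod (fun ω : Outcome K => f ((Fin.elim0 : History K 0), ω.1))
        (h1.comp measurable_fst).aemeasurable]
    simp only [lintegral_const, measure_univ, mul_one]
    rw [multivariateGaussian, lintegral_map h1 (by fun_prop)]
    rw [counts_zero, InfoEnv.root, InfoEnv.postCov_zero E hV]
    rfl
  | succ t ih =>
    have hf' := measurable_lintegral_root (E := E) (measurable_counts (K := K) (t := t + 1))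
      (measurable_postMean E μ₀ (t + 1)) hf
    -- The one-period formula is applied both to `f` and to its posterior expectation;
    -- `lintegral_update` identifies the two results.
    rw [lintegral_history_succ_of s E μ₀ t (fun _ => ih) hf,
      lintegral_history_succ_of s E μ₀ t (fun _ => ih) (g := fun p =>
        ∫⁻ z, f (p.1, postMean E μ₀ (t + 1) p.1 +
          E.root (History.counts p.1) z) ∂(InfoEnv.stdState K)) (hf'.comp measurable_fst)]
    exact lintegral_congr fun ω => lintegral_update E hV hσ μ₀ _ _ hf

/-- The last period of a history given the earlier periods. -/
lemma lintegral_history_block (s : Strategy K A) (E : InfoEnv K) (hV : E.V₀.PosDef)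
    (hσ : ∀ k, 0 < E.sigmaSq k) (μ₀ : EuclideanSpace ℝ (Fin K)) (t : ℕ)
    {g : History K (t + 1) → ℝ≥0∞} (hg : Measurable g) :
    ∫⁻ ω, g (s.history E ω (t + 1)) ∂(law E μ₀) =
      ∫⁻ ω, (fun h : History K t => ∫⁻ z, ∫⁻ e,
        g (Fin.snoc (α := fun _ => Observation K) h
          ⟨s.acquire t h, E.observe (postMean E μ₀ t h + E.root h.counts z) e⟩)
          ∂(E.blockNoise (s.acquire t h)) ∂(InfoEnv.stdState K)) (s.history E ω t)
          ∂(law E μ₀) := by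
  rw [lintegral_history_succ_of s E μ₀ t (fun f hf => lintegral_history s E hV hσ μ₀ t hf)
    (g := fun p => g p.1) (hg.comp measurable_fst)]
  refine lintegral_congr fun ω => lintegral_congr fun z => ?_
  refine lintegral_blockAt E t _ (f := fun e => g (Fin.snoc (α := fun _ => Observation K)
    (s.history E ω t) ⟨s.acquire t (s.history E ω t),
      E.observe (postMean E μ₀ t (s.history E ω t) +
        E.root (s.history E ω t).counts z) e⟩)) (hg.comp ?_)
  exact measurable_snoc measurable_const ((Observation.measurable_mk _).comp
    (E.measurable_observe measurable_const measurable_id))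

end posterior

/-! ### The Gaussian identities in law, rewritten for iterated integrals. -/

section gaussianIntegrals

lemma measurable_coord {ι α : Type*} [MeasurableSpace α] {f : α → EuclideanSpace ℝ ι}
    (hf : Measurable f) (i : ι) : Measurable fun a => f a i := by
  fun_prop

lemma lintegral_add_scaled {a b c : ℝ} (h : a ^ 2 + b ^ 2 = c ^ 2) {f : ℝ → ℝ≥0∞}
    (hf : Measurable f) (x : ℝ) :
    ∫⁻ g, ∫⁻ g', f (x + a * g + b * g') ∂(gaussianReal 0 1) ∂(gaussianReal 0 1) =
      ∫⁻ g, f (x + c * g) ∂(gaussianReal 0 1) := by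
  have hm : Measurable fun y => f (x + y) := by fun_prop
  have key := congrArg (fun μ => ∫⁻ y, f (x + y) ∂μ) (InfoEnv.map_add_scaled h)
  beta_reduce at key
  rw [lintegral_map hm (by fun_prop), lintegral_map hm (by fun_prop),
    lintegral_prod (fun p : ℝ × ℝ => f (x + (a * p.1 + b * p.2)))
      (Measurable.aemeasurable (by fun_prop))] at key
  simpa only [add_assoc] using key

variable {K : ℕ} [NeZero K]

lemma lintegral_root_zero (E : InfoEnv K) (hV : E.V₀.PosDef) (q : Fin K → ℕ) {f : ℝ → ℝ≥0∞}
    (hf : Measurable f) (x : ℝ) :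
    ∫⁻ z, f (x + E.root q z 0) ∂(InfoEnv.stdState K) =
      ∫⁻ g, f (x + √(E.posteriorVar q) * g) ∂(gaussianReal 0 1) := by
  have hm : Measurable fun y => f (x + y) := by fun_prop
  have key := congrArg (fun μ => ∫⁻ y, f (x + y) ∂μ) (E.map_root_zero hV q)
  beta_reduce at key
  rwa [lintegral_map hm (by fun_prop), lintegral_map hm (by fun_prop)] at key

lemma lintegral_gain (E : InfoEnv K) (hV : E.V₀.PosDef) (hσ : ∀ k, 0 < E.sigmaSq k)
    (q n : Fin K → ℕ) {f : ℝ → ℝ≥0∞} (hf : Measurable f) (x : ℝ) :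
    ∫⁻ z, ∫⁻ e, f (x + E.gain (q + n) (E.observe (E.root q z) e) 0) ∂(E.blockNoise n)
        ∂(InfoEnv.stdState K) =
      ∫⁻ g, f (x + √(E.posteriorVar q - E.posteriorVar (q + n)) * g) ∂(gaussianReal 0 1) := by
  have hm : Measurable fun y => f (x + y) := by fun_prop
  have hobs : Measurable fun p : EuclideanSpace ℝ (Fin K) × Block n =>
      E.gain (q + n) (E.observe (E.root q p.1) p.2) :=
    (E.measurable_gain (q + n)).comp
      (E.measurable_observe ((E.measurable_root_apply q).comp measurable_fst) measurable_snd)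
  have hg : Measurable fun p : EuclideanSpace ℝ (Fin K) × Block n =>
      E.gain (q + n) (E.observe (E.root q p.1) p.2) 0 := measurable_coord hobs 0
  have key := congrArg (fun μ => ∫⁻ y, f (x + y) ∂μ) (E.map_gain_eq hV hσ q n)
  beta_reduce at key
  rwa [lintegral_map hm hg, lintegral_map hm (by fun_prop),
    lintegral_prod (fun p : EuclideanSpace ℝ (Fin K) × Block n =>
      f (x + E.gain (q + n) (E.observe (E.root q p.1) p.2) 0)) (hm.comp hg).aemeasurable] at key

lemma lintegral_simulate (E : InfoEnv K) (hV : E.V₀.PosDef) (hσ : ∀ k, 0 < E.sigmaSq k)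
    (q n : Fin K → ℕ) {v : ℝ} (hv : v ≤ E.posteriorVar (q + n)) {f : Block n × ℝ → ℝ≥0∞}
    (hf : Measurable f) :
    ∫⁻ g, ∫⁻ p, f (E.simulate q n v (√(E.posteriorVar q - v) * g) p, √(E.posteriorVar q - v) * g)
        ∂(((InfoEnv.stdState K).prod (E.blockNoise n)).prod (gaussianReal 0 1))
        ∂(gaussianReal 0 1) =
      ∫⁻ z, ∫⁻ e, ∫⁻ g, f (E.observe (E.root q z) e,
          E.gain (q + n) (E.observe (E.root q z) e) 0 + √(E.posteriorVar (q + n) - v) * g)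
        ∂(gaussianReal 0 1) ∂(E.blockNoise n) ∂(InfoEnv.stdState K) := by
  have hl : Measurable fun p : ℝ × ((EuclideanSpace ℝ (Fin K) × Block n) × ℝ) =>
      (E.simulate q n v (√(E.posteriorVar q - v) * p.1) p.2, √(E.posteriorVar q - v) * p.1) :=
    ((E.measurable_simulate q n v).comp
      (f := fun p : ℝ × ((EuclideanSpace ℝ (Fin K) × Block n) × ℝ) =>
        (√(E.posteriorVar q - v) * p.1, p.2)) (by fun_prop)).prodMk (by fun_prop)
  have hr : Measurable fun p : (EuclideanSpace ℝ (Fin K) × Block n) × ℝ =>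
      (E.observe (E.root q p.1.1) p.1.2, E.blurredGain q n v p) :=
    (E.measurable_observe ((E.measurable_root_apply q).comp (by fun_prop)) (by fun_prop)).prodMk
      (E.measurable_blurredGain q n v)
  have hfl : Measurable fun p : ℝ × ((EuclideanSpace ℝ (Fin K) × Block n) × ℝ) =>
      f (E.simulate q n v (√(E.posteriorVar q - v) * p.1) p.2, √(E.posteriorVar q - v) * p.1) :=
    hf.comp hl
  have hfr : Measurable fun p : (EuclideanSpace ℝ (Fin K) × Block n) × ℝ =>
      f (E.observe (E.root q p.1.1) p.1.2, E.blurredGain q n v p) := hf.comp hr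
  have key := congrArg (fun μ => ∫⁻ p, f p ∂μ) (E.map_simulate_eq hV hσ q n hv)
  beta_reduce at key
  rw [lintegral_map hf hl, lintegral_map hf hr, lintegral_prod _ hfl.aemeasurable,
    lintegral_prod _ hfr.aemeasurable,
    lintegral_prod _ hfr.lintegral_prod_right'.aemeasurable] at key
  exact key

end gaussianIntegrals

/-! ### The simulation of a strategy -/

/-- The random numbers used in one period of a simulation. -/
abbrev Tape (K : ℕ) : Type := (EuclideanSpace ℝ (Fin K) × (ℕ × Fin K × ℕ → ℝ)) × ℝ

/-- The law of the random numbers used in one period of a simulation. -/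
noncomputable abbrev tapeLaw {K : ℕ} (E : InfoEnv K) : Measure (Tape K) :=
  ((InfoEnv.stdState K).prod (noiseLaw E)).prod (gaussianReal 0 1)

/-- The law of all random numbers used in a simulation. -/
noncomputable abbrev tapesLaw {K : ℕ} (E : InfoEnv K) : Measure (ℕ → Tape K) :=
  Measure.infinitePi fun _ => tapeLaw E

/-- The random numbers needed to simulate a block of signals. -/
def Tape.block {K : ℕ} (n : Fin K → ℕ) (w : Tape K) :
    -- Each period has its own tape, so the time index inside a tape is a dummy and is set to `0`.
    (EuclideanSpace ℝ (Fin K) × Block n) × ℝ := ((w.1.1, blockAt 0 n w.1.2), w.2)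

lemma Tape.measurable_block {K : ℕ} (n : Fin K → ℕ) : Measurable (Tape.block (K := K) n) := by
  have := measurable_blockAt (K := K) 0 n
  unfold Tape.block
  fun_prop

section simulation

variable {K : ℕ} [NeZero K] {A : ℕ → Type u} [∀ t, MeasurableSpace (A t)]

omit [NeZero K] in
lemma lintegral_tape_block (E : InfoEnv K) (n : Fin K → ℕ)
    {f : (EuclideanSpace ℝ (Fin K) × Block n) × ℝ → ℝ≥0∞} (hf : Measurable f) :
    ∫⁻ w, f (Tape.block n w) ∂(tapeLaw E) =
      ∫⁻ p, f p ∂(((InfoEnv.stdState K).prod (E.blockNoise n)).prod (gaussianReal 0 1)) := by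
  have hm : (tapeLaw E).map (Tape.block n) =
      ((InfoEnv.stdState K).prod (E.blockNoise n)).prod (gaussianReal 0 1) := by
    have h1 : ((InfoEnv.stdState K).prod (noiseLaw E)).map (Prod.map id (blockAt 0 n)) =
        (InfoEnv.stdState K).prod (E.blockNoise n) := by
      rw [← Measure.map_prod_map _ _ measurable_id (measurable_blockAt 0 n), Measure.map_id,
        map_blockAt]
    have h2 := Measure.map_prod_map ((InfoEnv.stdState K).prod (noiseLaw E)) (gaussianReal 0 1)
      (measurable_id.prodMap (measurable_blockAt 0 n)) measurable_id
    rw [h1, Measure.map_id] at h2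
    rw [h2]
    rfl
  rw [← hm, lintegral_map hf (Tape.measurable_block n)]

/-- The next block of signals in a simulation, where `c` are its own counts, `q` the counts of the
simulated strategy, and `n` the block of the simulated strategy. -/
noncomputable def nextBlock (E : InfoEnv K) (B D : ℕ) (c q n : Fin K → ℕ) : Fin K → ℕ :=
  E.bestBlock c (InfoEnv.boost B D (∑ k, n k) (∑ k, c k - ∑ k, q k))

/-- The counts of a simulation, given the simulated history. -/
noncomputable def plan (E : InfoEnv K) (B D : ℕ) : (t : ℕ) → History K t → (Fin K → ℕ)
  | 0, _ => 0
  | t + 1, h => plan E B D t (Fin.init h) +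
      nextBlock E B D (plan E B D t (Fin.init h)) (History.counts (Fin.init h : History K t))
        (h (Fin.last t)).1

lemma plan_snoc (E : InfoEnv K) (B D : ℕ) {t : ℕ} (h : History K t) (o : Observation K) :
    plan E B D (t + 1) (Fin.snoc (α := fun _ => Observation K) h o) =
      plan E B D t h + nextBlock E B D (plan E B D t h) h.counts o.1 := by
  rw [plan]
  simp only [Fin.init_snoc, Fin.snoc_last]

lemma measurable_plan (E : InfoEnv K) (B D t : ℕ) : Measurable (plan E B D t) := by
  induction t with
  | zero => exact measurable_const
  | succ t ih =>
    have h1 : Measurable fun h : History K (t + 1) => plan E B D t (Fin.init h) :=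
      ih.comp measurable_init
    have h2 : Measurable fun h : History K (t + 1) =>
        History.counts (Fin.init h : History K t) := measurable_counts.comp measurable_init
    have h3 : Measurable fun h : History K (t + 1) => (h (Fin.last t)).1 :=
      Observation.measurable_counts.comp (measurable_pi_apply _)
    have h4 : Measurable fun p : (Fin K → ℕ) × (Fin K → ℕ) × (Fin K → ℕ) =>
        p.1 + nextBlock E B D p.1 p.2.1 p.2.2 := Measurable.of_discrete
    exact h4.comp (h1.prodMk (h2.prodMk h3))

lemma plan_invariant {E : InfoEnv K} {B D : ℕ} {R : (Fin K → ℕ) → (Fin K → ℕ) → Prop}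
    (hR : E.IsSimulationInvariant B D R) {t : ℕ} (h : History K t) :
    R (plan E B D t h) h.counts := by
  induction t with
  | zero => rw [counts_zero]; exact hR.zero
  | succ t ih =>
    have hs := hR.step _ _ (h (Fin.last t)).1 (ih (Fin.init h))
    have hc : History.counts h = History.counts (Fin.init h : History K t) +
        (h (Fin.last t)).1 := by
      conv_lhs => rw [← Fin.snoc_init_self h]
      exact counts_snoc _ _
    rw [hc, plan, nextBlock]
    exact hs

/-- The simulated history after one more period, where `h` is the simulated history before, `x` the
actual posterior mean of the payoff-relevant state after the period, and `c` the actual counts. -/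
noncomputable def simStep (s : Strategy K A) (E : InfoEnv K) (μ₀ : EuclideanSpace ℝ (Fin K))
    {t : ℕ} (w : Tape K) (h : History K t) (x : ℝ) (c : Fin K → ℕ) : History K (t + 1) :=
  Fin.snoc (α := fun _ => Observation K) h ⟨s.acquire t h, fun k j =>
    (∑ i, E.C k i * postMean E μ₀ t h i) +
      E.simulate h.counts (s.acquire t h) (E.posteriorVar c) (x - postMean E μ₀ t h 0)
        (w.block (s.acquire t h)) k j⟩

lemma measurable_simStep (s : Strategy K A) (E : InfoEnv K) (μ₀ : EuclideanSpace ℝ (Fin K))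
    (t : ℕ) {α : Type*} [MeasurableSpace α] {w : α → Tape K} {h : α → History K t} {x : α → ℝ}
    {c : α → Fin K → ℕ} (hw : Measurable w) (hh : Measurable h) (hx : Measurable x)
    (hc : Measurable c) : Measurable fun a => simStep s E μ₀ (w a) (h a) (x a) (c a) := by
  have hpm : Measurable fun a => postMean E μ₀ t (h a) := (measurable_postMean E μ₀ t).comp hh
  have hacq := (s.measurable_acquire t).comp hh
  refine measurable_of_countable_index (c := fun a => (c a, (h a).counts, s.acquire t (h a)))
    (hc.prodMk ((measurable_counts.comp hh).prodMk hacq))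
    (G := fun i a => Fin.snoc (α := fun _ => Observation K) (h a) ⟨i.2.2, fun k j =>
      (∑ l, E.C k l * postMean E μ₀ t (h a) l) +
        E.simulate i.2.1 i.2.2 (E.posteriorVar i.1) (x a - postMean E μ₀ t (h a) 0)
          ((w a).block i.2.2) k j⟩) fun i => ?_
  refine measurable_snoc hh ((Observation.measurable_mk _).comp ?_)
  have hs : Measurable fun a => E.simulate i.2.1 i.2.2 (E.posteriorVar i.1)
      (x a - postMean E μ₀ t (h a) 0) ((w a).block i.2.2) :=
    (E.measurable_simulate i.2.1 i.2.2 (E.posteriorVar i.1)).comp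
      (f := fun a => (x a - postMean E μ₀ t (h a) 0, (w a).block i.2.2))
      (Measurable.prodMk (by fun_prop) ((Tape.measurable_block _).comp hw))
  refine measurable_pi_lambda _ fun k => measurable_pi_lambda _ fun j => ?_
  fun_prop

/-- The simulated history, as a function of the actual history. -/
noncomputable def simHist (s : Strategy K A) (E : InfoEnv K) (μ₀ : EuclideanSpace ℝ (Fin K))
    (ξ : ℕ → Tape K) : (t : ℕ) → History K t → History K t
  | 0, _ => Fin.elim0
  | t + 1, h => simStep s E μ₀ (ξ t) (simHist s E μ₀ ξ t (Fin.init h))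
      (postMean E μ₀ (t + 1) h 0) h.counts

lemma measurable_simHist (s : Strategy K A) (E : InfoEnv K) (μ₀ : EuclideanSpace ℝ (Fin K))
    (t : ℕ) : Measurable fun p : (ℕ → Tape K) × History K t => simHist s E μ₀ p.1 t p.2 := by
  induction t with
  | zero => exact measurable_const
  | succ t ih =>
    have hpm : Measurable fun p : (ℕ → Tape K) × History K (t + 1) =>
        postMean E μ₀ (t + 1) p.2 := (measurable_postMean E μ₀ (t + 1)).comp measurable_snd
    refine measurable_simStep s E μ₀ t (by fun_prop)
      (ih.comp (measurable_fst.prodMk (measurable_init.comp measurable_snd)))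
      (measurable_coord hpm 0) (measurable_counts.comp measurable_snd)

lemma simHist_splice (s : Strategy K A) (E : InfoEnv K) (μ₀ : EuclideanSpace ℝ (Fin K))
    (ξ η : ℕ → Tape K) {t t' : ℕ} (ht : t' ≤ t) (h : History K t') :
    simHist s E μ₀ (splice {t} ξ η) t' h = simHist s E μ₀ ξ t' h := by
  induction t' with
  | zero => rfl
  | succ t' ih =>
    rw [simHist, simHist, ih (by omega)]
    congr 1
    exact splice_of_notMem _ _ (by simp; omega)

/-- The signals that a simulation chooses. -/
noncomputable def simAcquire (s : Strategy K A) (E : InfoEnv K) (B D : ℕ)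
    (μ₀ : EuclideanSpace ℝ (Fin K)) (ξ : ℕ → Tape K) (t : ℕ) (h : History K t) : Fin K → ℕ :=
  nextBlock E B D h.counts (simHist s E μ₀ ξ t h).counts (s.acquire t (simHist s E μ₀ ξ t h))

lemma measurable_simAcquire (s : Strategy K A) (E : InfoEnv K) (B D : ℕ)
    (μ₀ : EuclideanSpace ℝ (Fin K)) (t : ℕ) :
    Measurable fun p : (ℕ → Tape K) × History K t => simAcquire s E B D μ₀ p.1 t p.2 := by
  have h1 := measurable_simHist s E μ₀ t
  have h2 : Measurable fun p : (ℕ → Tape K) × History K t =>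
      (p.2.counts, (simHist s E μ₀ p.1 t p.2).counts, s.acquire t (simHist s E μ₀ p.1 t p.2)) :=
    (measurable_counts.comp measurable_snd).prodMk
      ((measurable_counts.comp h1).prodMk ((s.measurable_acquire t).comp h1))
  have h3 : Measurable fun p : (Fin K → ℕ) × (Fin K → ℕ) × (Fin K → ℕ) =>
      nextBlock E B D p.1 p.2.1 p.2.2 := Measurable.of_discrete
  exact h3.comp h2

/-- The strategy that simulates `s` with the random numbers `ξ`, and that chooses its own signals
myopically, with boosted intensities. -/
noncomputable def simStrategy (s : Strategy K A) (E : InfoEnv K) (B D : ℕ)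
    (μ₀ : EuclideanSpace ℝ (Fin K)) (ξ : ℕ → Tape K) : Strategy K A where
  acquire := simAcquire s E B D μ₀ ξ
  measurable_acquire t := (measurable_simAcquire s E B D μ₀ t).comp measurable_prodMk_left
  act t h := s.act t (simHist s E μ₀ ξ (t + 1) h)
  measurable_act t := (s.measurable_act t).comp
    ((measurable_simHist s E μ₀ (t + 1)).comp measurable_prodMk_left)

lemma simStrategy_myopic (s : Strategy K A) (E : InfoEnv K) (B D : ℕ)
    (μ₀ : EuclideanSpace ℝ (Fin K)) (ξ : ℕ → Tape K) : (simStrategy s E B D μ₀ ξ).Myopic E := by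
  intro t h m hm
  refine E.posteriorVar_bestBlock_le h.counts ?_
  rw [hm]
  exact E.sum_bestBlock _ _

/-- The simulated history, as a function of the outcome. -/
noncomputable def fictHist (s : Strategy K A) (E : InfoEnv K) (B D : ℕ)
    (μ₀ : EuclideanSpace ℝ (Fin K)) (ξ : ℕ → Tape K) (ω : Outcome K) (t : ℕ) : History K t :=
  simHist s E μ₀ ξ t ((simStrategy s E B D μ₀ ξ).history E ω t)

lemma fictHist_succ (s : Strategy K A) (E : InfoEnv K) (B D : ℕ)
    (μ₀ : EuclideanSpace ℝ (Fin K)) (ξ : ℕ → Tape K) (ω : Outcome K) (t : ℕ) :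
    fictHist s E B D μ₀ ξ ω (t + 1) = simStep s E μ₀ (ξ t) (fictHist s E B D μ₀ ξ ω t)
      (postMean E μ₀ (t + 1) ((simStrategy s E B D μ₀ ξ).history E ω (t + 1)) 0)
      ((simStrategy s E B D μ₀ ξ).history E ω (t + 1)).counts := by
  rw [fictHist, simHist]
  congr 1
  rw [history_succ, Fin.init_snoc, fictHist]

lemma acquire_fictHist (s : Strategy K A) (E : InfoEnv K) (B D : ℕ)
    (μ₀ : EuclideanSpace ℝ (Fin K)) (ξ : ℕ → Tape K) (ω : Outcome K) (t : ℕ) :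
    (simStrategy s E B D μ₀ ξ).acquire t ((simStrategy s E B D μ₀ ξ).history E ω t) =
      nextBlock E B D ((simStrategy s E B D μ₀ ξ).history E ω t).counts
        (fictHist s E B D μ₀ ξ ω t).counts (s.acquire t (fictHist s E B D μ₀ ξ ω t)) := rfl

/-- The actual counts depend on the outcome only through the fictitious history. Conditioning on the
latter therefore fixes the actual posterior variance. -/
lemma counts_history_simStrategy (s : Strategy K A) (E : InfoEnv K) (B D : ℕ)
    (μ₀ : EuclideanSpace ℝ (Fin K)) (ξ : ℕ → Tape K) (ω : Outcome K) (t : ℕ) :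
    ((simStrategy s E B D μ₀ ξ).history E ω t).counts =
      plan E B D t (fictHist s E B D μ₀ ξ ω t) := by
  induction t with
  | zero => exact counts_zero _
  | succ t ih =>
    rw [fictHist_succ, simStep, plan_snoc, history_succ, counts_snoc, ← ih, acquire_fictHist]

end simulation

lemma sq_sqrt_sub_add {a b c : ℝ} (hab : b ≤ a) (hbc : c ≤ b) :
    √(a - b) ^ 2 + √(b - c) ^ 2 = √(a - c) ^ 2 := by
  rw [Real.sq_sqrt (by linarith), Real.sq_sqrt (by linarith), Real.sq_sqrt (by linarith)]
  ring

/-! ### The joint law of the fictitious history, the actual posterior mean and the state. -/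

section simulationLaw

variable {K : ℕ} [NeZero K] {A : ℕ → Type u} [∀ t, MeasurableSpace (A t)]

instance (E : InfoEnv K) (μ₀ : EuclideanSpace ℝ (Fin K)) : IsProbabilityMeasure (law E μ₀) := by
  unfold law; infer_instance

lemma measurable_posteriorVar (E : InfoEnv K) {α : Type*} [MeasurableSpace α]
    {c : α → Fin K → ℕ} (hc : Measurable c) : Measurable fun a => E.posteriorVar (c a) :=
  (Measurable.of_discrete (f := E.posteriorVar)).comp hc

lemma measurable_lintegral_scaled {α : Type*} [MeasurableSpace α] {m σ : α → ℝ}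
    (hm : Measurable m) (hσ : Measurable σ) {f : α × ℝ → ℝ≥0∞} (hf : Measurable f) :
    Measurable fun a => ∫⁻ g, f (a, m a + σ a * g) ∂(gaussianReal 0 1) :=
  Measurable.lintegral_prod_right' (f := fun p : α × ℝ => f (p.1, m p.1 + σ p.1 * p.2))
    (by fun_prop)

/-- The law of the posterior mean of the payoff-relevant state after one more period. -/
lemma lintegral_postMean_succ (s : Strategy K A) (E : InfoEnv K) (hV : E.V₀.PosDef)
    (hσ : ∀ k, 0 < E.sigmaSq k) (μ₀ : EuclideanSpace ℝ (Fin K)) (t : ℕ)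
    {f : History K t × ℝ → ℝ≥0∞} (hf : Measurable f) :
    ∫⁻ ω, f (s.history E ω t, postMean E μ₀ (t + 1) (s.history E ω (t + 1)) 0) ∂(law E μ₀) =
      ∫⁻ ω, (fun h : History K t => ∫⁻ g, f (h, postMean E μ₀ t h 0 +
        √(E.posteriorVar h.counts - E.posteriorVar (h.counts + s.acquire t h)) * g)
        ∂(gaussianReal 0 1)) (s.history E ω t) ∂(law E μ₀) := by
  have hg : Measurable fun h : History K (t + 1) =>
      f (Fin.init h, postMean E μ₀ (t + 1) h 0) :=
    hf.comp (measurable_init.prodMk (measurable_coord (measurable_postMean E μ₀ (t + 1)) 0))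
  have key := lintegral_history_block s E hV hσ μ₀ t hg
  have hinit : ∀ ω, (Fin.init (s.history E ω (t + 1)) : History K t) = s.history E ω t := by
    intro ω
    rw [history_succ, Fin.init_snoc]
  simp only [hinit] at key
  rw [key]
  refine lintegral_congr fun ω => ?_
  set h := s.history E ω t
  beta_reduce
  rw [← lintegral_gain E hV hσ _ _ (f := fun x => f (h, x)) (hf.comp measurable_prodMk_left)]
  refine lintegral_congr fun z => lintegral_congr fun e => ?_
  rw [postMean_snoc, observe_add, Fin.init_snoc]
  simp only [add_sub_cancel_left, PiLp.add_apply]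

/-- The counts of a simulation after the next period. -/
noncomputable def nextPlan (s : Strategy K A) (E : InfoEnv K) (B D t : ℕ) (h : History K t) :
    Fin K → ℕ :=
  plan E B D t h + nextBlock E B D (plan E B D t h) h.counts (s.acquire t h)

lemma measurable_nextPlan (s : Strategy K A) (E : InfoEnv K) (B D t : ℕ) :
    Measurable (nextPlan s E B D t) := by
  have h4 : Measurable fun p : (Fin K → ℕ) × (Fin K → ℕ) × (Fin K → ℕ) =>
      p.1 + nextBlock E B D p.1 p.2.1 p.2.2 := Measurable.of_discrete
  exact h4.comp ((measurable_plan E B D t).prodMk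
    (measurable_counts.prodMk (s.measurable_acquire t)))

lemma posteriorVar_nextPlan_le (s : Strategy K A) {E : InfoEnv K} {B D : ℕ}
    {R : (Fin K → ℕ) → (Fin K → ℕ) → Prop} (hR : E.IsSimulationInvariant B D R) {t : ℕ}
    (h : History K t) :
    E.posteriorVar (nextPlan s E B D t h) ≤ E.posteriorVar (h.counts + s.acquire t h) :=
  hR.posteriorVar_le _ _ (hR.step _ _ _ (plan_invariant hR h))

lemma posteriorVar_nextPlan_le_plan (s : Strategy K A) {E : InfoEnv K} (hV : E.V₀.PosDef)
    (B D : ℕ) {t : ℕ} (h : History K t) :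
    E.posteriorVar (nextPlan s E B D t h) ≤ E.posteriorVar (plan E B D t h) :=
  E.posteriorVar_antitone hV le_self_add

lemma measurable_simulate_right (E : InfoEnv K) (q n : Fin K → ℕ) (v a : ℝ) :
    Measurable fun p => E.simulate q n v a p :=
  (E.measurable_simulate q n v).comp
    (f := fun p : (EuclideanSpace ℝ (Fin K) × Block n) × ℝ => (a, p)) (by fun_prop)

/-- The simulated signals of one period have the right joint law with the actual posterior mean. -/
lemma lintegral_simStep (s : Strategy K A) (E : InfoEnv K) (hV : E.V₀.PosDef)
    (hσ : ∀ k, 0 < E.sigmaSq k) (μ₀ : EuclideanSpace ℝ (Fin K)) {t : ℕ} (h : History K t)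
    {c : Fin K → ℕ} (hc : E.posteriorVar c ≤ E.posteriorVar (h.counts + s.acquire t h))
    {f : History K (t + 1) × ℝ → ℝ≥0∞} (hf : Measurable f) :
    ∫⁻ g, ∫⁻ w, f (simStep s E μ₀ w h
          (postMean E μ₀ t h 0 + √(E.posteriorVar h.counts - E.posteriorVar c) * g) c,
        postMean E μ₀ t h 0 + √(E.posteriorVar h.counts - E.posteriorVar c) * g)
        ∂(tapeLaw E) ∂(gaussianReal 0 1) =
      ∫⁻ z, ∫⁻ e, (fun h' : History K (t + 1) => ∫⁻ g, f (h', postMean E μ₀ (t + 1) h' 0 +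
            √(E.posteriorVar h'.counts - E.posteriorVar c) * g) ∂(gaussianReal 0 1))
          (Fin.snoc (α := fun _ => Observation K) h
            ⟨s.acquire t h, E.observe (postMean E μ₀ t h + E.root h.counts z) e⟩)
        ∂(E.blockNoise (s.acquire t h)) ∂(InfoEnv.stdState K) := by
  set m := postMean E μ₀ t h with hm
  set n := s.acquire t h with hn
  set v := E.posteriorVar c with hv
  set q := h.counts with hq
  have hshift : Measurable fun y : Block n =>
      (fun k j => (∑ i, E.C k i * m i) + y k j : Block n) := by fun_prop
  have hsnoc : Measurable fun y : Block n =>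
      (Fin.snoc (α := fun _ => Observation K) h ⟨n, y⟩ : History K (t + 1)) :=
    measurable_snoc measurable_const (Observation.measurable_mk n)
  have hF : Measurable fun p : Block n × ℝ => f (Fin.snoc (α := fun _ => Observation K) h
      ⟨n, fun k j => (∑ i, E.C k i * m i) + p.1 k j⟩, m 0 + p.2) :=
    hf.comp ((hsnoc.comp (hshift.comp measurable_fst)).prodMk (by fun_prop))
  have key := lintegral_simulate E hV hσ q n hc hF
  have e1 : ∀ g, ∫⁻ w, f (simStep s E μ₀ w h (m 0 + √(E.posteriorVar q - v) * g) c,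
        m 0 + √(E.posteriorVar q - v) * g) ∂(tapeLaw E) =
      ∫⁻ p, f (Fin.snoc (α := fun _ => Observation K) h ⟨n, fun k j => (∑ i, E.C k i * m i) +
          E.simulate q n v (√(E.posteriorVar q - v) * g) p k j⟩,
          m 0 + √(E.posteriorVar q - v) * g)
        ∂(((InfoEnv.stdState K).prod (E.blockNoise n)).prod (gaussianReal 0 1)) := by
    intro g
    have hs := measurable_simulate_right E q n v (√(E.posteriorVar q - v) * g)
    have h1 := lintegral_tape_block E n (f := fun p => f (Fin.snoc (α := fun _ => Observation K) h
        ⟨n, fun k j => (∑ i, E.C k i * m i) +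
          E.simulate q n v (√(E.posteriorVar q - v) * g) p k j⟩,
          m 0 + √(E.posteriorVar q - v) * g))
      (hF.comp (hs.prodMk (measurable_const (a := √(E.posteriorVar q - v) * g))))
    rw [← h1]
    refine lintegral_congr fun w => ?_
    rw [simStep]
    simp only [← hm, ← hv, ← hq, add_sub_cancel_left]
    rfl
  rw [lintegral_congr e1]
  refine key.trans ?_
  refine lintegral_congr fun z => lintegral_congr fun e => ?_
  beta_reduce
  rw [postMean_snoc, observe_add, counts_snoc, ← hm, ← hq]
  simp only [add_sub_cancel_left, PiLp.add_apply, add_assoc]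

variable (s : Strategy K A) (E : InfoEnv K) (B D : ℕ) (μ₀ : EuclideanSpace ℝ (Fin K))

lemma measurable_history_simStrategy (t : ℕ) :
    Measurable fun p : (ℕ → Tape K) × Outcome K =>
      (simStrategy s E B D μ₀ p.1).history E p.2 t :=
  measurable_history_family (fun t => measurable_simAcquire s E B D μ₀ t) E t

lemma measurable_fictHist (t : ℕ) :
    Measurable fun p : (ℕ → Tape K) × Outcome K => fictHist s E B D μ₀ p.1 p.2 t :=
  (measurable_simHist s E μ₀ t).comp
    (measurable_fst.prodMk (measurable_history_simStrategy s E B D μ₀ t))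

lemma simStrategy_acquire (ξ : ℕ → Tape K) (t : ℕ) (h : History K t) :
    (simStrategy s E B D μ₀ ξ).acquire t h = simAcquire s E B D μ₀ ξ t h := rfl

/-- The choice of signals in period `t` uses only tapes before `t`. Hence even the actual history of
length `t + 1` does not involve tape `t`, which is first used to extend the fictitious history
afterwards. -/
lemma history_simStrategy_splice (ξ η : ℕ → Tape K) (ω : Outcome K) {t t' : ℕ} (ht : t' ≤ t + 1) :
    (simStrategy s E B D μ₀ (splice {t} ξ η)).history E ω t' =
      (simStrategy s E B D μ₀ ξ).history E ω t' := by
  induction t' with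
  | zero => exact Subsingleton.elim _ _
  | succ t' ih =>
    have hacq : (simStrategy s E B D μ₀ (splice {t} ξ η)).acquire t' =
        (simStrategy s E B D μ₀ ξ).acquire t' := by
      funext h
      rw [simStrategy_acquire, simStrategy_acquire, simAcquire, simAcquire,
        simHist_splice s E μ₀ ξ η (by omega : t' ≤ t)]
    rw [history_succ, history_succ, ih (by omega), hacq]

omit [NeZero K] in
lemma lintegral_tapes_eval (t : ℕ) {f : Tape K → ℝ≥0∞} (hf : Measurable f) :
    ∫⁻ ξ, f (ξ t) ∂(tapesLaw E) = ∫⁻ w, f w ∂(tapeLaw E) := by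
  have h := (measurePreserving_eval_infinitePi (fun _ : ℕ => tapeLaw E) t)
  rw [← h.map_eq, lintegral_map hf h.measurable]

omit [NeZero K] in
/-- Integrate out the random numbers of one period. -/
lemma lintegral_tapes_resample (t : ℕ) {G : (ℕ → Tape K) → Outcome K → ℝ≥0∞}
    (hG : Measurable fun p : (ℕ → Tape K) × Outcome K => G p.1 p.2)
    {H : Tape K → (ℕ → Tape K) → Outcome K → ℝ≥0∞}
    (hH : ∀ ξ, Measurable fun p : Tape K × Outcome K => H p.1 ξ p.2)
    (hGH : ∀ ξ η ω, G (splice {t} ξ η) ω = H (η t) ξ ω) :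
    ∫⁻ ξ, ∫⁻ ω, G ξ ω ∂(law E μ₀) ∂(tapesLaw E) =
      ∫⁻ ξ, ∫⁻ ω, ∫⁻ w, H w ξ ω ∂(tapeLaw E) ∂(law E μ₀) ∂(tapesLaw E) := by
  rw [lintegral_splice _ {t} hG.lintegral_prod_right']
  refine lintegral_congr fun ξ => ?_
  simp only [hGH]
  have hm : Measurable fun p : (ℕ → Tape K) × Outcome K => H (p.1 t) ξ p.2 :=
    (hH ξ).comp (f := fun p : (ℕ → Tape K) × Outcome K => (p.1 t, p.2)) (by fun_prop)
  rw [lintegral_lintegral_swap hm.aemeasurable]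
  refine lintegral_congr fun ω => ?_
  exact lintegral_tapes_eval E t (f := fun w => H w ξ ω) ((hH ξ).comp measurable_prodMk_right)

lemma fictHist_splice (ξ η : ℕ → Tape K) (ω : Outcome K) (t : ℕ) :
    fictHist s E B D μ₀ (splice {t} ξ η) ω t = fictHist s E B D μ₀ ξ ω t := by
  rw [fictHist, history_simStrategy_splice s E B D μ₀ ξ η ω (by omega : t ≤ t + 1),
    simHist_splice s E μ₀ ξ η le_rfl, fictHist]

lemma counts_history_simStrategy_succ (ξ : ℕ → Tape K) (ω : Outcome K) (t : ℕ) :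
    ((simStrategy s E B D μ₀ ξ).history E ω (t + 1)).counts =
      nextPlan s E B D t (fictHist s E B D μ₀ ξ ω t) := by
  rw [history_succ, counts_snoc, counts_history_simStrategy, acquire_fictHist,
    counts_history_simStrategy, nextPlan]

/-- The posterior mean of the payoff-relevant state in a simulation. -/
noncomputable def simMean (ξ : ℕ → Tape K) (ω : Outcome K) (t : ℕ) : ℝ :=
  postMean E μ₀ t ((simStrategy s E B D μ₀ ξ).history E ω t) 0

lemma measurable_simMean (t : ℕ) :
    Measurable fun p : (ℕ → Tape K) × Outcome K => simMean s E B D μ₀ p.1 p.2 t :=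
  measurable_coord ((measurable_postMean E μ₀ t).comp
      (measurable_history_simStrategy s E B D μ₀ t)) 0

lemma simMean_splice (ξ η : ℕ → Tape K) (ω : Outcome K) (t : ℕ) :
    simMean s E B D μ₀ (splice {t} ξ η) ω (t + 1) = simMean s E B D μ₀ ξ ω (t + 1) := by
  rw [simMean, history_simStrategy_splice s E B D μ₀ ξ η ω le_rfl, simMean]

/-- The random numbers of the last period are independent of everything before. -/
lemma lintegral_fictHist_succ (t : ℕ) {f : History K (t + 1) × ℝ → ℝ≥0∞}
    (hf : Measurable f) :
    ∫⁻ ξ, ∫⁻ ω, f (fictHist s E B D μ₀ ξ ω (t + 1), simMean s E B D μ₀ ξ ω (t + 1))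
        ∂(law E μ₀) ∂(tapesLaw E) =
      ∫⁻ ξ, ∫⁻ ω, ∫⁻ w, f (simStep s E μ₀ w (fictHist s E B D μ₀ ξ ω t)
          (simMean s E B D μ₀ ξ ω (t + 1)) (nextPlan s E B D t (fictHist s E B D μ₀ ξ ω t)),
          simMean s E B D μ₀ ξ ω (t + 1)) ∂(tapeLaw E) ∂(law E μ₀) ∂(tapesLaw E) := by
  refine lintegral_tapes_resample E μ₀ t
    (G := fun ξ ω => f (fictHist s E B D μ₀ ξ ω (t + 1), simMean s E B D μ₀ ξ ω (t + 1)))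
    (H := fun w ξ ω => f (simStep s E μ₀ w (fictHist s E B D μ₀ ξ ω t)
          (simMean s E B D μ₀ ξ ω (t + 1)) (nextPlan s E B D t (fictHist s E B D μ₀ ξ ω t)),
          simMean s E B D μ₀ ξ ω (t + 1))) ?_ ?_ ?_
  · exact hf.comp ((measurable_fictHist s E B D μ₀ (t + 1)).prodMk
      (measurable_simMean s E B D μ₀ (t + 1)))
  · intro ξ
    have h1 : Measurable fun p : Tape K × Outcome K => fictHist s E B D μ₀ ξ p.2 t :=
      (measurable_fictHist s E B D μ₀ t).comp 
        (f := fun p : Tape K × Outcome K => (ξ, p.2)) (by fun_prop)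
    have h2 : Measurable fun p : Tape K × Outcome K => simMean s E B D μ₀ ξ p.2 (t + 1) :=
      (measurable_simMean s E B D μ₀ (t + 1)).comp 
        (f := fun p : Tape K × Outcome K => (ξ, p.2)) (by fun_prop)
    exact hf.comp ((measurable_simStep s E μ₀ t measurable_fst h1 h2
      ((measurable_nextPlan s E B D t).comp h1)).prodMk h2)
  · intro ξ η ω
    rw [fictHist_succ, ← simMean, simMean_splice, fictHist_splice,
      history_simStrategy_splice s E B D μ₀ ξ η ω le_rfl, counts_history_simStrategy_succ,
      splice_of_mem ξ η (Set.mem_singleton t)]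

variable {s E B D μ₀}

/-- The joint law of the simulated history and the actual posterior mean. -/
lemma lintegral_fictHist (hV : E.V₀.PosDef) (hσ : ∀ k, 0 < E.sigmaSq k)
    {R : (Fin K → ℕ) → (Fin K → ℕ) → Prop} (hR : E.IsSimulationInvariant B D R) (t : ℕ)
    {f : History K t × ℝ → ℝ≥0∞} (hf : Measurable f) :
    ∫⁻ ξ, ∫⁻ ω, f (fictHist s E B D μ₀ ξ ω t, simMean s E B D μ₀ ξ ω t)
        ∂(law E μ₀) ∂(tapesLaw E) =
      ∫⁻ ω, (fun h : History K t => ∫⁻ g, f (h, postMean E μ₀ t h 0 +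
        √(E.posteriorVar h.counts - E.posteriorVar (plan E B D t h)) * g)
        ∂(gaussianReal 0 1)) (s.history E ω t) ∂(law E μ₀) := by
  induction t with
  | zero =>
    have h0 : ∀ h : History K 0, h = Fin.elim0 := fun h => Subsingleton.elim _ _
    simp only [h0 (fictHist _ _ _ _ _ _ _ 0), h0 (Strategy.history _ _ _ 0), simMean, postMean, plan,
      counts_zero]
    simp
  | succ t ih =>
    rw [lintegral_fictHist_succ s E B D μ₀ t hf]
    set f₁ : History K t × ℝ → ℝ≥0∞ := fun p => ∫⁻ w,
      f (simStep s E μ₀ w p.1 p.2 (nextPlan s E B D t p.1), p.2) ∂(tapeLaw E) with hf₁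
    have hf₁m : Measurable f₁ := by
      refine Measurable.lintegral_prod_right' (f := fun p : (History K t × ℝ) × Tape K =>
        f (simStep s E μ₀ p.2 p.1.1 p.1.2 (nextPlan s E B D t p.1.1), p.1.2)) ?_
      exact hf.comp ((measurable_simStep s E μ₀ t measurable_snd (by fun_prop) (by fun_prop)
        ((measurable_nextPlan s E B D t).comp (by fun_prop))).prodMk (by fun_prop))
    set f₂ : History K t × ℝ → ℝ≥0∞ := fun p => ∫⁻ g, f₁ (p.1, p.2 +
      √(E.posteriorVar (plan E B D t p.1) - E.posteriorVar (nextPlan s E B D t p.1)) * g)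
      ∂(gaussianReal 0 1) with hf₂
    have hvar₁ : Measurable fun h : History K t => E.posteriorVar (plan E B D t h) :=
      measurable_posteriorVar E (measurable_plan E B D t)
    have hvar₂ : Measurable fun h : History K t => E.posteriorVar (nextPlan s E B D t h) :=
      measurable_posteriorVar E (measurable_nextPlan s E B D t)
    have hf₂m : Measurable f₂ :=
      measurable_lintegral_scaled (m := fun p : History K t × ℝ => p.2)
        (σ := fun p : History K t × ℝ => √(E.posteriorVar (plan E B D t p.1) -
          E.posteriorVar (nextPlan s E B D t p.1)))
        (f := fun p => f₁ (p.1.1, p.2)) measurable_snd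
        ((hvar₁.comp measurable_fst).sub (hvar₂.comp measurable_fst)).sqrt (by fun_prop)
    -- For fixed tapes, the next actual posterior mean is Gaussian around the current one; its
    -- variance is the reduction in posterior variance brought by the actual block.
    have hstep : ∀ ξ, ∫⁻ ω, f₁ (fictHist s E B D μ₀ ξ ω t,
          simMean s E B D μ₀ ξ ω (t + 1)) ∂(law E μ₀) =
        ∫⁻ ω, f₂ (fictHist s E B D μ₀ ξ ω t,
          simMean s E B D μ₀ ξ ω t) ∂(law E μ₀) := by
      intro ξ
      have hsim : Measurable (simHist s E μ₀ ξ t) :=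
        (measurable_simHist s E μ₀ t).comp measurable_prodMk_left
      have h1 := lintegral_postMean_succ (simStrategy s E B D μ₀ ξ) E hV hσ μ₀ t
        (f := fun p => f₁ (simHist s E μ₀ ξ t p.1, p.2)) (by fun_prop)
      refine h1.trans (lintegral_congr fun ω => ?_)
      beta_reduce
      rw [counts_history_simStrategy, acquire_fictHist, counts_history_simStrategy]
      rfl
    refine (lintegral_congr hstep).trans ?_
    rw [ih hf₂m]
    have hΘ : Measurable fun h : History K (t + 1) => ∫⁻ g, f (h, postMean E μ₀ (t + 1) h 0 +
        √(E.posteriorVar h.counts - E.posteriorVar (plan E B D (t + 1) h)) * g)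
        ∂(gaussianReal 0 1) :=
      measurable_lintegral_scaled (measurable_coord (measurable_postMean E μ₀ (t + 1)) 0)
        (((measurable_posteriorVar E measurable_counts).sub
          (measurable_posteriorVar E (measurable_plan E B D (t + 1)))).sqrt) hf
    rw [lintegral_history_block s E hV hσ μ₀ t hΘ]
    refine lintegral_congr fun ω => ?_
    set h := s.history E ω t with hh
    have hplan : E.posteriorVar (plan E B D t h) ≤ E.posteriorVar h.counts :=
      hR.posteriorVar_le _ _ (plan_invariant hR h)
    -- Two independent Gaussian displacements add up: from the fictitious to the actual mean, with
    -- variance `f(q) - f(plan)`, and from the actual mean to its next value, with variance `f(plan)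
    -- - f(nextPlan)`.
    have h1 := lintegral_add_scaled (sq_sqrt_sub_add hplan
      (posteriorVar_nextPlan_le_plan s hV B D h)) (f := fun x => f₁ (h, x))
      (hf₁m.comp measurable_prodMk_left) (postMean E μ₀ t h 0)
    refine h1.trans ?_
    -- The sum has exactly the variance from which a fictitious block can be simulated. Here the
    -- next actual variance must not exceed the next fictitious one.
    refine (lintegral_simStep s E hV hσ μ₀ h (posteriorVar_nextPlan_le s hR h) hf).trans ?_
    refine lintegral_congr fun z => lintegral_congr fun e => ?_
    beta_reduce
    rw [plan_snoc]
    rfl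

/-- The simulated history and the payoff-relevant state have the joint law of the history of the
simulated strategy and the payoff-relevant state. -/
lemma lintegral_fictHist_state (hV : E.V₀.PosDef) (hσ : ∀ k, 0 < E.sigmaSq k)
    {R : (Fin K → ℕ) → (Fin K → ℕ) → Prop} (hR : E.IsSimulationInvariant B D R) (t : ℕ)
    {f : History K t × ℝ → ℝ≥0∞} (hf : Measurable f) :
    ∫⁻ ξ, ∫⁻ ω, f (fictHist s E B D μ₀ ξ ω t, ω.1 0) ∂(law E μ₀) ∂(tapesLaw E) =
      ∫⁻ ω, f (s.history E ω t, ω.1 0) ∂(law E μ₀) := by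
  have hcoord : Measurable fun θ : EuclideanSpace ℝ (Fin K) => θ 0 := by fun_prop
  have hξ : ∀ ξ, ∫⁻ ω, f (fictHist s E B D μ₀ ξ ω t, ω.1 0) ∂(law E μ₀) =
      ∫⁻ ω, (fun p : History K t × ℝ => ∫⁻ g, f (p.1, p.2 +
          √(E.posteriorVar (plan E B D t p.1)) * g) ∂(gaussianReal 0 1))
        (fictHist s E B D μ₀ ξ ω t,
          simMean s E B D μ₀ ξ ω t) ∂(law E μ₀) := by
    intro ξ
    have hsim : Measurable (simHist s E μ₀ ξ t) :=
      (measurable_simHist s E μ₀ t).comp measurable_prodMk_left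
    have h1 := lintegral_history (simStrategy s E B D μ₀ ξ) E hV hσ μ₀ t
      (f := fun p => f (simHist s E μ₀ ξ t p.1, p.2 0)) (by fun_prop)
    refine h1.trans (lintegral_congr fun ω => ?_)
    beta_reduce
    rw [← counts_history_simStrategy, ← lintegral_root_zero E hV _
      (f := fun x => f (fictHist s E B D μ₀ ξ ω t, x)) (hf.comp measurable_prodMk_left)]
    rfl
  rw [lintegral_congr hξ]
  have hvar : Measurable fun h : History K t => E.posteriorVar (plan E B D t h) :=
    measurable_posteriorVar E (measurable_plan E B D t)
  have hm := measurable_lintegral_scaled (m := fun p : History K t × ℝ => p.2)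
        (σ := fun p : History K t × ℝ => √(E.posteriorVar (plan E B D t p.1)))
        (f := fun p => f (p.1.1, p.2)) measurable_snd (hvar.comp measurable_fst).sqrt
        (by fun_prop)
  rw [lintegral_fictHist hV hσ hR t hm,
    lintegral_history s E hV hσ μ₀ t (f := fun p => f (p.1, p.2 0)) (by fun_prop)]
  refine lintegral_congr fun ω => ?_
  set h := s.history E ω t
  have hplan : E.posteriorVar (plan E B D t h) ≤ E.posteriorVar h.counts :=
    hR.posteriorVar_le _ _ (plan_invariant hR h)
  have h1 := lintegral_root_zero E hV h.counts (f := fun x => f (h, x))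
    (hf.comp measurable_prodMk_left) (postMean E μ₀ t h 0)
  refine Eq.trans ?_ h1.symm
  -- The spread of the actual mean around the fictitious one and the actual posterior variance add
  -- up to the posterior variance of the simulated strategy.
  refine lintegral_add_scaled (a := √(E.posteriorVar h.counts - E.posteriorVar (plan E B D t h)))
    (b := √(E.posteriorVar (plan E B D t h))) ?_ (f := fun x => f (h, x))
    (hf.comp measurable_prodMk_left) _
  rw [Real.sq_sqrt (by linarith), Real.sq_sqrt (E.posteriorVar_pos hV _).le,
    Real.sq_sqrt (E.posteriorVar_pos hV _).le]
  ring

end simulationLaw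

/-! ### Laws of sequences of histories -/

section sequences

variable {K : ℕ}

lemma apply_castLE_of_init {H : (t : ℕ) → History K t}
    (hH : ∀ t, (Fin.init (H (t + 1)) : History K t) = H t) {t T : ℕ} (h : t ≤ T) (i : Fin t) :
    H T (Fin.castLE h i) = H t i := by
  induction T, h using Nat.le_induction with
  | base => rfl
  | succ T h ih => rw [← ih, ← hH T]; rfl

/-- Two sequences of histories that have the same laws at all finite times have the same law. -/
lemma lintegral_histories_eq {Ω₁ Ω₂ : Type*} [MeasurableSpace Ω₁] [MeasurableSpace Ω₂]
    {μ₁ : Measure Ω₁} {μ₂ : Measure Ω₂} [IsFiniteMeasure μ₁]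
    {H₁ : Ω₁ → (t : ℕ) → History K t} {H₂ : Ω₂ → (t : ℕ) → History K t} {x₁ : Ω₁ → ℝ} {x₂ : Ω₂ → ℝ}
    (hm₁ : ∀ t, Measurable fun ω => H₁ ω t) (hm₂ : ∀ t, Measurable fun ω => H₂ ω t)
    (hx₁ : Measurable x₁) (hx₂ : Measurable x₂)
    (hi₁ : ∀ ω t, (Fin.init (H₁ ω (t + 1)) : History K t) = H₁ ω t)
    (hi₂ : ∀ ω t, (Fin.init (H₂ ω (t + 1)) : History K t) = H₂ ω t)
    (heq : ∀ t (f : History K t × ℝ → ℝ≥0∞), Measurable f →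
      ∫⁻ ω, f (H₁ ω t, x₁ ω) ∂μ₁ = ∫⁻ ω, f (H₂ ω t, x₂ ω) ∂μ₂)
    {f : ((t : ℕ) → History K t × ℝ) → ℝ≥0∞} (hf : Measurable f) :
    ∫⁻ ω, f (fun t => (H₁ ω t, x₁ ω)) ∂μ₁ = ∫⁻ ω, f (fun t => (H₂ ω t, x₂ ω)) ∂μ₂ := by
  have hZ₁ : Measurable fun ω => (fun t => (H₁ ω t, x₁ ω) : (t : ℕ) → History K t × ℝ) :=
    measurable_pi_lambda _ fun t => (hm₁ t).prodMk hx₁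
  have hZ₂ : Measurable fun ω => (fun t => (H₂ ω t, x₂ ω) : (t : ℕ) → History K t × ℝ) :=
    measurable_pi_lambda _ fun t => (hm₂ t).prodMk hx₂
  rw [← lintegral_map hf hZ₁, ← lintegral_map hf hZ₂]
  congr 1
  refine IsProjectiveLimit.unique
    (P := fun I : Finset ℕ => (μ₁.map (fun ω t => (H₁ ω t, x₁ ω))).map I.restrict)
    (fun _ => rfl) fun I => ?_
  -- Histories are nested, so all coordinates with index in `I` are truncations of the history at
  -- the largest index; a law at a single time determines each finite-dimensional law.
  have hle : ∀ i : I, (i : ℕ) ≤ I.sup id := fun i => Finset.le_sup (f := id) i.2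
  set r : History K (I.sup id) × ℝ → ((i : I) → History K i × ℝ) :=
    fun p i => (fun j => p.1 (Fin.castLE (hle i) j), p.2) with hr
  have hrm : Measurable r := measurable_pi_lambda _ fun i =>
    Measurable.prodMk (measurable_pi_lambda _ fun j =>
      (measurable_pi_apply _).comp measurable_fst) measurable_snd
  have e₁ : I.restrict ∘ (fun ω t => (H₁ ω t, x₁ ω) : Ω₁ → (t : ℕ) → History K t × ℝ) =
      r ∘ fun ω => (H₁ ω (I.sup id), x₁ ω) := by
    funext ω i
    refine Prod.ext (funext fun j => ?_) rfl
    exact (apply_castLE_of_init (hi₁ ω) (hle i) j).symm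
  have e₂ : I.restrict ∘ (fun ω t => (H₂ ω t, x₂ ω) : Ω₂ → (t : ℕ) → History K t × ℝ) =
      r ∘ fun ω => (H₂ ω (I.sup id), x₂ ω) := by
    funext ω i
    refine Prod.ext (funext fun j => ?_) rfl
    exact (apply_castLE_of_init (hi₂ ω) (hle i) j).symm
  beta_reduce
  rw [Measure.map_map (Finset.measurable_restrict I) hZ₁,
    Measure.map_map (Finset.measurable_restrict I) hZ₂, e₁, e₂,
    ← Measure.map_map hrm ((hm₁ _).prodMk hx₁), ← Measure.map_map hrm ((hm₂ _).prodMk hx₂)]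
  congr 1
  ext S hS
  have hind : Measurable (S.indicator (1 : History K (I.sup id) × ℝ → ℝ≥0∞)) :=
    measurable_one.indicator hS
  have hk := heq (I.sup id) _ hind
  rw [← lintegral_map hind ((hm₁ _).prodMk hx₁), ← lintegral_map hind ((hm₂ _).prodMk hx₂),
    lintegral_indicator_one hS, lintegral_indicator_one hS] at hk
  exact hk.symm

end sequences

/-! ### Costs and payoffs -/

/-- A random mixture is no better than its best realization. Positive and negative parts are kept
apart because the negative part may have infinite expectation. -/
lemma exists_le_sub {X : Type*} [MeasurableSpace X] {μ : Measure X} [IsProbabilityMeasure μ]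
    {p n : X → ℝ≥0∞} (hp : Measurable p) (hn : Measurable n) {a b : ℝ≥0∞} (ha : a ≠ ∞)
    (hpi : ∫⁻ x, p x ∂μ ≠ ∞) (hap : a ≤ ∫⁻ x, p x ∂μ) (hnb : ∫⁻ x, n x ∂μ ≤ b) :
    ∃ x, p x < ∞ ∧ (a : EReal) - b ≤ (p x : EReal) - n x := by
  have hpf := ae_lt_top hp hpi
  by_cases hb : b = ∞
  · obtain ⟨x, hx⟩ := hpf.exists
    refine ⟨x, hx, ?_⟩
    lift a to ℝ≥0 using ha
    rw [hb, EReal.coe_ennreal_top, EReal.sub_top]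
    exact bot_le
  · have hni : ∫⁻ x, n x ∂μ ≠ ∞ := ne_top_of_le_ne_top hb hnb
    have hnf := ae_lt_top hn hni
    by_contra! hcon
    -- The strict inequality is rearranged into sums, so that it can be integrated in `ℝ≥0∞`.
    have hlt : ∀ᵐ x ∂μ, p x + b < a + n x := by
      filter_upwards [hpf, hnf] with x hx hnx
      have h1 := hcon x hx
      by_contra! hle
      refine absurd h1 (not_lt.2 ?_)
      lift a to ℝ≥0 using ha
      lift b to ℝ≥0 using hb
      generalize p x = px at *
      generalize n x = nx at *
      lift px to ℝ≥0 using hx.ne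
      lift nx to ℝ≥0 using hnx.ne
      have h2 : (a : ℝ) + nx ≤ px + b := by exact_mod_cast hle
      have h3 : (a : ℝ) - b ≤ px - nx := by linarith
      simp only [EReal.coe_nnreal_eq_coe_real]
      exact_mod_cast h3
    have hs := lintegral_strict_mono (IsProbabilityMeasure.ne_zero μ)
      (hn.const_add a).aemeasurable
      (by rw [lintegral_add_right _ measurable_const]; simp [hpi, hb]) hlt
    rw [lintegral_add_right _ measurable_const, lintegral_add_left measurable_const] at hs
    simp only [lintegral_const, measure_univ, mul_one] at hs
    exact absurd hs (not_lt.2 (add_le_add hap hnb))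

/-- Raising intensities between `1` and `B` to `B` saves only a bounded amount. -/
lemma tsum_cost_le {κ : ℕ → ℝ≥0∞} {d : ℝ≥0∞} (hd : d ≤ 1) {B D : ℕ} {N adv : ℕ → ℕ}
    (hadv : ∀ t, adv (t + 1) + N t = adv t + InfoEnv.boost B D (N t) (adv t))
    (hfin : ∀ t, 1 ≤ N t → N t < B → κ (N t) ≠ ∞) :
    ∑' t, d ^ t * κ (N t) ≤ ∑' t, d ^ t * κ (InfoEnv.boost B D (N t) (adv t)) +
      (∑ n ∈ Finset.range B, if κ n = ∞ then 0 else κ n) * D := by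
  set M := ∑ n ∈ Finset.range B, if κ n = ∞ then 0 else κ n with hM
  -- A period in which the intensity is raised saves at most `M` and increases `min (adv t) D` by at
  -- least one, so there are at most `D` such periods. Infinite costs are left out of `M` to keep it
  -- finite, and `hfin` excludes them where it matters.
  have hpart : ∀ t, ∑ i ∈ Finset.range t, d ^ i * κ (N i) ≤
      ∑ i ∈ Finset.range t, d ^ i * κ (InfoEnv.boost B D (N i) (adv i)) +
        M * ((min (adv t) D : ℕ) : ℝ≥0∞) := by
    intro t
    induction t with
    | zero => simp
    | succ t ih =>
      rw [Finset.sum_range_succ, Finset.sum_range_succ]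
      by_cases hb : 1 ≤ N t ∧ N t < B ∧ adv t < D
      · have hadv' := hadv t
        have hbo : InfoEnv.boost B D (N t) (adv t) = B := by rw [InfoEnv.boost, if_pos hb]
        rw [hbo] at hadv'
        have hmin : min (adv t) D + 1 ≤ min (adv (t + 1)) D := by omega
        have hκ : d ^ t * κ (N t) ≤ M := by
          have h1 : κ (N t) ≤ M := by
            have := Finset.single_le_sum (f := fun n => if κ n = ∞ then 0 else κ n)
              (fun _ _ => zero_le) (Finset.mem_range.2 hb.2.1)
            simpa [hfin t hb.1 hb.2.1] using this
          calc d ^ t * κ (N t) ≤ 1 * κ (N t) := by gcongr; exact pow_le_one' hd t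
            _ ≤ M := by rwa [one_mul]
        calc _ ≤ (∑ i ∈ Finset.range t, d ^ i * κ (InfoEnv.boost B D (N i) (adv i)) +
              M * ((min (adv t) D : ℕ) : ℝ≥0∞)) + M := add_le_add ih hκ
          _ = ∑ i ∈ Finset.range t, d ^ i * κ (InfoEnv.boost B D (N i) (adv i)) +
              M * ((min (adv t) D + 1 : ℕ) : ℝ≥0∞) := by push_cast; ring
          _ ≤ _ := by
              gcongr
              exact le_self_add
      · have hbo : InfoEnv.boost B D (N t) (adv t) = N t := by rw [InfoEnv.boost, if_neg hb]
        have hadv' := hadv t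
        rw [hbo] at hadv' ⊢
        have : adv (t + 1) = adv t := by omega
        rw [this, add_right_comm]
        gcongr
  refine ENNReal.tsum_le_of_sum_range_le fun t => (hpart t).trans ?_
  gcongr
  · exact ENNReal.sum_le_tsum _
  · exact min_le_right _ _

lemma sub_le_sub_add {g : ℝ} {c c' M : ℝ≥0∞} (hM : M ≠ ∞) (h : c ≤ c' + M) :
    (g : EReal) - c' ≤ ((g : EReal) - c) + M := by
  by_cases hc' : c' = ∞
  · rw [hc', EReal.coe_ennreal_top, EReal.sub_top]
    exact bot_le
  · have hc : c ≠ ∞ := ne_top_of_le_ne_top (by simp [hc', hM]) h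
    lift c to ℝ≥0 using hc
    lift c' to ℝ≥0 using hc'
    lift M to ℝ≥0 using hM
    have h1 : (c : ℝ) ≤ c' + M := by exact_mod_cast h
    have h2 : g - c' ≤ g - c + (M : ℝ) := by linarith
    simp only [EReal.coe_nnreal_eq_coe_real]
    exact_mod_cast h2

section payoffs

variable {K : ℕ} [NeZero K] {A : ℕ → Type u} [∀ t, MeasurableSpace (A t)]

namespace DecisionProblem

omit [NeZero K] in
lemma measurable_sub_cost (P : DecisionProblem K A) {α : Type*} [MeasurableSpace α]
    {a : α → (t : ℕ) → A t} (ha : ∀ t, Measurable fun ω => a ω t) {x : α → ℝ} (hx : Measurable x)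
    {N : α → ℕ → ℕ} (hN : ∀ t, Measurable fun ω => N ω t) :
    Measurable fun ω => ((P.U (a ω) (x ω) : ℝ) : EReal) -
      ((∑' t, ENNReal.ofReal P.δ ^ t * P.κ (N ω t) : ℝ≥0∞) : EReal) := by
  have h1 : Measurable fun ω => P.U (a ω) (x ω) :=
    P.measurable_U.comp ((measurable_pi_lambda _ ha).prodMk hx)
  have h2 : Measurable fun ω => ∑' t, ENNReal.ofReal P.δ ^ t * P.κ (N ω t) :=
    Measurable.tsum fun t => ((Measurable.of_discrete (f := P.κ)).comp (hN t)).const_mul _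
  fun_prop

/-- The payoff, as a function of the sequence of histories and the payoff-relevant state. -/
noncomputable def pathPayoff (P : DecisionProblem K A) (s : Strategy K A)
    (Z : (t : ℕ) → History K t × ℝ) : EReal :=
  ((P.U (fun t => s.act t (Z (t + 1)).1) (Z 0).2 : ℝ) : EReal) -
    ((∑' t, ENNReal.ofReal P.δ ^ t * P.κ (∑ k, s.acquire t (Z t).1 k) : ℝ≥0∞) : EReal)

omit [NeZero K] in
lemma measurable_pathPayoff (P : DecisionProblem K A) (s : Strategy K A) :
    Measurable (P.pathPayoff s) := by
  refine P.measurable_sub_cost (fun t => (s.measurable_act t).comp (by fun_prop)) (by fun_prop)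
    fun t => ?_
  have := (s.measurable_acquire t).comp
    (by fun_prop : Measurable fun Z : (t : ℕ) → History K t × ℝ => (Z t).1)
  exact Finset.measurable_sum _ fun k _ => (measurable_pi_apply k).comp this

variable (P : DecisionProblem K A) (s : Strategy K A) (E : InfoEnv K) (B D : ℕ)

lemma measurable_payoff_simStrategy :
    Measurable fun p : (ℕ → Tape K) × Outcome K =>
      P.payoff E (simStrategy s E B D P.μ₀ p.1) p.2 := by
  refine P.measurable_sub_cost
    (fun t => (s.measurable_act t).comp (measurable_fictHist s E B D P.μ₀ (t + 1))) (by fun_prop)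
    fun t => ?_
  have := (measurable_simAcquire s E B D P.μ₀ t).comp
    (measurable_fst.prodMk (measurable_history_simStrategy s E B D P.μ₀ t))
  exact Finset.measurable_sum _ fun k _ => (measurable_pi_apply k).comp this

/-- The number of signals by which a simulation is ahead. -/
noncomputable def advance (μ₀ : EuclideanSpace ℝ (Fin K)) (ξ : ℕ → Tape K) (ω : Outcome K)
    (t : ℕ) : ℕ :=
  ∑ k, plan E B D t (fictHist s E B D μ₀ ξ ω t) k - ∑ k, (fictHist s E B D μ₀ ξ ω t).counts k

lemma totalCost_simStrategy (ξ : ℕ → Tape K) (ω : Outcome K) :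
    P.totalCost E (simStrategy s E B D P.μ₀ ξ) ω = ∑' t, ENNReal.ofReal P.δ ^ t *
      P.κ (InfoEnv.boost B D (∑ k, s.acquire t (fictHist s E B D P.μ₀ ξ ω t) k)
        (advance s E B D P.μ₀ ξ ω t)) := by
  refine tsum_congr fun t => ?_
  rw [acquire_fictHist, counts_history_simStrategy, nextBlock, E.sum_bestBlock, advance]

variable {B D}

lemma advance_succ {R : (Fin K → ℕ) → (Fin K → ℕ) → Prop} (hR : E.IsSimulationInvariant B D R)
    (μ₀ : EuclideanSpace ℝ (Fin K)) (ξ : ℕ → Tape K) (ω : Outcome K) (t : ℕ) :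
    advance s E B D μ₀ ξ ω (t + 1) + ∑ k, s.acquire t (fictHist s E B D μ₀ ξ ω t) k =
      advance s E B D μ₀ ξ ω t +
        InfoEnv.boost B D (∑ k, s.acquire t (fictHist s E B D μ₀ ξ ω t) k)
          (advance s E B D μ₀ ξ ω t) := by
  have h0 := hR.sum_le _ _ (plan_invariant hR (fictHist s E B D μ₀ ξ ω t))
  have h1 := hR.sum_le _ _ (plan_invariant hR (fictHist s E B D μ₀ ξ ω (t + 1)))
  have e1 : ∑ k, plan E B D (t + 1) (fictHist s E B D μ₀ ξ ω (t + 1)) k =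
      ∑ k, plan E B D t (fictHist s E B D μ₀ ξ ω t) k +
        InfoEnv.boost B D (∑ k, s.acquire t (fictHist s E B D μ₀ ξ ω t) k)
          (advance s E B D μ₀ ξ ω t) := by
    rw [fictHist_succ, simStep, plan_snoc, nextBlock, advance]
    simp only [Pi.add_apply, Finset.sum_add_distrib, E.sum_bestBlock]
  have e2 : ∑ k, (fictHist s E B D μ₀ ξ ω (t + 1)).counts k =
      ∑ k, (fictHist s E B D μ₀ ξ ω t).counts k +
        ∑ k, s.acquire t (fictHist s E B D μ₀ ξ ω t) k := by
    rw [fictHist_succ, simStep, counts_snoc]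
    simp only [Pi.add_apply, Finset.sum_add_distrib]
  have e3 := advance.eq_1 s E B D μ₀ ξ ω t
  have e4 := advance.eq_1 s E B D μ₀ ξ ω (t + 1)
  omega

variable (B D)

/-- The payoff that the simulated strategy would have along a simulation. -/
noncomputable def fictPayoff (ξ : ℕ → Tape K) (ω : Outcome K) : EReal :=
  P.pathPayoff s fun t => (fictHist s E B D P.μ₀ ξ ω t, ω.1 0)

lemma measurable_fictPayoff :
    Measurable fun p : (ℕ → Tape K) × Outcome K => P.fictPayoff s E B D p.1 p.2 :=
  (P.measurable_pathPayoff s).comp (measurable_pi_lambda _ fun t =>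
    (measurable_fictHist s E B D P.μ₀ t).prodMk (by fun_prop))

variable {s E B D}

/-- The actions and the state are the same on both sides; only the costs differ, and a raised
intensity replaces `κ N` by `κ B`. -/
lemma fictPayoff_le (hκ : ∀ N, 1 ≤ N → N < B → P.κ B ≤ P.κ N) (ξ : ℕ → Tape K) (ω : Outcome K) :
    P.fictPayoff s E B D ξ ω ≤ P.payoff E (simStrategy s E B D P.μ₀ ξ) ω := by
  refine EReal.sub_le_sub le_rfl (EReal.coe_ennreal_le_coe_ennreal_iff.2 ?_)
  rw [totalCost_simStrategy]
  refine ENNReal.tsum_le_tsum fun t => ?_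
  gcongr
  unfold InfoEnv.boost
  split_ifs with h
  · exact hκ _ h.1 h.2.1
  · exact le_rfl

/-- The payoff depends on the whole sequence of histories, so equality in law at each time is passed
on through `lintegral_histories_eq`. -/
lemma lintegral_fictPayoff (hV : E.V₀.PosDef) (hσ : ∀ k, 0 < E.sigmaSq k)
    {R : (Fin K → ℕ) → (Fin K → ℕ) → Prop} (hR : E.IsSimulationInvariant B D R)
    {f : EReal → ℝ≥0∞} (hf : Measurable f) :
    ∫⁻ p, f (P.fictPayoff s E B D p.1 p.2) ∂((tapesLaw E).prod (law E P.μ₀)) =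
      ∫⁻ ω, f (P.payoff E s ω) ∂(law E P.μ₀) := by
  refine lintegral_histories_eq
    (H₁ := fun p : (ℕ → Tape K) × Outcome K => fictHist s E B D P.μ₀ p.1 p.2)
    (H₂ := fun ω => s.history E ω) (x₁ := fun p => p.2.1 0) (x₂ := fun ω => ω.1 0)
    (f := fun Z => f (P.pathPayoff s Z))
    (measurable_fictHist s E B D P.μ₀) (measurable_history s E) (by fun_prop) (by fun_prop)
    ?_ ?_ ?_ (hf.comp (P.measurable_pathPayoff s))
  · intro p t
    rw [fictHist_succ, simStep, Fin.init_snoc]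
  · intro ω t
    rw [history_succ, Fin.init_snoc]
  · intro t g hg
    rw [← lintegral_fictHist_state hV hσ hR t hg]
    refine lintegral_prod (fun p : (ℕ → Tape K) × Outcome K =>
      g (fictHist s E B D P.μ₀ p.1 p.2 t, p.2.1 0)) (Measurable.aemeasurable ?_)
    exact hg.comp ((measurable_fictHist s E B D P.μ₀ t).prodMk (by fun_prop))

/-- A simulation saves only a bounded amount. -/
lemma payoff_simStrategy_le {R : (Fin K → ℕ) → (Fin K → ℕ) → Prop}
    (hR : E.IsSimulationInvariant B D R) (ξ : ℕ → Tape K) (ω : Outcome K)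
    (h : (∀ N, 1 ≤ N → N < B → P.κ N ≠ ∞) ∨ P.fictPayoff s E B D ξ ω ≠ ⊥) :
    P.payoff E (simStrategy s E B D P.μ₀ ξ) ω ≤ P.fictPayoff s E B D ξ ω +
      (((∑ n ∈ Finset.range B, if P.κ n = ∞ then 0 else P.κ n) * D : ℝ≥0∞) : EReal) := by
  refine sub_le_sub_add ?_ ?_
  · refine ENNReal.mul_ne_top (ENNReal.sum_ne_top.2 fun n _ => ?_) (ENNReal.natCast_ne_top D)
    split_ifs with h
    · exact ENNReal.zero_ne_top
    · exact h
  · rw [totalCost_simStrategy]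
    refine tsum_cost_le (ENNReal.ofReal_le_one.2 P.δ_le_one)
      (advance_succ s E hR P.μ₀ ξ ω) fun t h1 h2 => ?_
    rcases h with h | h
    · exact h _ h1 h2
    · intro htop
      apply h
      have hcost : ∑' t, ENNReal.ofReal P.δ ^ t *
          P.κ (∑ k, s.acquire t (fictHist s E B D P.μ₀ ξ ω t) k) = ∞ := by
        refine ENNReal.tsum_eq_top_of_eq_top ⟨t, ?_⟩
        rw [htop, ENNReal.mul_top]
        exact pow_ne_zero _ (ENNReal.ofReal_pos.2 P.δ_pos).ne'
      rw [fictPayoff, pathPayoff]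
      simp only [hcost, EReal.coe_ennreal_top, EReal.sub_top]

variable (E)

/-- If some intensity is infinitely costly, then there is a myopic strategy that always pays this
cost. -/
lemma exists_myopic_bot (s : Strategy K A) {N : ℕ} (hN : P.κ N = ∞) :
    ∃ s' : Strategy K A, s'.Myopic E ∧ P.WellDefined E s' := by
  refine ⟨{ s with
    acquire := fun t h => E.bestBlock h.counts N
    measurable_acquire := fun t =>
      (Measurable.of_discrete (f := fun c => E.bestBlock c N)).comp measurable_counts }, ?_, ?_⟩
  · intro t h m hm
    refine E.posteriorVar_bestBlock_le h.counts ?_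
    rw [hm]
    exact E.sum_bestBlock _ _
  · rw [WellDefined]
    refine (lintegral_congr fun ω => ?_).trans_lt (lt_of_eq_of_lt lintegral_zero ENNReal.zero_lt_top)
    rw [EReal.toENNReal_eq_zero_iff, payoff, totalCost]
    simp only [E.sum_bestBlock, hN]
    have : ∑' t, ENNReal.ofReal P.δ ^ t * ∞ = ∞ :=
      ENNReal.tsum_eq_top_of_eq_top ⟨0, by simp⟩
    rw [this, EReal.coe_ennreal_top, EReal.sub_top]
    exact bot_le

variable {E}

theorem exists_myopic_dominating (hV : E.V₀.PosDef) (hσ : ∀ k, 0 < E.sigmaSq k)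
    {R : (Fin K → ℕ) → (Fin K → ℕ) → Prop} (hR : E.IsSimulationInvariant B D R)
    (hκ : ∀ N, 1 ≤ N → N < B → P.κ B ≤ P.κ N) (hs : P.WellDefined E s) :
    ∃ s' : Strategy K A, s'.Myopic E ∧ P.WellDefined E s' ∧
      P.expectedPayoff E s ≤ P.expectedPayoff E s' := by
  by_cases hcase : (∀ N, 1 ≤ N → N < B → P.κ N ≠ ∞) ∨
      ∫⁻ ω, (-P.payoff E s ω).toENNReal ∂(law E P.μ₀) ≠ ∞
  · have hpos : Measurable EReal.toENNReal := measurable_ereal_toENNReal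
    have hneg : Measurable fun x : EReal => (-x).toENNReal := by fun_prop
    have hX := P.measurable_payoff_simStrategy s E B D
    have hY := P.measurable_fictPayoff s E B D
    have hpX : Measurable fun p : (ℕ → Tape K) × Outcome K =>
        (P.payoff E (simStrategy s E B D P.μ₀ p.1) p.2).toENNReal := hpos.comp hX
    have hnX : Measurable fun p : (ℕ → Tape K) × Outcome K =>
        (-P.payoff E (simStrategy s E B D P.μ₀ p.1) p.2).toENNReal := hneg.comp hX
    set M : ℝ≥0∞ := (∑ n ∈ Finset.range B, if P.κ n = ∞ then 0 else P.κ n) * D with hM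
    have hMtop : M ≠ ∞ := by
      refine ENNReal.mul_ne_top (ENNReal.sum_ne_top.2 fun n _ => ?_) (ENNReal.natCast_ne_top D)
      split_ifs with h
      · exact ENNReal.zero_ne_top
      · exact h
    have hbound : ∀ᵐ p ∂((tapesLaw E).prod (law E P.μ₀)),
        (P.payoff E (simStrategy s E B D P.μ₀ p.1) p.2).toENNReal ≤
          (P.fictPayoff s E B D p.1 p.2).toENNReal + M := by
      -- If the negative part of the payoff of `s` has finite expectation, then so has that of the
      -- fictitious payoff, which therefore equals `-∞` with probability zero.
      have hae : ∀ᵐ p ∂((tapesLaw E).prod (law E P.μ₀)),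
          (∀ N, 1 ≤ N → N < B → P.κ N ≠ ∞) ∨ P.fictPayoff s E B D p.1 p.2 ≠ ⊥ := by
        rcases hcase with h | h
        · exact Filter.Eventually.of_forall fun _ => Or.inl h
        · rw [← P.lintegral_fictPayoff hV hσ hR hneg] at h
          filter_upwards [ae_lt_top (hneg.comp hY) h] with p hp
          right
          intro hbot
          simp [hbot] at hp
      filter_upwards [hae] with p hp
      refine (EReal.toENNReal_le_toENNReal (P.payoff_simStrategy_le hR p.1 p.2 hp)).trans ?_
      exact EReal.toENNReal_add_le.trans (by rw [EReal.toENNReal_coe])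
    have hpE := lintegral_prod (μ := tapesLaw E) (ν := law E P.μ₀) _ hpX.aemeasurable
    have hnE := lintegral_prod (μ := tapesLaw E) (ν := law E P.μ₀) _ hnX.aemeasurable
    have hp_int : ∫⁻ ξ, ∫⁻ ω, (P.payoff E (simStrategy s E B D P.μ₀ ξ) ω).toENNReal
        ∂(law E P.μ₀) ∂(tapesLaw E) ≠ ∞ := by
      rw [← hpE]
      refine ne_top_of_le_ne_top ?_ (lintegral_mono_ae hbound)
      rw [lintegral_add_right _ measurable_const, P.lintegral_fictPayoff hV hσ hR hpos]
      simp only [lintegral_const, measure_univ, mul_one]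
      exact ENNReal.add_ne_top.2 ⟨hs.ne, hMtop⟩
    -- Fixing the tapes turns the randomized simulation into a pure strategy that is at least as
    -- good as `s`.
    obtain ⟨ξ, hξ, hle⟩ := exists_le_sub (μ := tapesLaw E)
      (hpX.lintegral_prod_right' (ν := law E P.μ₀)) (hnX.lintegral_prod_right' (ν := law E P.μ₀))
      (a := ∫⁻ ω, (P.payoff E s ω).toENNReal ∂(law E P.μ₀))
      (b := ∫⁻ ω, (-P.payoff E s ω).toENNReal ∂(law E P.μ₀)) hs.ne hp_int
      (by
        rw [← hpE, ← P.lintegral_fictPayoff hV hσ hR hpos]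
        exact lintegral_mono fun p => EReal.toENNReal_le_toENNReal (P.fictPayoff_le hκ p.1 p.2))
      (by
        rw [← hnE, ← P.lintegral_fictPayoff hV hσ hR hneg]
        exact lintegral_mono fun p => EReal.toENNReal_le_toENNReal
          (EReal.neg_le_neg_iff.2 (P.fictPayoff_le hκ p.1 p.2)))
    exact ⟨simStrategy s E B D P.μ₀ ξ, simStrategy_myopic s E B D P.μ₀ ξ, hξ, hle⟩
  -- Here some intensity is infinitely costly and the negative part of the payoff of `s` has
  -- infinite expectation, so the expected payoff of `s` is `-∞`.
  · push Not at hcase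
    obtain ⟨⟨N, -, -, hN⟩, hinf⟩ := hcase
    obtain ⟨s', hm, hw⟩ := P.exists_myopic_bot E s hN
    refine ⟨s', hm, hw, ?_⟩
    rw [expectedPayoff, hinf, EReal.coe_ennreal_top, EReal.sub_top]
    exact bot_le

theorem myopicOptimal (hV : E.V₀.PosDef) (hσ : ∀ k, 0 < E.sigmaSq k)
    {R : (Fin K → ℕ) → (Fin K → ℕ) → Prop} (hR : E.IsSimulationInvariant B D R)
    (hκ : ∀ N, 1 ≤ N → N < B → P.κ B ≤ P.κ N) : P.MyopicOptimal E := by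
  refine ⟨fun s hs => P.exists_myopic_dominating hV hσ hR hκ hs, ?_⟩
  rintro ⟨s, hs, hopt⟩
  obtain ⟨s', hm, hw, hle⟩ := P.exists_myopic_dominating hV hσ hR hκ hs
  exact ⟨s', ⟨hw, fun r hr => (hopt r hr).trans hle⟩, hm⟩

end DecisionProblem

end payoffs

end SignalAcquisition

/-! ### The theorem, from the two simulation invariants. -/

theorem corollary2 {K : ℕ} [NeZero K] (E : SignalAcquisition.InfoEnv K)
    (hV : E.V₀.PosDef) (hσ : ∀ k, 0 < E.sigmaSq k) (hC : E.NonRedundant) :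
    (∃ B₀ : ℕ, ∀ B : ℕ, B₀ ≤ B →
      ∀ (A : ℕ → Type u) [∀ t, MeasurableSpace (A t)]
        (P : SignalAcquisition.DecisionProblem K A),
        (∀ N : ℕ, 1 ≤ N → N ≤ B → P.κ B ≤ P.κ N) → P.MyopicOptimal E) ∧
    (E.Separable →
      ∀ (A : ℕ → Type u) [∀ t, MeasurableSpace (A t)]
        (P : SignalAcquisition.DecisionProblem K A), P.MyopicOptimal E) := by
  constructor
  · obtain ⟨D, hD⟩ := E.exists_simulationInvariant hV hσ hC
    refine ⟨D, fun B hB A _ P hκ => ?_⟩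
    obtain ⟨R, hR⟩ := hD B hB
    exact P.myopicOptimal hV hσ hR fun N h1 h2 => hκ N h1 h2.le
  -- With `B = 0` the condition on costs is vacuous.
  · intro hsep A _ P
    exact P.myopicOptimal hV hσ (SignalAcquisition.InfoEnv.Separable.simulationInvariant E hV hσ hC hsep)
      fun N _ h => absurd h N.not_lt_zero
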